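/- Let $n\ge 2$ be an even integer, let $k$ be a field with $\operatorname{char} k\nmid 2n^2$ containing a primitive $n$-th root of unity $q$, and let $q^{1/2}\in k$ be a square root of $q$; write $q^{m^2/2}:=(q^{1/2})^{m^2}$. Let $H_{2n^2}$ be the Hopf algebra over $k$ generated as an algebra by $x,y,z$ with relations $$x^n=1,\quad y^n=1,\quad xy=yx,\quad zx=yz,\quad zy=xz,\quad z^2=\frac1n\sum_{i,j=0}^{n-1}q^{-ij}x^iy^j,$$ and with comultiplication, counit and antipode $$\Delta(x)=x\otimes x,\quad \Delta(y)=y\otimes y,\quad \Delta(z)=\frac1n\sum_{i,j=0}^{n-1}q^{-ij}x^iz\otimes y^jz,$$ $$\varepsilon(x)=\varepsilon(y)=\varepsilon(z)=1,\quad S(x)=x^{-1},\ S(y)=y^{-1},\ S(z)=z.$$ Let $r(H_{2n^2})$ be its Grothendieck (Green) ring: the quotient of the free abelian group on the isomorphism classes $[M]$ of finite-dimensional $H_{2n^2}$-modules by the relations $[M\oplus N]=[M]+[N]$, with product $[M][N]=[M\otimes N]$. For $0\le m\le 2n-1$ let $S_m$ be the one-dimensional module on which $x$ and $y$ act by $q^m$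 and $z$ acts by $\sigma(m)q^{m^2/2}$, where $\sigma(m)=1$ if $m\le n-1$ and $\sigma(m)=-1$ if $m\ge n$. Let $S_{0,1}$ be the two-dimensional module with basis $v_1,v_2$ on which $$xv_1=v_1,\quad xv_2=qv_2,\quad yv_1=qv_1,\quad yv_2=v_2,\quad zv_1=v_2,\quad zv_2=v_1.$$ Define the generalized Fibonacci polynomials by $F_0=0$, $F_1=1$, $F_{t+2}(y,z)=zF_{t+1}(y,z)-yF_t(y,z)$ for $t\ge 0$. Then there is an ideal $I$ of the commutative polynomial ring $\mathbb Z[x,y,z]$, described below, and a ring isomorphism $\mathbb Z[x,y,z]/I\cong r(H_{2n^2})$ that sends the classes of $x,y,z$ to $[S_1],[S_{n+1}],[S_{0,1}]$ respectively. (a) If $n=2$, then $I$ is generated by $y^2-1$, $x^2-y^2$, $zx-zy$, $z-zy$ and $z^2-x-y-xy-1$. (b) If $n>2$ and $m:=n/2$, then $I$ is generated by $x^n-1$, $x^2-y^2$, $zx-zy$ and the two elements $$z^m-z^my^m+\sum_{i=1}^{\lfloor m/2\rfloor}(-1)^i\binom{m-i}{i}y^iz^{m-2i}-\sum_{i=1}^{\lfloor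 m/2\rfloor}(-1)^i\binom{m-i}{i}y^{m+i}z^{m-2i}-xF_{m-1}(y,z)+xy^mF_{m-1}(y,z),$$ $$z^{m+1}-z^{m-1}y^{m+1}+\sum_{i=1}^{\lfloor (m+1)/2\rfloor}(-1)^i\binom{m+1-i}{i}y^iz^{m+1-2i}-\sum_{i=1}^{\lfloor (m-1)/2\rfloor}(-1)^i\binom{m-1-i}{i}y^{m+1+i}z^{m-1-2i}-xF_m(y,z)+xy^{m+1}F_{m-2}(y,z).$$ -/

import Mathlib

open scoped TensorProduct

universe u v

noncomputable section

/-! ## Finite-dimensional modules over a bialgebra and the Green ring -/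

/-- A finite-dimensional module over a `k`-algebra `H`: a finite-dimensional `k`-vector space `V`
together with a homomorphism of `k`-algebras `H → End_k V`. -/
structure FinMod (k : Type u) (H : Type v) [Field k] [Ring H] [Algebra k H] where
  V : Type u
  [addCommGroup : AddCommGroup V]
  [module : Module k V]
  [finiteDimensional : FiniteDimensional k V]
  ρ : H →ₐ[k] Module.End k V

attribute [instance] FinMod.addCommGroup FinMod.module FinMod.finiteDimensional

namespace FinMod

section Algebra

variable {k : Type u} {H : Type v} [Field k] [Ring H] [Algebra k H]

/-- Two modules are isomorphic if there is a bijective linear map commuting with the action. -/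
def Iso (M N : FinMod k H) : Prop :=
  ∃ e : M.V ≃ₗ[k] N.V, ∀ (h : H) (v : M.V), e (M.ρ h v) = N.ρ h (e v)

/-- The direct sum `M ⊕ N`, with `h (v, w) = (h v, h w)`. -/
def directSum (M N : FinMod k H) : FinMod k H where
  V := M.V × N.V
  ρ := (LinearMap.prodMapAlgHom k M.V N.V).comp (M.ρ.prod N.ρ)

variable (k H) in
theorem iso_equivalence : Equivalence (Iso (k := k) (H := H)) where
  refl M := ⟨LinearEquiv.refl k M.V, fun _ _ => rfl⟩
  symm := by
    rintro M N ⟨e, he⟩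
    refine ⟨e.symm, fun h v => ?_⟩
    apply e.injective
    simp [he]
  trans := by
    rintro M N P ⟨e, he⟩ ⟨f, hf⟩
    exact ⟨e.trans f, fun h v => by simp [he, hf]⟩

variable (k H) in
/-- The isomorphism relation as a setoid. -/
def isoSetoid : Setoid (FinMod k H) := ⟨Iso, iso_equivalence k H⟩

end Algebra

section Bialgebra

variable {k : Type u} {H : Type v} [Field k] [Ring H] [Bialgebra k H]

/-- The tensor product `M ⊗ N`, with `h (v ⊗ w) = ∑ h₍₁₎ v ⊗ h₍₂₎ w`. -/
def tensor (M N : FinMod k H) : FinMod k H where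
  V := M.V ⊗[k] N.V
  ρ := (Module.endTensorEndAlgHom (R := k) (S := k) (A := k) (M := M.V) (N := N.V)).comp
    ((Algebra.TensorProduct.map M.ρ N.ρ).comp (Bialgebra.comulAlgHom k H))

variable (k H) in
/-- The trivial one-dimensional module: `h v = ε(h) v` on `k`. -/
def trivial : FinMod k H where
  V := k
  ρ := (Algebra.lmul k k).comp (Bialgebra.counitAlgHom k H)

/-- The action of `H ⊗ H` on `V ⊗ W`. -/
def act₂ (M N : FinMod k H) : H ⊗[k] H →ₐ[k] Module.End k (M.V ⊗[k] N.V) :=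
  (Module.endTensorEndAlgHom (R := k) (S := k) (A := k) (M := M.V) (N := N.V)).comp
    (Algebra.TensorProduct.map M.ρ N.ρ)

@[simp] theorem act₂_tmul (M N : FinMod k H) (a b : H) (v : M.V) (w : N.V) :
    act₂ M N (a ⊗ₜ b) (v ⊗ₜ w) = M.ρ a v ⊗ₜ N.ρ b w := rfl

theorem tensor_ρ (M N : FinMod k H) (h : H) :
    (tensor M N).ρ h = act₂ M N (Coalgebra.comul h) := rfl

theorem tensor_iso {M M' N N' : FinMod k H} (h₁ : Iso M M') (h₂ : Iso N N') :
    Iso (tensor M N) (tensor M' N') := by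
  obtain ⟨e, he⟩ := h₁
  obtain ⟨f, hf⟩ := h₂
  refine ⟨TensorProduct.congr e f, fun h v => ?_⟩
  rw [tensor_ρ, tensor_ρ]
  generalize (Coalgebra.comul h : H ⊗[k] H) = t
  change (TensorProduct.congr e f) (act₂ M N t v) =
    act₂ M' N' t ((TensorProduct.congr e f : M.V ⊗[k] N.V ≃ₗ[k] M'.V ⊗[k] N'.V) v)
  change M.V ⊗[k] N.V at v
  induction t using TensorProduct.induction_on with
  | zero => simp
  | add a b ha hb => simp only [map_add, LinearMap.add_apply, ha, hb]
  | tmul a b =>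
    induction v using TensorProduct.induction_on with
    | zero => simp
    | add a b ha hb => simp only [map_add, ha, hb]
    | tmul v w => simp [he, hf]

theorem tensor_assoc (M N P : FinMod k H) :
    Iso (tensor (tensor M N) P) (tensor M (tensor N P)) := by
  refine ⟨TensorProduct.assoc k M.V N.V P.V, fun h v => ?_⟩
  change (M.V ⊗[k] N.V) ⊗[k] P.V at v
  let A := TensorProduct.assoc k M.V N.V P.V
  let act₃ : H ⊗[k] (H ⊗[k] H) →ₐ[k] Module.End k (M.V ⊗[k] (N.V ⊗[k] P.V)) :=
    (Module.endTensorEndAlgHom (R := k) (S := k) (A := k)).comp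
      (Algebra.TensorProduct.map M.ρ (act₂ N P))
  have act₃_tmul : ∀ (a : H) (t : H ⊗[k] H) (v : M.V) (w : N.V ⊗[k] P.V),
      act₃ (a ⊗ₜ t) (v ⊗ₜ w) = M.ρ a v ⊗ₜ act₂ N P t w := fun _ _ _ _ => rfl
  have key : ∀ s : (H ⊗[k] H) ⊗[k] H, ∀ v : (M.V ⊗[k] N.V) ⊗[k] P.V,
      A (((Module.endTensorEndAlgHom (R := k) (S := k) (A := k)).comp
        (Algebra.TensorProduct.map (act₂ M N) P.ρ)) s v) =
      act₃ (TensorProduct.assoc k H H H s) (A v) := by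
    intro s v
    induction s using TensorProduct.induction_on with
    | zero => simp
    | add a b ha hb => simp only [map_add, LinearMap.add_apply, ha, hb]
    | tmul t c =>
      induction t using TensorProduct.induction_on with
      | zero => simp
      | add a b ha hb => simp only [map_add, LinearMap.add_apply, TensorProduct.add_tmul, ha, hb]
      | tmul a b =>
        induction v using TensorProduct.induction_on with
        | zero => simp
        | add a b ha hb => simp only [map_add, ha, hb]
        | tmul v w =>
          induction v using TensorProduct.induction_on with
          | zero => simp
          | add a b ha hb => simp only [map_add, TensorProduct.add_tmul, ha, hb]
          | tmul v w' => rfl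
  have h1 : ∀ t : H ⊗[k] H, ∀ v : (M.V ⊗[k] N.V) ⊗[k] P.V, act₂ (tensor M N) P t v =
      ((Module.endTensorEndAlgHom (R := k) (S := k) (A := k)).comp
        (Algebra.TensorProduct.map (act₂ M N) P.ρ)) ((Coalgebra.comul (R := k)).rTensor H t) v := by
    intro t v
    induction t using TensorProduct.induction_on with
    | zero => simp; rfl
    | add a b ha hb =>
      simp only [map_add, LinearMap.add_apply, ← ha, ← hb]; rfl
    | tmul a b => rfl
  have h2 : ∀ t : H ⊗[k] H, ∀ v : M.V ⊗[k] (N.V ⊗[k] P.V), act₂ M (tensor N P) t v =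
      act₃ ((Coalgebra.comul (R := k)).lTensor H t) v := by
    intro t v
    induction t using TensorProduct.induction_on with
    | zero => simp; rfl
    | add a b ha hb =>
      simp only [map_add, LinearMap.add_apply, ← ha, ← hb]; rfl
    | tmul a b => rfl
  change A (act₂ (tensor M N) P (Coalgebra.comul h) v) =
    act₂ M (tensor N P) (Coalgebra.comul h) (A v)
  rw [h1, h2, key, Coalgebra.coassoc_apply]

theorem trivial_tensor (M : FinMod k H) : Iso (tensor (trivial k H) M) M := by
  refine ⟨TensorProduct.lid k M.V, fun h v => ?_⟩
  change k ⊗[k] M.V at v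
  have key : ∀ t : H ⊗[k] H, ∀ v : k ⊗[k] M.V,
      TensorProduct.lid k M.V (act₂ (trivial k H) M t v) =
      M.ρ (TensorProduct.lid k H ((Coalgebra.counit (R := k)).rTensor H t))
        (TensorProduct.lid k M.V v) := by
    intro t v
    induction t using TensorProduct.induction_on with
    | zero => simp; exact map_zero (TensorProduct.lid k M.V)
    | add a b ha hb =>
      simp only [map_add, LinearMap.add_apply, ← ha, ← hb]
      exact map_add (TensorProduct.lid k M.V) _ _
    | tmul a b =>
      induction v using TensorProduct.induction_on with
      | zero => simp; exact map_zero (TensorProduct.lid k M.V)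
      | add x y hx hy =>
        rw [map_add (TensorProduct.lid k M.V) x y, map_add, ← hx, ← hy]
        exact (congrArg _ (map_add (act₂ (trivial k H) M (a ⊗ₜ[k] b)) x y)).trans
          (map_add (TensorProduct.lid k M.V) _ _)
      | tmul c w =>
        change TensorProduct.lid k M.V ((Coalgebra.counit (R := k) a * c) ⊗ₜ[k] M.ρ b w) = _
        rw [TensorProduct.lid_tmul, LinearMap.rTensor_tmul, TensorProduct.lid_tmul,
          TensorProduct.lid_tmul, map_smul, mul_comm, mul_smul,
          map_smul M.ρ]
        rfl
  exact (key (Coalgebra.comul h) v).trans (by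
    rw [Coalgebra.rTensor_counit_comul, TensorProduct.lid_tmul, one_smul]; rfl)

theorem tensor_trivial (M : FinMod k H) : Iso (tensor M (trivial k H)) M := by
  refine ⟨TensorProduct.rid k M.V, fun h v => ?_⟩
  change M.V ⊗[k] k at v
  have key : ∀ t : H ⊗[k] H, ∀ v : M.V ⊗[k] k,
      TensorProduct.rid k M.V (act₂ M (trivial k H) t v) =
      M.ρ (TensorProduct.rid k H ((Coalgebra.counit (R := k)).lTensor H t))
        (TensorProduct.rid k M.V v) := by
    intro t v
    induction t using TensorProduct.induction_on with
    | zero => simp; exact map_zero (TensorProduct.rid k M.V)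
    | add a b ha hb =>
      simp only [map_add, LinearMap.add_apply, ← ha, ← hb]
      exact map_add (TensorProduct.rid k M.V) _ _
    | tmul a b =>
      induction v using TensorProduct.induction_on with
      | zero => simp; exact map_zero (TensorProduct.rid k M.V)
      | add x y hx hy =>
        rw [map_add (TensorProduct.rid k M.V) x y, map_add, ← hx, ← hy]
        exact (congrArg _ (map_add (act₂ M (trivial k H) (a ⊗ₜ[k] b)) x y)).trans
          (map_add (TensorProduct.rid k M.V) _ _)
      | tmul w c =>
        change TensorProduct.rid k M.V (M.ρ a w ⊗ₜ[k] (Coalgebra.counit (R := k) b * c)) = _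
        rw [TensorProduct.rid_tmul, LinearMap.lTensor_tmul, TensorProduct.rid_tmul,
          TensorProduct.rid_tmul, map_smul, mul_comm, mul_smul,
          map_smul M.ρ]
        rfl
  exact (key (Coalgebra.comul h) v).trans (by
    rw [Coalgebra.lTensor_counit_comul, TensorProduct.rid_tmul, one_smul]; rfl)

end Bialgebra

end FinMod

/-- Isomorphism classes of finite-dimensional `H`-modules. -/
def IsoClass (k : Type u) (H : Type v) [Field k] [Ring H] [Algebra k H] :=
  Quotient (FinMod.isoSetoid k H)

/-- The isomorphism class of a module. -/
def FinMod.isoClass {k : Type u} {H : Type v} [Field k] [Ring H] [Algebra k H] (M : FinMod k H) :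
    IsoClass k H :=
  Quotient.mk (FinMod.isoSetoid k H) M

/-- Isomorphism classes form a monoid under tensor product. -/
instance IsoClass.instMonoid (k : Type u) (H : Type v) [Field k] [Ring H] [Bialgebra k H] :
    Monoid (IsoClass k H) where
  mul := Quotient.map₂ FinMod.tensor (fun _ _ h₁ _ _ h₂ => FinMod.tensor_iso h₁ h₂)
  one := (FinMod.trivial k H).isoClass
  mul_assoc := by
    rintro ⟨M⟩ ⟨N⟩ ⟨P⟩
    exact Quotient.sound (FinMod.tensor_assoc M N P)
  one_mul := by
    rintro ⟨M⟩
    exact Quotient.sound (FinMod.trivial_tensor M)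
  mul_one := by
    rintro ⟨M⟩
    exact Quotient.sound (FinMod.tensor_trivial M)

/-- The relations `[M ⊕ N] = [M] + [N]` in the free abelian group on isomorphism classes; the
latter, with the product `[M][N] = [M ⊗ N]`, is the monoid ring `ℤ[IsoClass k H]`. -/
inductive GreenRel (k : Type u) (H : Type v) [Field k] [Ring H] [Bialgebra k H] :
    MonoidAlgebra ℤ (IsoClass k H) → MonoidAlgebra ℤ (IsoClass k H) → Prop
  | directSum (M N : FinMod k H) :
      GreenRel k H (MonoidAlgebra.of ℤ (IsoClass k H) (M.directSum N).isoClass)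
        (MonoidAlgebra.of ℤ (IsoClass k H) M.isoClass +
          MonoidAlgebra.of ℤ (IsoClass k H) N.isoClass)

/-- The Green ring (representation ring) `r(H)`: the quotient of the free abelian group on the
isomorphism classes of finite-dimensional `H`-modules by the relations `[M ⊕ N] = [M] + [N]`,
with multiplication `[M][N] = [M ⊗ N]`. -/
def GreenRing (k : Type u) (H : Type v) [Field k] [Ring H] [Bialgebra k H] :=
  RingQuot (GreenRel k H)

instance GreenRing.instRing (k : Type u) (H : Type v) [Field k] [Ring H] [Bialgebra k H] :
    Ring (GreenRing k H) :=
  inferInstanceAs (Ring (RingQuot (GreenRel k H)))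

/-- The class `[M]` in the Green ring. -/
def FinMod.cls {k : Type u} {H : Type v} [Field k] [Ring H] [Bialgebra k H] (M : FinMod k H) :
    GreenRing k H :=
  RingQuot.mkRingHom (GreenRel k H) (MonoidAlgebra.of ℤ (IsoClass k H) M.isoClass)

/-! ## The quadratic sum `(1/n) ∑_{i,j} q^{-ij} X^i Y^j` -/

/-- `(1/n) ∑_{i,j=0}^{n-1} q^{-ij} X^i Y^j`. -/
def quadSum {k : Type*} {A : Type*} [Field k] [Ring A] [Algebra k A] (n : ℕ) (q : k) (X Y : A) :
    A :=
  (n : k)⁻¹ • ∑ i ∈ Finset.range n, ∑ j ∈ Finset.range n, (q⁻¹) ^ (i * j) • (X ^ i * Y ^ j)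

section QuadSum

variable {k : Type*} {A : Type*} {B : Type*} [Field k] [Ring A] [Algebra k A] [Ring B] [Algebra k B]
  {n : ℕ} {q : k}

/-- `(1/n) ∑_j q^{-ij} Y^j`. -/
def rootIdem (n : ℕ) (q : k) (i : ℕ) (Y : A) : A :=
  (n : k)⁻¹ • ∑ j ∈ Finset.range n, (q⁻¹) ^ (i * j) • Y ^ j

theorem quadSum_eq (X Y : A) :
    quadSum n q X Y = ∑ i ∈ Finset.range n, X ^ i * rootIdem n q i Y := by
  simp only [quadSum, rootIdem, Finset.smul_sum, Finset.mul_sum, mul_smul_comm]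

theorem map_quadSum (f : A →ₐ[k] B) (X Y : A) :
    f (quadSum n q X Y) = quadSum n q (f X) (f Y) := by
  simp [quadSum, map_sum]

theorem quadSum_comm {X Y : A} (h : Commute X Y) : quadSum n q X Y = quadSum n q Y X := by
  unfold quadSum
  rw [Finset.sum_comm]
  refine congrArg _ (Finset.sum_congr rfl fun j _ => Finset.sum_congr rfl fun i _ => ?_)
  rw [mul_comm i j, (h.pow_pow i j).eq]

theorem semiconjBy_quadSum {c a a' b b' : A} (ha : SemiconjBy c a a') (hb : SemiconjBy c b b') :
    SemiconjBy c (quadSum n q a b) (quadSum n q a' b') := by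
  unfold SemiconjBy quadSum
  rw [mul_smul_comm, smul_mul_assoc]
  congr 1
  simp only [Finset.mul_sum, Finset.sum_mul, mul_smul_comm, smul_mul_assoc]
  refine Finset.sum_congr rfl fun i _ => Finset.sum_congr rfl fun j _ => ?_
  rw [((ha.pow_right i).mul_right (hb.pow_right j)).eq]

theorem commute_quadSum {c a b : A} (ha : Commute c a) (hb : Commute c b) :
    Commute c (quadSum n q a b) :=
  semiconjBy_quadSum ha hb

theorem quadSum_op {a b : A} (h : Commute a b) :
    quadSum n q (MulOpposite.op a) (MulOpposite.op b) = MulOpposite.op (quadSum n q a b) := by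
  rw [quadSum_comm (X := MulOpposite.op a) (Y := MulOpposite.op b) (congrArg MulOpposite.op h.eq.symm)]
  unfold quadSum
  simp only [MulOpposite.op_smul, Finset.op_sum]
  refine congrArg _ ?_
  rw [Finset.sum_comm]
  refine Finset.sum_congr rfl fun i _ => Finset.sum_congr rfl fun j _ => ?_
  rw [← MulOpposite.op_pow, ← MulOpposite.op_pow, ← MulOpposite.op_mul, mul_comm i j]

open Classical in
theorem geom_root {r : k} (hr : r ^ n = 1) :
    ∑ j ∈ Finset.range n, r ^ j = if r = 1 then (n : k) else 0 := by
  split_ifs with h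
  · simp [h]
  · have := geom_sum_mul r n
    rw [hr, sub_self] at this
    exact (mul_eq_zero.1 this).resolve_right (sub_ne_zero.2 h)

variable [NeZero n]

theorem mul_rootIdem (hq : IsPrimitiveRoot q n) {Y : A} (hY : Y ^ n = 1) (i : ℕ) :
    Y * rootIdem n q i Y = q ^ i • rootIdem n q i Y := by
  have hq0 : q ≠ 0 := hq.ne_zero (NeZero.ne n)
  unfold rootIdem
  rw [mul_smul_comm, smul_comm]
  congr 1
  let g : ℕ → A := fun j => (q ^ i * (q⁻¹) ^ (i * j)) • Y ^ j
  have hg : ∀ j, g (j + 1) = (q⁻¹) ^ (i * j) • Y ^ (j + 1) := by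
    intro j
    simp only [g]
    congr 1
    rw [Nat.mul_succ, pow_add, mul_comm, mul_assoc, ← mul_pow, inv_mul_cancel₀ hq0, one_pow,
      mul_one]
  have h0 : g n = g 0 := by
    simp only [g, hY, pow_zero, mul_zero]
    rw [mul_comm i n, pow_mul, inv_pow, hq.pow_eq_one]
    simp
  have hs : ∑ j ∈ Finset.range n, g (j + 1) = ∑ j ∈ Finset.range n, g j := by
    have h1 := Finset.sum_range_succ g n
    have h2 := Finset.sum_range_succ' g n
    rw [h1, h0] at h2
    exact (add_right_cancel h2).symm
  rw [Finset.mul_sum, Finset.smul_sum]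
  refine Eq.trans (Finset.sum_congr rfl fun j _ => ?_) (hs.trans (Finset.sum_congr rfl fun j _ => ?_))
  · rw [hg, mul_smul_comm, pow_succ']
  · simp only [g, mul_smul]

theorem pow_mul_rootIdem (hq : IsPrimitiveRoot q n) {Y : A} (hY : Y ^ n = 1) (i j : ℕ) :
    Y ^ j * rootIdem n q i Y = (q ^ i) ^ j • rootIdem n q i Y := by
  induction j with
  | zero => simp
  | succ j ih => rw [pow_succ, mul_assoc, mul_rootIdem hq hY, mul_smul_comm, ih, smul_smul, pow_succ']

theorem rootIdem_mul_rootIdem (hq : IsPrimitiveRoot q n) {Y : A} (hY : Y ^ n = 1) {i l : ℕ}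
    (hi : i < n) (hl : l < n) :
    rootIdem n q i Y * rootIdem n q l Y = if i = l then rootIdem n q l Y else 0 := by
  have hq0 : q ≠ 0 := hq.ne_zero (NeZero.ne n)
  have hn : (n : k) ≠ 0 := (hq.neZero').out
  have h1 : rootIdem n q i Y * rootIdem n q l Y =
      ((n : k)⁻¹ * ∑ j ∈ Finset.range n, (q ^ l * (q⁻¹) ^ i) ^ j) • rootIdem n q l Y := by
    conv_lhs => rw [rootIdem]
    rw [smul_mul_assoc, Finset.sum_mul, mul_smul, Finset.sum_smul]
    refine congrArg _ (Finset.sum_congr rfl fun j _ => ?_)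
    rw [smul_mul_assoc, pow_mul_rootIdem hq hY, smul_smul, mul_pow, pow_mul (q⁻¹), mul_comm]
  rw [h1, geom_root]
  · have hiff : q ^ l * (q⁻¹) ^ i = 1 ↔ i = l := by
      rw [inv_pow, mul_inv_eq_one₀ (pow_ne_zero _ hq0)]
      exact ⟨fun h => (hq.pow_inj hl hi h).symm, fun h => by rw [h]⟩
    by_cases h : i = l
    · rw [if_pos (hiff.2 h), if_pos h, inv_mul_cancel₀ hn, one_smul]
    · rw [if_neg (mt hiff.1 h), if_neg h, mul_zero, zero_smul]
  · rw [mul_pow, ← pow_mul, ← pow_mul, mul_comm l, mul_comm i, pow_mul, pow_mul, inv_pow,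
      hq.pow_eq_one]
    simp

theorem quadSum_one_left (hq : IsPrimitiveRoot q n) (Y : A) : quadSum n q 1 Y = 1 := by
  have hq0 : q ≠ 0 := hq.ne_zero (NeZero.ne n)
  have hn : (n : k) ≠ 0 := (hq.neZero').out
  unfold quadSum
  rw [Finset.sum_comm]
  have h1 : ∀ j ∈ Finset.range n, ∑ i ∈ Finset.range n, (q⁻¹) ^ (i * j) • ((1 : A) ^ i * Y ^ j) =
      if j = 0 then (n : k) • (1 : A) else 0 := by
    intro j hj
    have h2 : ∑ i ∈ Finset.range n, (q⁻¹) ^ (i * j) • ((1 : A) ^ i * Y ^ j) =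
        (∑ i ∈ Finset.range n, ((q⁻¹) ^ j) ^ i) • Y ^ j := by
      rw [Finset.sum_smul]
      refine Finset.sum_congr rfl fun i _ => ?_
      rw [one_pow, one_mul, mul_comm, pow_mul]
    rw [h2, geom_root]
    · by_cases h : j = 0
      · simp [h]
      · rw [if_neg h, if_neg, zero_smul]
        rw [inv_pow, inv_eq_one]
        exact hq.pow_ne_one_of_pos_of_lt h (Finset.mem_range.1 hj)
    · rw [← pow_mul, mul_comm, pow_mul, inv_pow, hq.pow_eq_one]
      simp
  rw [Finset.sum_congr rfl h1, Finset.sum_ite_eq' (Finset.range n) 0,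
    if_pos (Finset.mem_range.2 (NeZero.pos n)), smul_smul, inv_mul_cancel₀ hn, one_smul]

theorem quadSum_mul_left (hq : IsPrimitiveRoot q n) {X X' Y : A} (hXX : Commute X X')
    (hXY : Commute X' Y) (hY : Y ^ n = 1) :
    quadSum n q (X * X') Y = quadSum n q X Y * quadSum n q X' Y := by
  have hc : ∀ i l, Commute (X' ^ l) (rootIdem n q i Y) := by
    intro i l
    unfold rootIdem
    exact (Commute.sum_right _ _ _ fun j _ => ((hXY.pow_pow l j).smul_right _)).smul_right _
  rw [quadSum_eq, quadSum_eq, quadSum_eq, Finset.sum_mul_sum]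
  refine Finset.sum_congr rfl fun i hi => ?_
  rw [Finset.sum_eq_single i]
  · rw [mul_assoc, ← mul_assoc (rootIdem n q i Y), ← (hc i i).eq, mul_assoc (X' ^ i),
      rootIdem_mul_rootIdem hq hY (Finset.mem_range.1 hi) (Finset.mem_range.1 hi), if_pos rfl,
      hXX.mul_pow, mul_assoc]
  · intro l hl hne
    rw [mul_assoc, ← mul_assoc (rootIdem n q i Y), ← (hc i l).eq, mul_assoc (X' ^ l),
      rootIdem_mul_rootIdem hq hY (Finset.mem_range.1 hi) (Finset.mem_range.1 hl),
      if_neg hne.symm, mul_zero, mul_zero]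
  · intro h
    exact absurd hi h

theorem quadSum_one_right (hq : IsPrimitiveRoot q n) (X : A) : quadSum n q X 1 = 1 := by
  rw [quadSum_comm (Commute.one_right X), quadSum_one_left hq]

theorem quadSum_mul_right (hq : IsPrimitiveRoot q n) {X Y Y' : A} (hYY : Commute Y Y')
    (hXY : Commute X Y) (hXY' : Commute X Y') (hX : X ^ n = 1) :
    quadSum n q X (Y * Y') = quadSum n q X Y * quadSum n q X Y' := by
  rw [quadSum_comm (hXY.mul_right hXY'), quadSum_mul_left hq hYY hXY'.symm hX,
    quadSum_comm hXY, quadSum_comm hXY']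

theorem quadSum_inv_mul (hq : IsPrimitiveRoot q n) {X X' Y : A} (h : X' * X = 1)
    (h' : X * X' = 1) (hXY : Commute X Y) (hY : Y ^ n = 1) :
    quadSum n q X' Y * quadSum n q X Y = 1 := by
  rw [← quadSum_mul_left hq (h.trans h'.symm) hXY hY, h, quadSum_one_left hq]

theorem quadSum_inv_inv (hq : IsPrimitiveRoot q n) {X X' Y Y' : A} (h : X' * X = 1)
    (h' : X * X' = 1) (g : Y' * Y = 1) (g' : Y * Y' = 1) (hXY : Commute X Y)
    (hX'Y : Commute X' Y) (hX'Y' : Commute X' Y')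
    (hX' : X' ^ n = 1) (hY : Y ^ n = 1) :
    quadSum n q X' Y' = quadSum n q X Y := by
  have h1 : quadSum n q X' Y * quadSum n q X Y = 1 := quadSum_inv_mul hq h h' hXY hY
  have h2 : quadSum n q X' Y' * quadSum n q X' Y = 1 := by
    rw [quadSum_comm hX'Y', quadSum_comm hX'Y]
    exact quadSum_inv_mul hq g g' hX'Y.symm hX'
  exact left_inv_eq_right_inv h2 h1

open Classical in
theorem quadSum_gen (hq : IsPrimitiveRoot q n) {x : k} (hx : x ^ n = 1) :
    quadSum n q x q = x := by
  have hq0 : q ≠ 0 := hq.ne_zero (NeZero.ne n)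
  have hn : (n : k) ≠ 0 := (hq.neZero').out
  have h1 : ∀ i, rootIdem n q i q = if q * (q⁻¹) ^ i = 1 then 1 else 0 := by
    intro i
    have : rootIdem n q i q = (n : k)⁻¹ * ∑ j ∈ Finset.range n, (q * (q⁻¹) ^ i) ^ j := by
      rw [rootIdem, smul_eq_mul]
      refine congrArg _ (Finset.sum_congr rfl fun j _ => ?_)
      rw [smul_eq_mul, mul_pow, pow_mul, mul_comm]
    rw [this, geom_root]
    · split_ifs
      · exact inv_mul_cancel₀ hn
      · exact mul_zero _
    · rw [mul_pow, ← pow_mul, mul_comm i, pow_mul, inv_pow, hq.pow_eq_one]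
      simp
  have hmod : ∀ i, q * (q⁻¹) ^ i = 1 ↔ 1 ≡ i [MOD n] := by
    intro i
    have hfin : IsOfFinOrder q := isOfFinOrder_iff_pow_eq_one.2 ⟨n, NeZero.pos n, hq.pow_eq_one⟩
    have := hfin.pow_eq_pow_iff_modEq (n := 1) (m := i)
    rw [pow_one, ← hq.eq_orderOf] at this
    rw [inv_pow, mul_inv_eq_one₀ (pow_ne_zero _ hq0), this]
  rw [quadSum_eq, Finset.sum_eq_single (1 % n)]
  · rw [h1, if_pos ((hmod _).2 (Nat.mod_modEq 1 n).symm), mul_one]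
    calc x ^ (1 % n) = x ^ (1 % n + n * (1 / n)) := by rw [pow_add, pow_mul, hx]; simp
      _ = x := by rw [Nat.mod_add_div, pow_one]
  · intro i hi hne
    rw [h1, if_neg, mul_zero]
    intro h
    apply hne
    have := (hmod i).1 h
    rw [Nat.ModEq, Nat.mod_eq_of_lt (Finset.mem_range.1 hi)] at this
    exact this.symm
  · intro h
    exact absurd (Finset.mem_range.2 (Nat.mod_lt 1 (NeZero.pos n))) h

theorem quadSum_pow (hq : IsPrimitiveRoot q n) (a b : ℕ) :
    quadSum n q (q ^ a) (q ^ b) = q ^ (a * b) := by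
  have ha : (q ^ a) ^ n = 1 := by rw [← pow_mul, mul_comm, pow_mul, hq.pow_eq_one, one_pow]
  induction b with
  | zero => rw [pow_zero, quadSum_one_right hq, mul_zero, pow_zero]
  | succ b ih =>
    rw [pow_succ, quadSum_mul_right hq (Commute.all _ _) (Commute.all _ _) (Commute.all _ _) ha, ih,
      quadSum_gen hq ha, Nat.mul_succ, pow_add]

end QuadSum

/-! ## The Hopf algebra `H_{2n²}` -/

namespace KacPaljutkin

/-- The three generators. -/
inductive Gen : Type
  | x | y | z

open FreeAlgebra in
/-- The defining relations `x^n = 1`, `y^n = 1`, `xy = yx`, `zx = yz`, `zy = xz`,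
`z² = (1/n) ∑_{i,j} q^{-ij} x^i y^j`. -/
inductive Rel {k : Type u} [Field k] (n : ℕ) (q : k) :
    FreeAlgebra k Gen → FreeAlgebra k Gen → Prop
  | x_pow : Rel n q (ι k Gen.x ^ n) 1
  | y_pow : Rel n q (ι k Gen.y ^ n) 1
  | xy : Rel n q (ι k Gen.x * ι k Gen.y) (ι k Gen.y * ι k Gen.x)
  | zx : Rel n q (ι k Gen.z * ι k Gen.x) (ι k Gen.y * ι k Gen.z)
  | zy : Rel n q (ι k Gen.z * ι k Gen.y) (ι k Gen.x * ι k Gen.z)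
  | z_sq : Rel n q (ι k Gen.z ^ 2)
      ((n : k)⁻¹ • ∑ i ∈ Finset.range n, ∑ j ∈ Finset.range n,
        (q⁻¹) ^ (i * j) • (ι k Gen.x ^ i * ι k Gen.y ^ j))

/-- The algebra `H_{2n²}` over `k`, where `q` is a primitive `n`-th root of unity. -/
def H {k : Type u} [Field k] {n : ℕ} {q : k} (_hq : IsPrimitiveRoot q n) : Type u :=
  RingQuot (Rel n q)

section

variable {k : Type u} [Field k] {n : ℕ} {q : k} (hq : IsPrimitiveRoot q n)

instance : Ring (H hq) := inferInstanceAs (Ring (RingQuot (Rel n q)))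

instance : Algebra k (H hq) := inferInstanceAs (Algebra k (RingQuot (Rel n q)))

/-- The image of a generator in `H_{2n²}`. -/
def gen (g : Gen) : H hq := RingQuot.mkAlgHom k (Rel n q) (FreeAlgebra.ι k g)

/-- The generator `x`. -/
abbrev x : H hq := gen hq Gen.x
/-- The generator `y`. -/
abbrev y : H hq := gen hq Gen.y
/-- The generator `z`. -/
abbrev z : H hq := gen hq Gen.z

/-- Three elements of an algebra satisfying the defining relations of `H_{2n²}`. -/
structure IsTriple {A : Type*} [Ring A] [Algebra k A] (n : ℕ) (q : k) (a b c : A) : Prop where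
  x_pow : a ^ n = 1
  y_pow : b ^ n = 1
  xy : a * b = b * a
  zx : c * a = b * c
  zy : c * b = a * c
  z_sq : c ^ 2 = quadSum n q a b

theorem isTriple_gen : IsTriple n q (x hq) (y hq) (z hq) where
  x_pow := by
    have := RingQuot.mkAlgHom_rel k (Rel.x_pow (n := n) (q := q))
    rwa [map_pow, map_one] at this
  y_pow := by
    have := RingQuot.mkAlgHom_rel k (Rel.y_pow (n := n) (q := q))
    rwa [map_pow, map_one] at this
  xy := by
    have := RingQuot.mkAlgHom_rel k (Rel.xy (n := n) (q := q))
    rwa [map_mul, map_mul] at this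
  zx := by
    have := RingQuot.mkAlgHom_rel k (Rel.zx (n := n) (q := q))
    rwa [map_mul, map_mul] at this
  zy := by
    have := RingQuot.mkAlgHom_rel k (Rel.zy (n := n) (q := q))
    rwa [map_mul, map_mul] at this
  z_sq := by
    have := RingQuot.mkAlgHom_rel k (Rel.z_sq (n := n) (q := q))
    rw [map_pow] at this
    exact this.trans (map_quadSum (RingQuot.mkAlgHom k (Rel n q)) _ _)

/-- The assignment of three elements to the generators. -/
def pick {A : Type*} (a b c : A) : Gen → A
  | Gen.x => a
  | Gen.y => b
  | Gen.z => c

variable {A : Type*} [Ring A] [Algebra k A]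

/-- The algebra homomorphism `H_{2n²} → A` given by a triple satisfying the relations. -/
def lift {a b c : A} (h : IsTriple n q a b c) : H hq →ₐ[k] A :=
  RingQuot.liftAlgHom k ⟨FreeAlgebra.lift k (pick a b c), by
    intro u v r
    cases r with
    | x_pow => simpa [pick] using h.x_pow
    | y_pow => simpa [pick] using h.y_pow
    | xy => simpa [pick] using h.xy
    | zx => simpa [pick] using h.zx
    | zy => simpa [pick] using h.zy
    | z_sq =>
      have := map_quadSum (n := n) (q := q) (FreeAlgebra.lift k (pick a b c))
        (FreeAlgebra.ι k Gen.x) (FreeAlgebra.ι k Gen.y)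
      rw [FreeAlgebra.lift_ι_apply, FreeAlgebra.lift_ι_apply] at this
      rw [map_pow, FreeAlgebra.lift_ι_apply]
      exact h.z_sq.trans this.symm⟩

theorem lift_gen {a b c : A} (h : IsTriple n q a b c) (g : Gen) :
    lift hq h (gen hq g) = pick a b c g := by
  unfold lift gen
  exact (RingQuot.liftAlgHom_mkAlgHom_apply k _ _ _).trans (FreeAlgebra.lift_ι_apply _ _)

@[simp] theorem lift_x {a b c : A} (h : IsTriple n q a b c) : lift hq h (x hq) = a :=
  lift_gen hq h Gen.x
@[simp] theorem lift_y {a b c : A} (h : IsTriple n q a b c) : lift hq h (y hq) = b :=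
  lift_gen hq h Gen.y
@[simp] theorem lift_z {a b c : A} (h : IsTriple n q a b c) : lift hq h (z hq) = c :=
  lift_gen hq h Gen.z

variable {hq} in
theorem algHom_ext {f g : H hq →ₐ[k] A} (hx : f (x hq) = g (x hq)) (hy : f (y hq) = g (y hq))
    (hz : f (z hq) = g (z hq)) : f = g := by
  apply RingQuot.ringQuot_ext' k
  apply FreeAlgebra.hom_ext
  funext t
  cases t
  · exact hx
  · exact hy
  · exact hz

variable {hq} in
theorem induction {P : H hq → Prop} (alg : ∀ r, P (algebraMap k _ r))
    (hx : P (x hq)) (hy : P (y hq)) (hz : P (z hq))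
    (mul : ∀ a b, P a → P b → P (a * b)) (add : ∀ a b, P a → P b → P (a + b)) (h : H hq) : P h := by
  obtain ⟨h, rfl⟩ := RingQuot.mkAlgHom_surjective k (Rel n q) h
  induction h using FreeAlgebra.induction with
  | grade0 r => rw [AlgHom.commutes]; exact alg r
  | grade1 t =>
    cases t
    · exact hx
    · exact hy
    · exact hz
  | mul a b ha hb => rw [map_mul]; exact mul _ _ ha hb
  | add a b ha hb => rw [map_add]; exact add _ _ ha hb

/-- The value `Δ(z) = (1/n) ∑_{i,j} q^{-ij} x^i z ⊗ y^j z`. -/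
def deltaZ : H hq ⊗[k] H hq :=
  (n : k)⁻¹ • ∑ i ∈ Finset.range n, ∑ j ∈ Finset.range n,
    (q⁻¹) ^ (i * j) • ((x hq ^ i * z hq) ⊗ₜ[k] (y hq ^ j * z hq))

theorem deltaZ_eq : deltaZ hq =
    quadSum n q (x hq ⊗ₜ[k] (1 : H hq)) ((1 : H hq) ⊗ₜ[k] y hq) * (z hq ⊗ₜ[k] z hq) := by
  simp [deltaZ, quadSum, Finset.sum_mul, Algebra.TensorProduct.tmul_pow]

variable [NeZero n]

theorem isTriple_comul :
    IsTriple n q (x hq ⊗ₜ[k] x hq) (y hq ⊗ₜ[k] y hq) (deltaZ hq) := by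
  have t := isTriple_gen hq
  have hxy : Commute (x hq) (y hq) := t.xy
  have hJ : ∀ c, Commute c (x hq ⊗ₜ[k] (1 : H hq)) → Commute c ((1 : H hq) ⊗ₜ[k] y hq) →
      Commute c (quadSum n q (x hq ⊗ₜ[k] (1 : H hq)) ((1 : H hq) ⊗ₜ[k] y hq)) :=
    fun c => commute_quadSum
  constructor
  · rw [Algebra.TensorProduct.tmul_pow, t.x_pow]; rfl
  · rw [Algebra.TensorProduct.tmul_pow, t.y_pow]; rfl
  · simp only [Algebra.TensorProduct.tmul_mul_tmul, t.xy]
  · rw [deltaZ_eq, mul_assoc, Algebra.TensorProduct.tmul_mul_tmul, t.zx, ← mul_assoc,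
      (hJ (y hq ⊗ₜ y hq) _ _).eq, mul_assoc, Algebra.TensorProduct.tmul_mul_tmul]
    · simp [commute_iff_eq, t.xy]
    · simp [commute_iff_eq]
  · rw [deltaZ_eq, mul_assoc, Algebra.TensorProduct.tmul_mul_tmul, t.zy, ← mul_assoc,
      (hJ (x hq ⊗ₜ x hq) _ _).eq, mul_assoc, Algebra.TensorProduct.tmul_mul_tmul]
    · simp [commute_iff_eq]
    · simp [commute_iff_eq, t.xy]
  · have hX : x hq ⊗ₜ[k] x hq = (x hq ⊗ₜ[k] (1 : H hq)) * ((1 : H hq) ⊗ₜ[k] x hq) := by simp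
    have hY : y hq ⊗ₜ[k] y hq = (y hq ⊗ₜ[k] (1 : H hq)) * ((1 : H hq) ⊗ₜ[k] y hq) := by simp
    have px1 : (x hq ⊗ₜ[k] (1 : H hq)) ^ n = 1 := by
      rw [Algebra.TensorProduct.tmul_pow, t.x_pow, one_pow]; rfl
    have px2 : ((1 : H hq) ⊗ₜ[k] x hq) ^ n = 1 := by
      rw [Algebra.TensorProduct.tmul_pow, t.x_pow, one_pow]; rfl
    have pyy : (y hq ⊗ₜ[k] y hq) ^ n = 1 := by
      rw [Algebra.TensorProduct.tmul_pow, t.y_pow]; rfl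
    have cxx : Commute (x hq ⊗ₜ[k] (1 : H hq)) ((1 : H hq) ⊗ₜ[k] x hq) := by simp [commute_iff_eq]
    have cyy : Commute (y hq ⊗ₜ[k] (1 : H hq)) ((1 : H hq) ⊗ₜ[k] y hq) := by simp [commute_iff_eq]
    have c11 : Commute (x hq ⊗ₜ[k] (1 : H hq)) (y hq ⊗ₜ[k] (1 : H hq)) := by
      simp [commute_iff_eq, t.xy]
    have c12 : Commute (x hq ⊗ₜ[k] (1 : H hq)) ((1 : H hq) ⊗ₜ[k] y hq) := by simp [commute_iff_eq]
    have c21 : Commute ((1 : H hq) ⊗ₜ[k] x hq) (y hq ⊗ₜ[k] (1 : H hq)) := by simp [commute_iff_eq]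
    have c22 : Commute ((1 : H hq) ⊗ₜ[k] x hq) ((1 : H hq) ⊗ₜ[k] y hq) := by
      simp [commute_iff_eq, t.xy]
    have e1 : (z hq ⊗ₜ[k] z hq) * (z hq ⊗ₜ[k] z hq) =
        quadSum n q (x hq ⊗ₜ[k] (1 : H hq)) (y hq ⊗ₜ[k] (1 : H hq)) *
          quadSum n q ((1 : H hq) ⊗ₜ[k] x hq) ((1 : H hq) ⊗ₜ[k] y hq) := by
      have h1 := map_quadSum (n := n) (q := q)
        (Algebra.TensorProduct.includeLeft : H hq →ₐ[k] H hq ⊗[k] H hq) (x hq) (y hq)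
      have h2 := map_quadSum (n := n) (q := q)
        (Algebra.TensorProduct.includeRight : H hq →ₐ[k] H hq ⊗[k] H hq) (x hq) (y hq)
      simp only [Algebra.TensorProduct.includeLeft_apply,
        Algebra.TensorProduct.includeRight_apply] at h1 h2
      rw [← h1, ← h2, Algebra.TensorProduct.tmul_mul_tmul, Algebra.TensorProduct.tmul_mul_tmul,
        one_mul, mul_one, ← t.z_sq, pow_two]
    have e2 : (z hq ⊗ₜ[k] z hq) *
          quadSum n q (x hq ⊗ₜ[k] (1 : H hq)) ((1 : H hq) ⊗ₜ[k] y hq) =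
        quadSum n q (y hq ⊗ₜ[k] (1 : H hq)) ((1 : H hq) ⊗ₜ[k] x hq) * (z hq ⊗ₜ[k] z hq) :=
      (semiconjBy_quadSum (by simp [SemiconjBy, t.zx]) (by simp [SemiconjBy, t.zy])).eq
    rw [pow_two, deltaZ_eq, mul_assoc, ← mul_assoc (z hq ⊗ₜ[k] z hq), e2,
      mul_assoc (quadSum n q (y hq ⊗ₜ[k] (1 : H hq)) _), e1, hX,
      quadSum_mul_left hq cxx (by rw [hY]; exact c21.mul_right c22) pyy, hY,
      quadSum_mul_right hq cyy c11 c12 px1, quadSum_mul_right hq cyy c21 c22 px2,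
      quadSum_comm c21.symm]
    rw [← mul_assoc (quadSum n q ((1 : H hq) ⊗ₜ[k] x hq) (y hq ⊗ₜ[k] (1 : H hq))),
      ← mul_assoc (quadSum n q _ _)]
    set J11 := quadSum n q (x hq ⊗ₜ[k] (1 : H hq)) (y hq ⊗ₜ[k] (1 : H hq))
    have k1 : Commute J11 (quadSum n q ((1 : H hq) ⊗ₜ[k] x hq) (y hq ⊗ₜ[k] (1 : H hq))) :=
      commute_quadSum (commute_quadSum cxx.symm c21).symm
        (commute_quadSum c11.symm (Commute.refl _)).symm
    have k2 : Commute J11 (quadSum n q (x hq ⊗ₜ[k] (1 : H hq)) ((1 : H hq) ⊗ₜ[k] y hq)) :=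
      commute_quadSum (commute_quadSum (Commute.refl _) c11).symm
        (commute_quadSum c12.symm cyy.symm).symm
    rw [← k1.eq, ← mul_assoc, ← k2.eq]
    simp only [mul_assoc]

theorem isTriple_counit (hq : IsPrimitiveRoot q n) : IsTriple n q (1 : k) 1 1 := by
  constructor <;> simp [quadSum_one_left hq]

/-- `Δ : H → H ⊗ H`. -/
def comulHom : H hq →ₐ[k] H hq ⊗[k] H hq := lift hq (isTriple_comul hq)

/-- `ε : H → k`. -/
def counitHom : H hq →ₐ[k] k := lift hq (isTriple_counit hq)

@[simp] theorem comulHom_x : comulHom hq (x hq) = x hq ⊗ₜ x hq := lift_x hq _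
@[simp] theorem comulHom_y : comulHom hq (y hq) = y hq ⊗ₜ y hq := lift_y hq _
@[simp] theorem comulHom_z : comulHom hq (z hq) = deltaZ hq := lift_z hq _
@[simp] theorem counitHom_x : counitHom hq (x hq) = 1 := lift_x hq _
@[simp] theorem counitHom_y : counitHom hq (y hq) = 1 := lift_y hq _
@[simp] theorem counitHom_z : counitHom hq (z hq) = 1 := lift_z hq _

theorem coassoc_z :
    (Algebra.TensorProduct.assoc k k k (H hq) (H hq) (H hq))
      (Algebra.TensorProduct.map (comulHom hq) (.id k (H hq)) (deltaZ hq)) =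
    Algebra.TensorProduct.map (.id k (H hq)) (comulHom hq) (deltaZ hq) := by
  have t := isTriple_gen hq
  have hl : (deltaZ hq ⊗ₜ[k] z hq : (H hq ⊗[k] H hq) ⊗[k] H hq) =
      quadSum n q ((x hq ⊗ₜ[k] (1 : H hq)) ⊗ₜ[k] (1 : H hq)) (((1 : H hq) ⊗ₜ[k] y hq) ⊗ₜ[k] 1) *
        ((z hq ⊗ₜ[k] z hq) ⊗ₜ[k] z hq) := by
    have h1 := map_quadSum (n := n) (q := q)
      (Algebra.TensorProduct.includeLeft : H hq ⊗[k] H hq →ₐ[k] (H hq ⊗[k] H hq) ⊗[k] H hq)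
      (x hq ⊗ₜ[k] (1 : H hq)) ((1 : H hq) ⊗ₜ[k] y hq)
    simp only [Algebra.TensorProduct.includeLeft_apply] at h1
    rw [← h1, Algebra.TensorProduct.tmul_mul_tmul, one_mul, deltaZ_eq]
  have hr : (z hq ⊗ₜ[k] deltaZ hq : H hq ⊗[k] (H hq ⊗[k] H hq)) =
      quadSum n q ((1 : H hq) ⊗ₜ[k] (x hq ⊗ₜ[k] (1 : H hq)))
        ((1 : H hq) ⊗ₜ[k] ((1 : H hq) ⊗ₜ[k] y hq)) *
        (z hq ⊗ₜ[k] (z hq ⊗ₜ[k] z hq)) := by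
    have h1 := map_quadSum (n := n) (q := q)
      (Algebra.TensorProduct.includeRight : H hq ⊗[k] H hq →ₐ[k] H hq ⊗[k] (H hq ⊗[k] H hq))
      (x hq ⊗ₜ[k] (1 : H hq)) ((1 : H hq) ⊗ₜ[k] y hq)
    simp only [Algebra.TensorProduct.includeRight_apply] at h1
    rw [← h1, Algebra.TensorProduct.tmul_mul_tmul, one_mul, deltaZ_eq]
  conv_lhs => rw [deltaZ_eq]
  conv_rhs => rw [deltaZ_eq]
  simp only [map_mul, map_quadSum, Algebra.TensorProduct.map_tmul, comulHom_x, comulHom_y,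
    comulHom_z, AlgHom.coe_id, id_eq, map_one, hl, hr]
  rw [← AlgEquiv.coe_toAlgHom]
  simp only [map_quadSum]
  simp only [AlgEquiv.coe_toAlgHom, Algebra.TensorProduct.assoc_tmul,
    Algebra.TensorProduct.one_def]
  set X₁ : H hq ⊗[k] (H hq ⊗[k] H hq) := x hq ⊗ₜ[k] ((1 : H hq) ⊗ₜ[k] (1 : H hq)) with hX₁
  set X₂ : H hq ⊗[k] (H hq ⊗[k] H hq) := (1 : H hq) ⊗ₜ[k] (x hq ⊗ₜ[k] (1 : H hq)) with hX₂
  set Y₂ : H hq ⊗[k] (H hq ⊗[k] H hq) := (1 : H hq) ⊗ₜ[k] (y hq ⊗ₜ[k] (1 : H hq)) with hY₂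
  set Y₃ : H hq ⊗[k] (H hq ⊗[k] H hq) := (1 : H hq) ⊗ₜ[k] ((1 : H hq) ⊗ₜ[k] y hq) with hY₃
  have e1 : (x hq ⊗ₜ[k] (x hq ⊗ₜ[k] (1 : H hq)) : H hq ⊗[k] (H hq ⊗[k] H hq)) = X₁ * X₂ := by
    simp [hX₁, hX₂]
  have e2 : ((1 : H hq) ⊗ₜ[k] (y hq ⊗ₜ[k] y hq) : H hq ⊗[k] (H hq ⊗[k] H hq)) = Y₂ * Y₃ := by
    simp [hY₂, hY₃]
  have c1 : Commute X₁ X₂ := by simp [commute_iff_eq, hX₁, hX₂]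
  have c2 : Commute Y₂ Y₃ := by simp [commute_iff_eq, hY₂, hY₃]
  have c12 : Commute X₁ Y₂ := by simp [commute_iff_eq, hX₁, hY₂]
  have c13 : Commute X₁ Y₃ := by simp [commute_iff_eq, hX₁, hY₃]
  have c22 : Commute X₂ Y₂ := by simp [commute_iff_eq, hX₂, hY₂, t.xy]
  have c23 : Commute X₂ Y₃ := by simp [commute_iff_eq, hX₂, hY₃]
  have pX : X₁ ^ n = 1 := by
    simp [hX₁, Algebra.TensorProduct.tmul_pow, t.x_pow, Algebra.TensorProduct.one_def]
  have pY : Y₃ ^ n = 1 := by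
    simp [hY₃, Algebra.TensorProduct.tmul_pow, t.y_pow, Algebra.TensorProduct.one_def]
  rw [e1, e2, quadSum_mul_left hq c1 c23 pY, quadSum_mul_right hq c2 c12 c13 pX]
  have k1 : Commute (quadSum n q X₂ Y₃) (quadSum n q X₁ Y₂) :=
    commute_quadSum (commute_quadSum c1 c13).symm (commute_quadSum c22.symm c2).symm
  have k2 : Commute (quadSum n q X₁ Y₃) (quadSum n q X₁ Y₂) :=
    commute_quadSum (commute_quadSum (Commute.refl _) c13).symm (commute_quadSum c12.symm c2).symm
  rw [← mul_assoc, ← mul_assoc]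
  congr 1
  rw [mul_assoc, k1.eq, ← mul_assoc, k2.eq]

/-- The bialgebra structure: `Δ(x) = x ⊗ x`, `Δ(y) = y ⊗ y`,
`Δ(z) = (1/n) ∑_{i,j} q^{-ij} x^i z ⊗ y^j z`, `ε(x) = ε(y) = ε(z) = 1`. -/
instance : Bialgebra k (H hq) :=
  Bialgebra.ofAlgHom (comulHom hq) (counitHom hq)
    (by
      apply algHom_ext
      · simp
      · simp
      · simpa using coassoc_z hq)
    (by
      apply algHom_ext
      · simp
      · simp
      · have h : (1 : k) ⊗ₜ[k] (1 : H hq) = 1 := rfl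
        simp [deltaZ_eq, map_quadSum, h, quadSum_one_left hq])
    (by
      apply algHom_ext
      · simp
      · simp
      · have h : (1 : H hq) ⊗ₜ[k] (1 : k) = 1 := rfl
        simp [deltaZ_eq, map_quadSum, h, quadSum_one_right hq])

/-! ### The antipode -/

theorem pow_pred_mul {A : Type*} [Monoid A] {a : A} (h : a ^ n = 1) : a ^ (n - 1) * a = 1 := by
  rw [← pow_succ, Nat.sub_add_cancel (NeZero.pos n), h]

theorem mul_pow_pred {A : Type*} [Monoid A] {a : A} (h : a ^ n = 1) : a * a ^ (n - 1) = 1 := by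
  rw [← pow_succ', Nat.sub_add_cancel (NeZero.pos n), h]

open MulOpposite in
theorem isTriple_antipode :
    IsTriple n q (op (x hq ^ (n - 1))) (op (y hq ^ (n - 1))) (op (z hq)) := by
  have t := isTriple_gen hq
  have hxy : Commute (x hq) (y hq) := t.xy
  have hzx : SemiconjBy (z hq) (x hq) (y hq) := t.zx
  have hzy : SemiconjBy (z hq) (y hq) (x hq) := t.zy
  constructor
  · rw [← op_pow, ← pow_mul, mul_comm, pow_mul, t.x_pow, one_pow, op_one]
  · rw [← op_pow, ← pow_mul, mul_comm, pow_mul, t.y_pow, one_pow, op_one]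
  · rw [← op_mul, ← op_mul, (hxy.pow_pow _ _).eq]
  · rw [← op_mul, ← op_mul, (hzy.pow_right _).eq]
  · rw [← op_mul, ← op_mul, (hzx.pow_right _).eq]
  · rw [quadSum_op (hxy.pow_pow _ _), ← op_pow, t.z_sq]
    congr 1
    refine (quadSum_inv_inv hq (pow_pred_mul t.x_pow) (mul_pow_pred t.x_pow)
      (pow_pred_mul t.y_pow) (mul_pow_pred t.y_pow) hxy (hxy.pow_left _) (hxy.pow_pow _ _)
      ?_ t.y_pow).symm
    rw [← pow_mul, mul_comm, pow_mul, t.x_pow, one_pow]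

/-- The antipode as an algebra homomorphism `H → Hᵒᵖ`. -/
def antipodeHom : H hq →ₐ[k] (H hq)ᵐᵒᵖ := lift hq (isTriple_antipode hq)

/-- The antipode: the anti-multiplicative linear map with `S(x) = x⁻¹ = x^{n-1}`,
`S(y) = y⁻¹ = y^{n-1}`, `S(z) = z`. -/
def antipodeLin : H hq →ₗ[k] H hq :=
  (MulOpposite.opLinearEquiv k).symm.toLinearMap ∘ₗ (antipodeHom hq).toLinearMap

theorem antipodeLin_apply (h : H hq) : antipodeLin hq h = (antipodeHom hq h).unop := rfl
@[simp] theorem antipodeLin_x : antipodeLin hq (x hq) = x hq ^ (n - 1) :=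
  congrArg MulOpposite.unop (lift_x hq _)
@[simp] theorem antipodeLin_y : antipodeLin hq (y hq) = y hq ^ (n - 1) :=
  congrArg MulOpposite.unop (lift_y hq _)
@[simp] theorem antipodeLin_z : antipodeLin hq (z hq) = z hq :=
  congrArg MulOpposite.unop (lift_z hq _)
theorem antipodeLin_mul (a b : H hq) :
    antipodeLin hq (a * b) = antipodeLin hq b * antipodeLin hq a := by
  simp [antipodeLin_apply]
theorem antipodeLin_algebraMap (r : k) :
    antipodeLin hq (algebraMap k _ r) = algebraMap k _ r := by
  simp [antipodeLin_apply]
theorem antipodeLin_pow (a : H hq) (i : ℕ) :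
    antipodeLin hq (a ^ i) = antipodeLin hq a ^ i := by
  simp [antipodeLin_apply]

/-- `t ↦ ∑ S(t₁) t₂`. -/
def convL : H hq ⊗[k] H hq →ₗ[k] H hq :=
  LinearMap.mul' k (H hq) ∘ₗ (antipodeLin hq).rTensor (H hq)

/-- `t ↦ ∑ t₁ S(t₂)`. -/
def convR : H hq ⊗[k] H hq →ₗ[k] H hq :=
  LinearMap.mul' k (H hq) ∘ₗ (antipodeLin hq).lTensor (H hq)

theorem convL_tmul (a b : H hq) : convL hq (a ⊗ₜ b) = antipodeLin hq a * b := rfl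
theorem convR_tmul (a b : H hq) : convR hq (a ⊗ₜ b) = a * antipodeLin hq b := rfl

theorem convL_mul (t : H hq ⊗[k] H hq) (a b : H hq) :
    convL hq (t * (a ⊗ₜ b)) = antipodeLin hq a * convL hq t * b := by
  induction t using TensorProduct.induction_on with
  | zero => simp
  | add s t hs ht => simp only [add_mul, map_add, hs, ht, mul_add]
  | tmul c d =>
    rw [Algebra.TensorProduct.tmul_mul_tmul, convL_tmul, convL_tmul, antipodeLin_mul]
    simp only [mul_assoc]

theorem convR_mul (t : H hq ⊗[k] H hq) (a b : H hq) :
    convR hq ((a ⊗ₜ b) * t) = a * convR hq t * antipodeLin hq b := by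
  induction t using TensorProduct.induction_on with
  | zero => simp
  | add s t hs ht => simp only [add_mul, map_add, hs, ht, mul_add]
  | tmul c d =>
    rw [Algebra.TensorProduct.tmul_mul_tmul, convR_tmul, convR_tmul, antipodeLin_mul]
    simp only [mul_assoc]

theorem convL_mul_of {s : H hq ⊗[k] H hq} {r : k} (hs : convL hq s = algebraMap k _ r)
    (t : H hq ⊗[k] H hq) : convL hq (s * t) = algebraMap k _ r * convL hq t := by
  induction t using TensorProduct.induction_on with
  | zero => simp
  | add t u ht hu => simp only [mul_add, map_add, ht, hu]
  | tmul a b => rw [convL_mul, hs, convL_tmul, ← Algebra.commutes r, mul_assoc]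

theorem convR_mul_of {s : H hq ⊗[k] H hq} {r : k} (hs : convR hq s = algebraMap k _ r)
    (t : H hq ⊗[k] H hq) : convR hq (t * s) = algebraMap k _ r * convR hq t := by
  induction t using TensorProduct.induction_on with
  | zero => simp
  | add t u ht hu => simp only [add_mul, mul_add, map_add, ht, hu]
  | tmul a b => rw [convR_mul, hs, convR_tmul, ← Algebra.commutes r, mul_assoc, Algebra.commutes]

theorem convL_deltaZ : convL hq (deltaZ hq) = 1 := by
  have t := isTriple_gen hq
  have hxy : Commute (x hq) (y hq) := t.xy
  have hzx : SemiconjBy (z hq) (x hq) (y hq) := t.zx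
  have hzy : SemiconjBy (z hq) (y hq) (x hq) := t.zy
  have h1 : convL hq (quadSum n q (x hq ⊗ₜ[k] (1 : H hq)) ((1 : H hq) ⊗ₜ[k] y hq)) =
      quadSum n q (x hq ^ (n - 1)) (y hq) := by
    simp [quadSum, map_sum, Algebra.TensorProduct.tmul_pow, convL_tmul, antipodeLin_pow]
  have hs : SemiconjBy (z hq) (quadSum n q (x hq ^ (n - 1)) (y hq))
      (quadSum n q (y hq ^ (n - 1)) (x hq)) := semiconjBy_quadSum (hzx.pow_right _) hzy
  rw [deltaZ_eq, convL_mul, h1, antipodeLin_z, hs.eq, mul_assoc, ← pow_two, t.z_sq,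
    quadSum_comm hxy]
  exact quadSum_inv_mul hq (pow_pred_mul t.y_pow) (mul_pow_pred t.y_pow) hxy.symm t.x_pow

theorem convR_deltaZ : convR hq (deltaZ hq) = 1 := by
  have t := isTriple_gen hq
  have hxy : Commute (x hq) (y hq) := t.xy
  have h1 : convR hq (deltaZ hq) = quadSum n q (x hq) (y hq ^ (n - 1)) * z hq ^ 2 := by
    have hc : ∀ j, z hq ^ 2 * (y hq ^ (n - 1)) ^ j = (y hq ^ (n - 1)) ^ j * z hq ^ 2 := by
      intro j
      rw [t.z_sq]
      exact (commute_quadSum ((hxy.symm.pow_left _).pow_left _)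
        (((Commute.refl (y hq)).pow_left _).pow_left _)).symm.eq
    simp only [deltaZ, quadSum, map_smul, map_sum, convR_tmul, antipodeLin_mul, antipodeLin_pow,
      antipodeLin_y, antipodeLin_z, smul_mul_assoc, Finset.sum_mul]
    refine congrArg _ (Finset.sum_congr rfl fun i _ => Finset.sum_congr rfl fun j _ => ?_)
    rw [mul_assoc (x hq ^ i) _ (z hq ^ 2), ← hc, pow_two]
    simp only [mul_assoc]
  rw [h1, t.z_sq, quadSum_comm hxy, quadSum_comm (hxy.pow_right _)]
  exact quadSum_inv_mul hq (pow_pred_mul t.y_pow) (mul_pow_pred t.y_pow) hxy.symm t.x_pow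

theorem convL_comul (h : H hq) : convL hq (comulHom hq h) = algebraMap k _ (counitHom hq h) := by
  have t := isTriple_gen hq
  induction h using induction with
  | alg r =>
    rw [AlgHom.commutes, AlgHom.commutes, Algebra.TensorProduct.algebraMap_apply, convL_tmul,
      antipodeLin_algebraMap, mul_one]
    rfl
  | hx => rw [comulHom_x, convL_tmul, antipodeLin_x, pow_pred_mul t.x_pow]; simp
  | hy => rw [comulHom_y, convL_tmul, antipodeLin_y, pow_pred_mul t.y_pow]; simp
  | hz => rw [comulHom_z, convL_deltaZ]; simp
  | mul a b ha hb => rw [map_mul, convL_mul_of hq ha, hb, map_mul, map_mul]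
  | add a b ha hb => simp only [map_add, ha, hb]

theorem convR_comul (h : H hq) : convR hq (comulHom hq h) = algebraMap k _ (counitHom hq h) := by
  have t := isTriple_gen hq
  induction h using induction with
  | alg r =>
    rw [AlgHom.commutes, AlgHom.commutes, Algebra.TensorProduct.algebraMap_apply, convR_tmul]
    have := antipodeLin_algebraMap hq 1
    rw [map_one] at this
    rw [this, mul_one]
    rfl
  | hx => rw [comulHom_x, convR_tmul, antipodeLin_x, mul_pow_pred t.x_pow]; simp
  | hy => rw [comulHom_y, convR_tmul, antipodeLin_y, mul_pow_pred t.y_pow]; simp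
  | hz => rw [comulHom_z, convR_deltaZ]; simp
  | mul a b ha hb =>
    rw [map_mul, convR_mul_of hq hb, ha, map_mul, map_mul, Algebra.commutes]
  | add a b ha hb => simp only [map_add, ha, hb]

/-- The Hopf algebra `H_{2n²}`. -/
instance : HopfAlgebra k (H hq) where
  antipode := antipodeLin hq
  mul_antipode_rTensor_comul := LinearMap.ext fun h => convL_comul hq h
  mul_antipode_lTensor_comul := LinearMap.ext fun h => convR_comul hq h

/-! ### The modules `S_m` and `S_{i,j}` -/

theorem isTriple_one {p : k} (hp : p ^ 2 = q) (m : ℕ) {s : k} (hs : s ^ 2 = 1)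
    (hq : IsPrimitiveRoot q n) : IsTriple n q (q ^ m) (q ^ m) (s * p ^ m ^ 2) := by
  have h : (q ^ m) ^ n = 1 := by rw [← pow_mul, mul_comm, pow_mul, hq.pow_eq_one, one_pow]
  refine ⟨h, h, rfl, mul_comm _ _, mul_comm _ _, ?_⟩
  rw [quadSum_pow hq, mul_pow, hs, one_mul, ← pow_mul, mul_comm, pow_mul, hp, pow_two m]

/-- The sign `σ(m)`, equal to `1` for `0 ≤ m ≤ n - 1` and to `-1` for `n ≤ m ≤ 2n - 1`. -/
def sign (k : Type u) [Field k] (n m : ℕ) : k := if m < n then 1 else -1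

/-- The one-dimensional module `S_m`, `0 ≤ m ≤ 2n - 1`: `x` and `y` act by `q^m` and `z` acts by
`σ(m) q^{m²/2}`, where `q^{1/2} = p`. -/
def oneDim {p : k} (hp : p ^ 2 = q) (m : ℕ) : FinMod k (H hq) where
  V := k
  ρ := (Algebra.lmul k k).comp
    (lift hq (isTriple_one hp m (s := sign k n m) (by unfold sign; split_ifs <;> norm_num) hq))

theorem isTriple_two (i j : ℕ) (hq : IsPrimitiveRoot q n) :
    IsTriple n q (!![q ^ i, 0; 0, q ^ j] : Matrix (Fin 2) (Fin 2) k) !![q ^ j, 0; 0, q ^ i]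
      !![0, q ^ (i * j); 1, 0] := by
  have hpow : ∀ m, (q ^ m) ^ n = 1 := fun m => by
    rw [← pow_mul, mul_comm, pow_mul, hq.pow_eq_one, one_pow]
  have hd : ∀ a b : k, (!![a, 0; 0, b] : Matrix (Fin 2) (Fin 2) k) =
      Matrix.diagonalAlgHom k ![a, b] := by
    intro a b
    ext u v
    fin_cases u <;> fin_cases v <;> simp
  constructor
  · rw [hd, ← map_pow, ← map_one (Matrix.diagonalAlgHom k)]
    congr 1
    ext u
    fin_cases u <;> simp [hpow]
  · rw [hd, ← map_pow, ← map_one (Matrix.diagonalAlgHom k)]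
    congr 1
    ext u
    fin_cases u <;> simp [hpow]
  · simp [mul_comm]
  · simp [mul_comm]
  · simp [mul_comm]
  · rw [hd, hd, ← map_quadSum]
    have h1 : quadSum n q ![q ^ i, q ^ j] ![q ^ j, q ^ i] = ![q ^ (i * j), q ^ (i * j)] := by
      funext u
      have h2 := map_quadSum (n := n) (q := q) (Pi.evalAlgHom k (fun _ : Fin 2 => k) u)
        ![q ^ i, q ^ j] ![q ^ j, q ^ i]
      refine h2.trans ?_
      fin_cases u
      · simpa using quadSum_pow hq i j
      · simpa [mul_comm] using quadSum_pow hq j i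
    rw [h1, ← hd, pow_two]
    simp

/-- The two-dimensional module `S_{i,j}`, `0 ≤ i < j ≤ n - 1`: in the standard basis `x`, `y`, `z`
act by `diag(q^i, q^j)`, `diag(q^j, q^i)` and the matrix with rows `(0, q^{ij})`, `(1, 0)`. -/
def twoDim (i j : ℕ) : FinMod k (H hq) where
  V := Fin 2 → k
  ρ := (Matrix.toLinAlgEquiv' : Matrix (Fin 2) (Fin 2) k ≃ₐ[k] _).toAlgHom.comp
    (lift hq (isTriple_two i j hq))

end

end KacPaljutkin

/-! ## Generalized Fibonacci polynomials -/

/-- `F_0 = 0`, `F_1 = 1`, `F_{t+2}(y,z) = z F_{t+1}(y,z) - y F_t(y,z)`. -/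
def genFib {R : Type*} [CommRing R] (y z : R) : ℕ → R
  | 0 => 0
  | 1 => 1
  | t + 2 => z * genFib y z (t + 1) - y * genFib y z t

/-! ## The relations -/

/-- `z^m - z^m y^m + ∑_{i=1}^{[m/2]} (-1)^i C(m-i,i) y^i z^{m-2i}
- ∑_{i=1}^{[m/2]} (-1)^i C(m-i,i) y^{m+i} z^{m-2i} - x F_{m-1}(y,z) + x y^m F_{m-1}(y,z)`,
where `m ≥ 2`. -/
def relFirst {R : Type*} [CommRing R] (m : ℕ) (x y z : R) : R :=
  z ^ m - z ^ m * y ^ m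
    + ∑ i ∈ Finset.Icc 1 (m / 2), (-1) ^ i * ((m - i).choose i : R) * y ^ i * z ^ (m - 2 * i)
    - ∑ i ∈ Finset.Icc 1 (m / 2), (-1) ^ i * ((m - i).choose i : R) * y ^ (m + i) * z ^ (m - 2 * i)
    - x * genFib y z (m - 1) + x * y ^ m * genFib y z (m - 1)

/-- `z^{m+1} - z^{m-1} y^{m+1} + ∑_{i=1}^{[(m+1)/2]} (-1)^i C(m+1-i,i) y^i z^{m+1-2i}
- ∑_{i=1}^{[(m-1)/2]} (-1)^i C(m-1-i,i) y^{m+1+i} z^{m-1-2i} - x F_m(y,z)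
+ x y^{m+1} F_{m-2}(y,z)`, where `m ≥ 2`. -/
def relSecond {R : Type*} [CommRing R] (m : ℕ) (x y z : R) : R :=
  z ^ (m + 1) - z ^ (m - 1) * y ^ (m + 1)
    + ∑ i ∈ Finset.Icc 1 ((m + 1) / 2),
        (-1) ^ i * ((m + 1 - i).choose i : R) * y ^ i * z ^ (m + 1 - 2 * i)
    - ∑ i ∈ Finset.Icc 1 ((m - 1) / 2),
        (-1) ^ i * ((m - 1 - i).choose i : R) * y ^ (m + 1 + i) * z ^ (m - 1 - 2 * i)
    - x * genFib y z m + x * y ^ (m + 1) * genFib y z (m - 2)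

open MvPolynomial in
/-- The ideal of `ℤ[x,y,z]` for `n = 2`; the variables `x`, `y`, `z` are `X 0`, `X 1`, `X 2`. -/
def idealTwo : Ideal (MvPolynomial (Fin 3) ℤ) :=
  Ideal.span {X 1 ^ 2 - 1, X 0 ^ 2 - X 1 ^ 2, X 2 * X 0 - X 2 * X 1, X 2 - X 2 * X 1,
    X 2 ^ 2 - X 0 - X 1 - X 0 * X 1 - 1}

open MvPolynomial in
/-- The ideal of `ℤ[x,y,z]` for even `n > 2`, with `m = n/2`. -/
def idealEven (n : ℕ) : Ideal (MvPolynomial (Fin 3) ℤ) :=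
  Ideal.span {X 0 ^ n - 1, X 0 ^ 2 - X 1 ^ 2, X 2 * X 0 - X 2 * X 1,
    relFirst (n / 2) (X 0) (X 1) (X 2), relSecond (n / 2) (X 0) (X 1) (X 2)}

end

/-! The proof characterises the Green ring by a universal property and shows that the presented ring
satisfies it too. Let `g` and `e` be the classes of `one 1 0` and `one 0 1` (on the latter `x = y =
1` and `z = -1`), and let `w i j` be the class of `twoDim i j`. Here `i` and `j` are arbitrary
natural numbers: only their residues modulo `n` matter, and `w i i` is a sum of two one-dimensional
classes. With this convention the tensor product rules have no case distinctions. They are collected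
in `IsFusionFamily`.

Module side. A module is the direct sum of the joint eigenspaces of `x` and `y`. The element `z`
exchanges the weights `(i, j)` and `(j, i)`, and `z²` is the scalar `q^{ij}` on vectors of weight
`(i, j)`. A nonzero weight vector with distinct residues therefore generates a copy of `S_{i,j}`. On
the weight `(i, i)` the eigenvalues of `z` are `± p^{i²}`, where `p² = q`, and `2 ≠ 0` separates
them. Each such copy splits off (`exists_split`), so every module is a sum of these simple ones
(`finMod_induction`). Given a fusion family in a commutative ring, `character` adds up its elements
with the multiplicities of the simple summands. It is additive, and multiplicative by inspection of
products of simple modules, so it is a ring homomorphism out of the Green ring (`exists_green_hom`).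

Ring side. In a fusion family `W(d) = w 0 d` satisfies `W(0) = 1 + e`, `W(1) = z` and `W(d+2) = z
W(d+1) - g W(d)`, so the family is generated by `g`, `g * e` and `w 0 1`. Conversely, let `x^n = 1`,
`x² = y²` and `zx = zy`, and put `e = x⁻¹ y`. The recursion, extended to negative indices, and `w i
j = x^i W(j - i)` give every rule except periodicity. Since `W(d+1) = F_{d+2}(y,z) - x F_d(y,z)`,
the two long relations for `n = 2m` say `W(m) = y^m W(m)` and `W(m+1) = y^{m+1} W(m-1)`. These are
two consecutive cases of `W(m+d) = x^{m+d} W(m-d)`, so the recursion yields all cases. Combined with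
`W(-d) = x^{-d} W(d)` this is periodicity with period `2m`. For `n = 2` the last two generators say
the same with `m = 1`.

Hence the relations hold in the Green ring, which gives a surjection from `ℤ[x,y,z]/I`, and the
quotient carries a fusion family, which gives a left inverse (`exists_green_equiv`). -/

/-! ## Fusion families -/

/-- Elements `g`, `e` and `w i j` of a commutative ring which multiply like the classes of the
one- and two-dimensional modules over `H_{2n²}`. -/
structure IsFusionFamily {R : Type*} [CommRing R] (n : ℕ) (g e : R) (w : ℕ → ℕ → R) : Prop where
  pow_eq_one : g ^ n = 1
  sq_eq_one : e ^ 2 = 1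
  symm (i j : ℕ) : w i j = w j i
  periodic (i j : ℕ) : w (i + n) j = w i j
  diag (i : ℕ) : w i i = g ^ i + g ^ i * e
  shift (a s i j : ℕ) : g ^ a * e ^ s * w i j = w (a + i) (a + j)
  mul (i j k l : ℕ) : w i j * w k l = w (i + k) (j + l) + w (i + l) (j + k)

namespace IsFusionFamily

variable {R : Type*} [CommRing R] {n : ℕ} {g e : R} {w : ℕ → ℕ → R}

theorem periodic_right (h : IsFusionFamily n g e w) (i j : ℕ) : w i (j + n) = w i j := by
  rw [h.symm, h.periodic, h.symm]

theorem mod_left (h : IsFusionFamily n g e w) (i j : ℕ) : w (i % n) j = w i j := by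
  conv_rhs => rw [← Nat.mod_add_div i n]
  induction i / n with
  | zero => simp
  | succ t ih => rw [Nat.mul_succ, ← add_assoc, h.periodic, ih]

theorem mod_right (h : IsFusionFamily n g e w) (i j : ℕ) : w i (j % n) = w i j := by
  rw [h.symm, h.mod_left, h.symm]

end IsFusionFamily

/-! ### Second-order recursions and generalized Fibonacci polynomials. -/

section Recurrence

variable {R : Type*} [CommRing R]

/-- The sequence `1 + e, z, …` with recursion `W (d + 2) = z W (d + 1) - g W d`. -/
def fusionSeq (g e z : R) : ℕ → R
  | 0 => 1 + e
  | 1 => z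
  | d + 2 => z * fusionSeq g e z (d + 1) - g * fusionSeq g e z d

theorem fusionSeq_add_two (g e z : R) (d : ℕ) :
    fusionSeq g e z (d + 2) = z * fusionSeq g e z (d + 1) - g * fusionSeq g e z d := rfl

/-- The starting values `1 + e` and `z` are fixed by `e`, and the recursion is linear. In front of
the sequence, powers of `g` and of `g * e` thus become interchangeable. -/
theorem mul_fusionSeq {g e z : R} (he : e ^ 2 = 1) (hz : z * e = z) (d : ℕ) :
    e * fusionSeq g e z d = fusionSeq g e z d := by
  induction d using Nat.twoStepInduction with
  | zero => simp only [fusionSeq]; linear_combination he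
  | one => simp only [fusionSeq]; linear_combination hz
  | more d h1 h2 =>
    simp only [fusionSeq_add_two]
    linear_combination z * h2 - g * h1

/-- The polynomials `genFib` run with coefficient `g * e` and the sequence with `g`. The two
recursions agree on the sequence because `e` fixes it. -/
theorem fusionSeq_eq_genFib {g e z : R} (he : e ^ 2 = 1) (hz : z * e = z) (d : ℕ) :
    fusionSeq g e z (d + 1) = genFib (g * e) z (d + 2) - g * genFib (g * e) z d := by
  induction d using Nat.twoStepInduction with
  | zero => simp [fusionSeq, genFib]
  | one => simp only [fusionSeq, genFib]; ring
  | more d h1 h2 =>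
    have h3 := mul_fusionSeq (g := g) he hz (d + 1)
    have h4 : genFib (g * e) z (d + 2 + 2) =
      z * genFib (g * e) z (d + 1 + 2) - g * e * genFib (g * e) z (d + 2) := rfl
    have h5 : genFib (g * e) z (d + 2) =
      z * genFib (g * e) z (d + 1) - g * e * genFib (g * e) z d := rfl
    rw [fusionSeq_add_two, h4]
    linear_combination z * h2 - g * e * h1 + g * h3 + g * h5

/-- The summand `(-1)^i C(m-i,i) y^i z^{m-2i}` of a generalized Fibonacci polynomial. -/
theorem genFib_succ_eq_sum (y z : R) (m : ℕ) : ∀ N, m / 2 < N → genFib y z (m + 1) =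
    ∑ i ∈ Finset.range N, (-1) ^ i * ((m - i).choose i : R) * y ^ i * z ^ (m - 2 * i) := by
  induction m using Nat.twoStepInduction with
  | zero =>
    intro N hN
    rw [Finset.sum_eq_single_of_mem 0 (by simpa using hN)]
    · simp [genFib]
    · intro i _ hi
      rw [Nat.choose_eq_zero_of_lt (by omega)]; simp
  | one =>
    intro N hN
    rw [Finset.sum_eq_single_of_mem 0 (by simpa using hN)]
    · simp [genFib]
    · intro i _ hi
      rw [Nat.choose_eq_zero_of_lt (by omega)]; simp
  | more m h1 h2 =>
    intro N hN
    -- The freedom in the upper bound lets the sum for `m + 1` have one term more than the sum for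
    -- `m`. Peeling off its term `0` aligns the two.
    obtain ⟨N, rfl⟩ : ∃ M, N = M + 1 := ⟨N - 1, by omega⟩
    have h3 : genFib y z (m + 2 + 1) = z * genFib y z (m + 1 + 1) - y * genFib y z (m + 1) := rfl
    rw [h3, h2 (N + 1) (by omega), h1 N (by omega), Finset.sum_range_succ', Finset.sum_range_succ',
      mul_add, Finset.mul_sum, Finset.mul_sum, add_sub_right_comm, ← Finset.sum_sub_distrib]
    congr 1
    · refine Finset.sum_congr rfl fun i _ => ?_
      -- In this range Pascal's rule joins the two summands; outside it all three binomial
      -- coefficients vanish.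
      by_cases hi : 2 * i ≤ m
      · obtain ⟨c, rfl⟩ := Nat.exists_eq_add_of_le hi
        rw [show 2 * i + c + 2 - (i + 1) = (i + c) + 1 by omega,
          show 2 * i + c + 1 - (i + 1) = i + c by omega, show 2 * i + c - i = i + c by omega,
          show 2 * i + c - 2 * i = c by omega, show 2 * i + c + 2 - 2 * (i + 1) = c by omega,
          Nat.choose_succ_succ]
        -- For `c = 0` the exponent `m + 1 - 2 * (i + 1)` is truncated to zero, which is harmless
        -- because its coefficient `C(i, i + 1)` is zero.
        rcases Nat.eq_zero_or_pos c with rfl | hc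
        · simp; ring
        · obtain ⟨c, rfl⟩ : ∃ b, c = b + 1 := ⟨c - 1, by omega⟩
          rw [show 2 * i + (c + 1) + 1 - 2 * (i + 1) = c by omega]
          push_cast
          ring
      · rw [Nat.choose_eq_zero_of_lt (by omega : m + 2 - (i + 1) < i + 1),
          Nat.choose_eq_zero_of_lt (by omega : m + 1 - (i + 1) < i + 1),
          Nat.choose_eq_zero_of_lt (by omega : m - i < i)]
        simp
    · simp; ring

theorem genFib_succ (y z : R) (m : ℕ) : genFib y z (m + 1) = z ^ m +
    ∑ i ∈ Finset.Icc 1 (m / 2), (-1) ^ i * ((m - i).choose i : R) * y ^ i * z ^ (m - 2 * i) := by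
  have h : Finset.Icc 1 (m / 2) = Finset.Ico 1 (m / 2 + 1) := by
    ext i
    simp
  rw [genFib_succ_eq_sum y z m (m / 2 + 1) (Nat.lt_succ_self _), Finset.sum_range_succ', h,
    Finset.sum_Ico_eq_sum_range, add_comm]
  simp [add_comm 1]

/-- Each binomial sum is a generalized Fibonacci polynomial without its leading term. By
`fusionSeq_eq_genFib` the vanishing of the right side reads `W(M) = y^M W(M)` with `M = m + 1`. -/
theorem relFirst_eq (m : ℕ) (x y z : R) : relFirst (m + 1) x y z =
    (genFib y z (m + 2) - x * genFib y z m)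
      - y ^ (m + 1) * (genFib y z (m + 2) - x * genFib y z m) := by
  have h : ∑ i ∈ Finset.Icc 1 ((m + 1) / 2), (-1) ^ i * ((m + 1 - i).choose i : R) *
        y ^ (m + 1 + i) * z ^ (m + 1 - 2 * i) = y ^ (m + 1) * ∑ i ∈ Finset.Icc 1 ((m + 1) / 2),
        (-1) ^ i * ((m + 1 - i).choose i : R) * y ^ i * z ^ (m + 1 - 2 * i) := by
    rw [Finset.mul_sum]
    exact Finset.sum_congr rfl fun i _ => by ring
  rw [relFirst, h, genFib_succ y z (m + 1), Nat.add_sub_cancel]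
  ring

/-- With `M = m + 2`, the vanishing of the right side reads `W(M+1) = y^{M+1} W(M-1)`. The shifted
index removes the truncated subtractions. -/
theorem relSecond_eq (m : ℕ) (x y z : R) : relSecond (m + 2) x y z =
    (genFib y z (m + 4) - x * genFib y z (m + 2))
      - y ^ (m + 3) * (genFib y z (m + 2) - x * genFib y z m) := by
  have h : ∑ i ∈ Finset.Icc 1 ((m + 1) / 2), (-1) ^ i * ((m + 1 - i).choose i : R) *
        y ^ (m + 3 + i) * z ^ (m + 1 - 2 * i) = y ^ (m + 3) * ∑ i ∈ Finset.Icc 1 ((m + 1) / 2),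
        (-1) ^ i * ((m + 1 - i).choose i : R) * y ^ i * z ^ (m + 1 - 2 * i) := by
    rw [Finset.mul_sum]
    exact Finset.sum_congr rfl fun i _ => by ring
  have h1 : m + 2 - 1 = m + 1 := rfl
  have h2 : m + 2 + 1 = m + 3 := rfl
  have h3 := genFib_succ y z (m + 3)
  have h4 := genFib_succ y z (m + 1)
  rw [relSecond, h1, h2, h, Nat.add_sub_cancel]
  linear_combination -h3 + y ^ (m + 3) * h4

/-- The product `w 0 1 * w 0 (d + 1)` equals `w 0 (d + 2) + w (d + 1) 1`, and the last term is `g *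
w 0 d` by `symm` and `shift`. The row `w 0 d` is therefore determined by `g`, `e` and `w 0 1`. -/
theorem IsFusionFamily.fusionSeq_eq {n : ℕ} {g e : R} {w : ℕ → ℕ → R}
    (h : IsFusionFamily n g e w) (d : ℕ) : fusionSeq g e (w 0 1) d = w 0 d := by
  induction d using Nat.twoStepInduction with
  | zero => simp [fusionSeq, h.diag]
  | one => rfl
  | more d h1 h2 =>
    have h3 := h.mul 0 1 0 (d + 1)
    have h4 := h.shift 1 0 0 d
    simp only [zero_add, add_zero, pow_one, pow_zero, mul_one] at h3 h4
    rw [fusionSeq_add_two, h1, h2, h3, h4, h.symm (d + 1) 1, add_comm 1 (d + 1), add_comm 1 d]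
    exact add_sub_cancel_right _ _

theorem IsFusionFamily.mul_e {n : ℕ} {g e : R} {w : ℕ → ℕ → R}
    (h : IsFusionFamily n g e w) (i j : ℕ) : w i j * e = w i j := by
  have := h.shift 0 1 i j
  simp only [zero_add, pow_zero, pow_one, one_mul] at this
  rw [mul_comm, this]

theorem IsFusionFamily.pow_mul {n : ℕ} {g e : R} {w : ℕ → ℕ → R}
    (h : IsFusionFamily n g e w) (a i j : ℕ) : (g * e) ^ a * w i j = w (a + i) (a + j) := by
  rw [mul_pow, h.shift]

/-- The reason is `(g * e)^m * w 0 m = w m (2m) = w m 0 = w 0 m`. -/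
theorem IsFusionFamily.relFirst_eq_zero {m : ℕ} {g e : R} {w : ℕ → ℕ → R} (hm : 1 ≤ m)
    (h : IsFusionFamily (2 * m) g e w) : relFirst m g (g * e) (w 0 1) = 0 := by
  obtain ⟨m, rfl⟩ := Nat.exists_eq_add_of_le' hm
  rw [relFirst_eq, ← fusionSeq_eq_genFib h.sq_eq_one (h.mul_e 0 1), h.fusionSeq_eq, h.pow_mul,
    ← two_mul, ← zero_add (2 * (m + 1)), h.periodic_right, add_zero, h.symm, sub_self]

/-- The reason is `(g * e)^(m+1) * w 0 (m-1) = w (m+1) (2m) = w (m+1) 0 = w 0 (m+1)`. -/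
theorem IsFusionFamily.relSecond_eq_zero {m : ℕ} {g e : R} {w : ℕ → ℕ → R} (hm : 2 ≤ m)
    (h : IsFusionFamily (2 * m) g e w) : relSecond m g (g * e) (w 0 1) = 0 := by
  obtain ⟨m, rfl⟩ := Nat.exists_eq_add_of_le' hm
  rw [relSecond_eq, ← fusionSeq_eq_genFib h.sq_eq_one (h.mul_e 0 1),
    ← fusionSeq_eq_genFib h.sq_eq_one (h.mul_e 0 1), h.fusionSeq_eq, h.fusionSeq_eq, h.pow_mul,
    show m + 3 + (m + 1) = 0 + 2 * (m + 2) by ring, h.periodic_right, add_zero, h.symm, sub_self]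

variable (u : Rˣ) (e z : R)

/-- The extension of `fusionSeq` to negative indices. -/
def fusionInt : ℤ → R
  | Int.ofNat d => fusionSeq (u : R) e z d
  | Int.negSucc d => ((u⁻¹ ^ (d + 1) : Rˣ) : R) * fusionSeq (u : R) e z (d + 1)

theorem fusionInt_natCast (d : ℕ) : fusionInt u e z d = fusionSeq (u : R) e z d := rfl

theorem fusionInt_neg_natCast (d : ℕ) :
    fusionInt u e z (-d) = ((u⁻¹ ^ d : Rˣ) : R) * fusionSeq (u : R) e z d := by
  cases d with
  | zero => simp [fusionInt_natCast u e z 0 |>.symm]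
  | succ d => rfl

/-- The rule that defines the values at negative indices is an involution, hence valid for both
signs. It becomes the symmetry `w i j = w j i`. -/
theorem fusionInt_neg (d : ℤ) : fusionInt u e z (-d) = ((u ^ (-d) : Rˣ) : R) * fusionInt u e z d := by
  obtain ⟨d, rfl | rfl⟩ := d.eq_nat_or_neg
  · rw [fusionInt_neg_natCast, fusionInt_natCast, zpow_neg, zpow_natCast, inv_pow]
  · rw [neg_neg, fusionInt_natCast, fusionInt_neg_natCast, zpow_natCast, ← mul_assoc,
      ← Units.val_mul, inv_pow, mul_inv_cancel, Units.val_one, one_mul]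

/-- `f` satisfies the recursion `z f(d) = f(d+1) + u f(d-1)`. -/
def IsRecurrent (f : ℤ → R) : Prop := ∀ d, z * f d = f (d + 1) + u * f (d - 1)

variable {u e z}

/-- For positive `d` this is the defining recursion, and reflection carries it to negative `d`. At
`d = 0` it reads `z * (1 + e) = z + z`, where `z * e = z` is needed. -/
theorem isRecurrent_fusionInt (hz : z * e = z) :
    IsRecurrent u z (fusionInt u e z) := by
  have pos : ∀ d : ℕ, z * fusionInt u e z ((d + 1 : ℕ) : ℤ) =
      fusionInt u e z ((d + 2 : ℕ) : ℤ) + u * fusionInt u e z (d : ℤ) := by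
    intro d
    simp only [fusionInt_natCast, fusionSeq_add_two]
    ring
  intro d
  obtain ⟨d, rfl | rfl⟩ := d.eq_nat_or_neg
  · cases d with
    | zero =>
      have h1 := fusionInt_neg u e z 1
      have h2 : fusionInt u e z 1 = z := fusionInt_natCast u e z 1
      have h3 : fusionInt u e z 0 = 1 + e := fusionInt_natCast u e z 0
      simp only [Nat.cast_zero, zero_add, zero_sub, h1, h2, h3]
      rw [← mul_assoc, ← Units.val_mul, zpow_neg_one, mul_inv_cancel, Units.val_one]
      linear_combination hz
    | succ d =>
      rw [pos]
      push_cast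
      ring_nf
  · cases d with
    | zero =>
      have h1 := fusionInt_neg u e z 1
      have h2 : fusionInt u e z 1 = z := fusionInt_natCast u e z 1
      have h3 : fusionInt u e z 0 = 1 + e := fusionInt_natCast u e z 0
      simp only [Nat.cast_zero, neg_zero, zero_add, zero_sub, h1, h2, h3]
      rw [← mul_assoc, ← Units.val_mul, zpow_neg_one, mul_inv_cancel, Units.val_one]
      linear_combination hz
    | succ d =>
      have h := pos d
      rw [show -((d + 1 : ℕ) : ℤ) + 1 = -(d : ℤ) by push_cast; ring,
        show -((d + 1 : ℕ) : ℤ) - 1 = -((d + 2 : ℕ) : ℤ) by push_cast; ring]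
      rw [fusionInt_neg u e z, fusionInt_neg u e z, fusionInt_neg u e z]
      have e1 : ((u ^ (-((d + 1 : ℕ) : ℤ)) : Rˣ) : R) = u * ((u ^ (-((d + 2 : ℕ) : ℤ)) : Rˣ) : R) := by
        rw [← Units.val_mul, ← zpow_one_add]
        congr 2
      have e2 : ((u ^ (-(d : ℤ)) : Rˣ) : R) =
          u * (u * ((u ^ (-((d + 2 : ℕ) : ℤ)) : Rˣ) : R)) := by
        rw [← Units.val_mul, ← Units.val_mul, ← zpow_one_add, ← zpow_one_add]
        congr 2
        push_cast
        ring
      rw [e1, e2]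
      linear_combination (u : R) * ((u ^ (-((d + 2 : ℕ) : ℤ)) : Rˣ) : R) * h

/-- Two consecutive values determine a solution in both directions; the step backwards cancels the
unit `u`. -/
theorem IsRecurrent.eq {f h : ℤ → R} (hf : IsRecurrent u z f) (hh : IsRecurrent u z h)
    (h0 : f 0 = h 0) (h1 : f 1 = h 1) (d : ℤ) : f d = h d := by
  have key : ∀ d : ℤ, f d = h d ∧ f (d + 1) = h (d + 1) := by
    intro d
    induction d using Int.induction_on with
    | zero => exact ⟨h0, by simpa using h1⟩
    | succ d ih =>
      refine ⟨ih.2, ?_⟩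
      have a := hf (d + 1)
      have b := hh (d + 1)
      rw [add_sub_cancel_right, ih.1, ih.2] at a
      rw [add_sub_cancel_right] at b
      linear_combination b - a
    | pred d ih =>
      rw [sub_add_cancel]
      refine ⟨?_, ih.1⟩
      have a := hf (-d)
      have b := hh (-d)
      rw [ih.1, ih.2] at a
      have c : (u : R) * f (-d - 1) = u * h (-d - 1) := by linear_combination b - a
      exact u.isUnit.mul_left_cancel c
  exact (key d).1

theorem mul_fusionInt (he : e ^ 2 = 1) (hz : z * e = z) (d : ℤ) :
    e * fusionInt u e z d = fusionInt u e z d := by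
  obtain ⟨d, rfl | rfl⟩ := d.eq_nat_or_neg
  · rw [fusionInt_natCast, mul_fusionSeq he hz]
  · rw [fusionInt_neg_natCast, mul_left_comm, mul_fusionSeq he hz]

/-- For fixed `c` both sides solve the recursion in `d`. At `d = 0` they agree because `e` fixes the
sequence, and at `d = 1` the claim is the recursion itself. -/
theorem fusionInt_mul (he : e ^ 2 = 1) (hz : z * e = z) (c d : ℤ) :
    fusionInt u e z c * fusionInt u e z d =
      fusionInt u e z (c + d) + ((u ^ d : Rˣ) : R) * fusionInt u e z (c - d) := by
  have hr := isRecurrent_fusionInt (u := u) (e := e) hz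
  refine IsRecurrent.eq (u := u) (z := z) (f := fun d => fusionInt u e z c * fusionInt u e z d)
    (h := fun d => fusionInt u e z (c + d) + ((u ^ d : Rˣ) : R) * fusionInt u e z (c - d))
    ?_ ?_ ?_ ?_ d
  · intro d
    have := hr d
    linear_combination fusionInt u e z c * this
  · intro d
    have h1 := hr (c + d)
    have h2 := hr (c - d)
    have e1 : ((u ^ (d + 1) : Rˣ) : R) = u * ((u ^ d : Rˣ) : R) := by
      rw [add_comm, zpow_one_add, Units.val_mul]
    have e2 : (u : R) * ((u ^ (d - 1) : Rˣ) : R) = ((u ^ d : Rˣ) : R) := by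
      rw [← Units.val_mul, ← zpow_one_add, add_sub_cancel]
    simp only
    rw [e1, ← add_assoc, show c - (d + 1) = c - d - 1 by ring,
      show c - (d - 1) = c - d + 1 by ring]
    rw [add_sub_assoc] at h1
    linear_combination h1 + ((u ^ d : Rˣ) : R) * h2 - fusionInt u e z (c - d + 1) * e2
  · have h3 : fusionInt u e z 0 = 1 + e := fusionInt_natCast u e z 0
    have h4 := mul_fusionInt (u := u) he hz c
    simp only [h3, add_zero, zpow_zero, Units.val_one, sub_zero]
    linear_combination h4
  · have h2 : fusionInt u e z 1 = z := fusionInt_natCast u e z 1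
    simp only [h2, zpow_one]
    linear_combination hr c

variable {m : ℕ}

/-- Both sides solve the recursion in `d`, and `h0` and `h1` are the cases `d = 0` and `d = 1`. This
is why two relations suffice in the presentation. -/
theorem fusionInt_reflect (hz : z * e = z)
    (h0 : fusionInt u e z m = u ^ m * fusionInt u e z m)
    (h1 : fusionInt u e z (m + 1) = u ^ (m + 1) * fusionInt u e z (m - 1)) (d : ℤ) :
    fusionInt u e z (m + d) = ((u ^ (m + d) : Rˣ) : R) * fusionInt u e z (m - d) := by
  have hr := isRecurrent_fusionInt (u := u) (e := e) hz
  refine IsRecurrent.eq (u := u) (z := z) (f := fun d => fusionInt u e z (m + d))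
    (h := fun d => ((u ^ (m + d) : Rˣ) : R) * fusionInt u e z (m - d)) ?_ ?_ ?_ ?_ d
  · intro d
    have := hr (m + d)
    rw [add_sub_assoc, add_assoc] at this
    exact this
  · intro d
    have h2 := hr (m - d)
    have e1 : ((u ^ (m + (d + 1)) : Rˣ) : R) = u * ((u ^ (m + d) : Rˣ) : R) := by
      rw [← add_assoc, add_comm, zpow_one_add, Units.val_mul]
    have e2 : (u : R) * ((u ^ (m + (d - 1)) : Rˣ) : R) = ((u ^ (m + d) : Rˣ) : R) := by
      rw [← Units.val_mul, ← zpow_one_add]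
      congr 2
      ring
    simp only
    rw [e1, show (m : ℤ) - (d + 1) = m - d - 1 by ring, show (m : ℤ) - (d - 1) = m - d + 1 by ring]
    linear_combination ((u ^ (m + d) : Rˣ) : R) * h2 - fusionInt u e z (m - d + 1) * e2
  · simpa using h0
  · simpa [zpow_add, pow_succ] using h1

/-- The reflection about `0` followed by the one about `m` is the translation by `2m`, and the
accompanying powers of `u` multiply to `u ^ (2 * m) = 1`. -/
theorem fusionInt_periodic (hu : u ^ (2 * m) = 1) (hz : z * e = z)
    (h0 : fusionInt u e z m = u ^ m * fusionInt u e z m)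
    (h1 : fusionInt u e z (m + 1) = u ^ (m + 1) * fusionInt u e z (m - 1)) (d : ℤ) :
    fusionInt u e z (d + (2 * m : ℕ)) = fusionInt u e z d := by
  have h2 := fusionInt_reflect hz h0 h1 (d + m)
  have h3 := fusionInt_neg u e z d
  rw [show (m : ℤ) + (d + m) = d + (2 * m : ℕ) by push_cast; ring,
    show (m : ℤ) - (d + m) = -d by ring, h3, ← mul_assoc, ← Units.val_mul, ← zpow_add,
    add_neg_cancel_comm, zpow_natCast, hu, Units.val_one, one_mul] at h2
  exact h2

/-- The relations of the Green ring of `H_{2n²}`, `n = 2m`, produce a fusion family. -/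
theorem isFusionFamily_fusionInt (hu : u ^ (2 * m) = 1) (he : e ^ 2 = 1) (hz : z * e = z)
    (h0 : fusionInt u e z m = u ^ m * fusionInt u e z m)
    (h1 : fusionInt u e z (m + 1) = u ^ (m + 1) * fusionInt u e z (m - 1)) :
    IsFusionFamily (2 * m) (u : R) e fun i j => u ^ i * fusionInt u e z (j - i) where
  pow_eq_one := by rw [← Units.val_pow_eq_pow_val, hu, Units.val_one]
  sq_eq_one := he
  symm i j := by
    rw [← neg_sub (i : ℤ) j, fusionInt_neg, ← mul_assoc, ← Units.val_pow_eq_pow_val,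
      ← Units.val_pow_eq_pow_val, ← Units.val_mul, ← zpow_natCast, ← zpow_natCast, ← zpow_add]
    congr 3
    ring
  periodic i j := by
    have := fusionInt_periodic hu hz h0 h1 (j - (i + (2 * m : ℕ)))
    rw [pow_add, ← Units.val_pow_eq_pow_val u (2 * m), hu, Units.val_one, mul_one]
    rw [Nat.cast_add, ← this]
    congr 2
    ring
  diag i := by
    have h3 : fusionInt u e z 0 = 1 + e := fusionInt_natCast u e z 0
    rw [sub_self, h3]
    ring
  shift a s i j := by
    have h2 : ∀ s, e ^ s * fusionInt u e z (j - i) = fusionInt u e z (j - i) := by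
      intro s
      induction s with
      | zero => simp
      | succ s ih => rw [pow_succ, mul_assoc, mul_fusionInt he hz, ih]
    have h3 : ((a + j : ℕ) : ℤ) - (a + i : ℕ) = j - i := by push_cast; ring
    rw [h3, pow_add]
    linear_combination (u : R) ^ a * (u : R) ^ i * h2 s
  mul i j k l := by
    have h2 := fusionInt_mul (u := u) he hz (j - i) (l - k)
    have e1 : (u : R) ^ k * ((u ^ ((l : ℤ) - k) : Rˣ) : R) = u ^ l := by
      rw [← Units.val_pow_eq_pow_val, ← Units.val_mul, ← zpow_natCast, ← zpow_add,
        add_sub_cancel, zpow_natCast, Units.val_pow_eq_pow_val]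
    have h3 : ((j + l : ℕ) : ℤ) - (i + k : ℕ) = j - i + (l - k) := by push_cast; ring
    have h4 : ((j + k : ℕ) : ℤ) - (i + l : ℕ) = j - i - (l - k) := by push_cast; ring
    rw [h3, h4, pow_add, pow_add]
    linear_combination (u : R) ^ i * (u : R) ^ k * h2 +
      (u : R) ^ i * fusionInt u e z (j - i - (l - k)) * e1

end Recurrence

/-! ## Homomorphisms, direct sums and multiplicities -/

namespace FinMod

section Algebra

variable {k : Type u} {H : Type v} [Field k] [Ring H] [Algebra k H]

theorem Iso.symm {M N : FinMod k H} (h : Iso M N) : Iso N M := (iso_equivalence k H).symm h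

theorem Iso.trans {M N P : FinMod k H} (h : Iso M N) (h' : Iso N P) : Iso M P :=
  (iso_equivalence k H).trans h h'

/-- `f` commutes with the action. -/
def IsHom (M N : FinMod k H) (f : M.V →ₗ[k] N.V) : Prop :=
  ∀ (h : H) (v : M.V), f (M.ρ h v) = N.ρ h (f v)

theorem IsHom.coprod {M N P : FinMod k H} {f : M.V →ₗ[k] P.V} {g : N.V →ₗ[k] P.V}
    (hf : IsHom M P f) (hg : IsHom N P g) : IsHom (directSum M N) P (LinearMap.coprod f g) := by
  rintro h ⟨v, w⟩
  change f (M.ρ h v) + g (N.ρ h w) = P.ρ h (f v + g w)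
  rw [hf, hg, map_add]

theorem iso_of_isHom {M N : FinMod k H} {f : M.V →ₗ[k] N.V} (hf : IsHom M N f)
    (hs : LinearMap.range f = ⊤) (hd : Module.finrank k M.V = Module.finrank k N.V) :
    Iso M N := by
  have hs' := LinearMap.range_eq_top.1 hs
  exact ⟨LinearEquiv.ofBijective f
    ⟨(LinearMap.injective_iff_surjective_of_finrank_eq_finrank hd).2 hs', hs'⟩, hf⟩

theorem iso_of_subsingleton {M N : FinMod k H} [Subsingleton M.V] [Subsingleton N.V] :
    Iso M N :=
  ⟨{ (0 : M.V →ₗ[k] N.V) with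
      invFun := 0
      left_inv := fun _ => Subsingleton.elim _ _
      right_inv := fun _ => Subsingleton.elim _ _ }, fun _ _ => Subsingleton.elim _ _⟩

/-- The kernel of a homomorphism. -/
def ker {M N : FinMod k H} {f : M.V →ₗ[k] N.V} (hf : IsHom M N f) : FinMod k H where
  V := LinearMap.ker f
  ρ :=
    { toFun := fun h => (M.ρ h).restrict fun v hv => by
        rw [LinearMap.mem_ker] at hv ⊢
        rw [hf, hv, map_zero]
      map_one' := by ext; simp
      map_mul' := fun a b => by ext; simp
      map_zero' := by ext; simp
      map_add' := fun a b => by ext; simp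
      commutes' := fun r => by
        ext
        simp }

/-- A section `g` of `f` gives `M = g(S) ⊕ ker f`. Complete reducibility is obtained from explicit
pairs `f`, `g` with `S` one of the standard modules. -/
theorem iso_directSum_ker {M S : FinMod k H} {f : M.V →ₗ[k] S.V} {g : S.V →ₗ[k] M.V}
    (hf : IsHom M S f) (hg : IsHom S M g) (hfg : ∀ v, f (g v) = v) :
    Iso (directSum S (ker hf)) M := by
  have hi : IsHom (ker hf) M (LinearMap.ker f).subtype := fun h v => rfl
  refine ⟨LinearEquiv.ofBijective (LinearMap.coprod g (LinearMap.ker f).subtype) ⟨?_, ?_⟩,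
    hg.coprod hi⟩
  · rw [injective_iff_map_eq_zero]
    rintro ⟨v, w⟩ h
    rw [LinearMap.coprod_apply] at h
    have hw : f w.1 = 0 := w.2
    have h1 := congrArg f h
    simp only [map_add, hfg, Submodule.subtype_apply, hw, add_zero, map_zero] at h1
    subst h1
    simp only [map_zero, zero_add, Submodule.subtype_apply] at h
    exact Prod.ext rfl (Subtype.ext h)
  · intro m
    refine ⟨(f m, ⟨m - g (f m), ?_⟩), ?_⟩
    · simp [hfg]
    · simp

/-- The space of joint eigenvectors for given elements of `H` and eigenvalues. -/
def joint (M : FinMod k H) (S : Set (H × k)) : Submodule k M.V where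
  carrier := {v | ∀ t ∈ S, M.ρ t.1 v = t.2 • v}
  add_mem' := fun ha hb t ht => by rw [map_add, ha t ht, hb t ht, smul_add]
  zero_mem' := fun t _ => by simp
  smul_mem' := fun c v hv t ht => by rw [map_smul, hv t ht, smul_comm]

theorem mem_joint {M : FinMod k H} {S : Set (H × k)} {v : M.V} :
    v ∈ joint M S ↔ ∀ t ∈ S, M.ρ t.1 v = t.2 • v := Iff.rfl

/-- The dimension of a space of joint eigenvectors. -/
noncomputable def mult (M : FinMod k H) (S : Set (H × k)) : ℕ := Module.finrank k (joint M S)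

theorem mult_iso {M N : FinMod k H} (h : Iso M N) (S : Set (H × k)) : mult M S = mult N S := by
  obtain ⟨e, he⟩ := h
  have : (joint M S).map (e : M.V →ₗ[k] N.V) = joint N S := by
    ext w
    obtain ⟨v, rfl⟩ := e.surjective w
    rw [Submodule.mem_map_equiv, e.symm_apply_apply, mem_joint, mem_joint]
    refine forall₂_congr fun t _ => ?_
    rw [← he, ← map_smul, e.injective.eq_iff]
  rw [mult, mult, ← this]
  exact (LinearEquiv.finrank_eq (e.submoduleMap (joint M S)))

theorem mult_directSum (M N : FinMod k H) (S : Set (H × k)) :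
    mult (directSum M N) S = mult M S + mult N S := by
  let e : joint (directSum M N) S ≃ₗ[k] joint M S × joint N S :=
    { toFun := fun v => (⟨v.1.1, fun t ht => congrArg Prod.fst (v.2 t ht)⟩,
        ⟨v.1.2, fun t ht => congrArg Prod.snd (v.2 t ht)⟩)
      map_add' := fun _ _ => rfl
      map_smul' := fun _ _ => rfl
      invFun := fun v => ⟨(v.1.1, v.2.1), fun t ht => Prod.ext (v.1.2 t ht) (v.2.2 t ht)⟩
      left_inv := fun _ => rfl
      right_inv := fun _ => rfl }
  exact (LinearEquiv.finrank_eq e).trans (Module.finrank_prod ..)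

theorem mult_of_subsingleton (M : FinMod k H) [Subsingleton M.V] (S : Set (H × k)) :
    mult M S = 0 := Module.finrank_zero_of_subsingleton

end Algebra

section Bialgebra

variable {k : Type u} {H : Type v} [Field k] [Ring H] [Bialgebra k H]

theorem directSum_tensor (M N P : FinMod k H) :
    Iso (tensor (directSum M N) P) (directSum (tensor M P) (tensor N P)) := by
  refine ⟨TensorProduct.prodLeft k k M.V N.V P.V, fun h v => ?_⟩
  have key : ∀ t : H ⊗[k] H, ∀ v : (M.V × N.V) ⊗[k] P.V,
      TensorProduct.prodLeft k k M.V N.V P.V (act₂ (directSum M N) P t v) =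
        (act₂ M P t (TensorProduct.prodLeft k k M.V N.V P.V v).1,
          act₂ N P t (TensorProduct.prodLeft k k M.V N.V P.V v).2) := by
    intro t v
    induction t using TensorProduct.induction_on with
    | zero => simp; rfl
    | add a b ha hb =>
      have e : act₂ (directSum M N) P (a + b) v = act₂ (directSum M N) P a v + act₂ (directSum M N) P b v := by
        rw [map_add]
        rfl
      refine (congrArg _ e).trans (((TensorProduct.prodLeft k k M.V N.V P.V).map_add _ _).trans
        ((congrArg₂ _ ha hb).trans ?_))
      rw [map_add, map_add]
      rfl
    | tmul a b =>
      induction v using TensorProduct.induction_on with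
      | zero => simp; rfl
      | add a b ha hb =>
        simp only [map_add, Prod.fst_add, Prod.snd_add]
        exact (congrArg _ (map_add (act₂ (directSum M N) P _) _ _)).trans
          ((map_add (TensorProduct.prodLeft k k M.V N.V P.V) _ _).trans (congrArg₂ _ ha hb))
      | tmul v w => rfl
  exact key (Coalgebra.comul h) v

theorem tensor_directSum (P M N : FinMod k H) :
    Iso (tensor P (directSum M N)) (directSum (tensor P M) (tensor P N)) := by
  refine ⟨TensorProduct.prodRight k k P.V M.V N.V, fun h v => ?_⟩
  have key : ∀ t : H ⊗[k] H, ∀ v : P.V ⊗[k] (M.V × N.V),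
      TensorProduct.prodRight k k P.V M.V N.V (act₂ P (directSum M N) t v) =
        (act₂ P M t (TensorProduct.prodRight k k P.V M.V N.V v).1,
          act₂ P N t (TensorProduct.prodRight k k P.V M.V N.V v).2) := by
    intro t v
    induction t using TensorProduct.induction_on with
    | zero => simp; rfl
    | add a b ha hb =>
      have e : act₂ P (directSum M N) (a + b) v = act₂ P (directSum M N) a v + act₂ P (directSum M N) b v := by
        rw [map_add]
        rfl
      refine (congrArg _ e).trans (((TensorProduct.prodRight k k P.V M.V N.V).map_add _ _).trans
        ((congrArg₂ _ ha hb).trans ?_))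
      rw [map_add, map_add]
      rfl
    | tmul a b =>
      induction v using TensorProduct.induction_on with
      | zero => simp; rfl
      | add a b ha hb =>
        simp only [map_add, Prod.fst_add, Prod.snd_add]
        exact (congrArg _ (map_add (act₂ P (directSum M N) _) _ _)).trans
          ((map_add (TensorProduct.prodRight k k P.V M.V N.V) _ _).trans (congrArg₂ _ ha hb))
      | tmul v w => rfl
  exact key (Coalgebra.comul h) v

theorem subsingleton_tensor_left (M N : FinMod k H) [Subsingleton M.V] :
    Subsingleton (tensor M N).V :=
  inferInstanceAs (Subsingleton (M.V ⊗[k] N.V))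

theorem subsingleton_tensor_right (M N : FinMod k H) [Subsingleton N.V] :
    Subsingleton (tensor M N).V :=
  inferInstanceAs (Subsingleton (M.V ⊗[k] N.V))

theorem cls_eq_of_iso {M N : FinMod k H} (h : Iso M N) : M.cls = N.cls := by
  unfold cls
  rw [show M.isoClass = N.isoClass from Quotient.sound h]

theorem cls_directSum (M N : FinMod k H) : (directSum M N).cls = M.cls + N.cls :=
  (RingQuot.mkRingHom_rel (GreenRel.directSum M N)).trans (map_add _ _ _)

theorem cls_tensor (M N : FinMod k H) : (tensor M N).cls = M.cls * N.cls := by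
  have h : MonoidAlgebra.of ℤ (IsoClass k H) (tensor M N).isoClass =
    MonoidAlgebra.of ℤ (IsoClass k H) M.isoClass * MonoidAlgebra.of ℤ (IsoClass k H) N.isoClass :=
    map_mul (MonoidAlgebra.of ℤ (IsoClass k H)) M.isoClass N.isoClass
  unfold cls
  rw [h]
  exact map_mul _ _ _

theorem cls_trivial : (trivial k H).cls = 1 := by
  have h : MonoidAlgebra.of ℤ (IsoClass k H) (trivial k H).isoClass = 1 :=
    map_one (MonoidAlgebra.of ℤ (IsoClass k H))
  unfold cls
  rw [h]
  exact map_one _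

/-- A zero module is isomorphic to its own double, so its class equals twice itself. -/
theorem cls_of_subsingleton (M : FinMod k H) [Subsingleton M.V] : M.cls = 0 := by
  have : Subsingleton (directSum M M).V := inferInstanceAs (Subsingleton (M.V × M.V))
  have h := cls_eq_of_iso (iso_of_subsingleton (M := directSum M M) (N := M))
  rw [cls_directSum] at h
  exact add_eq_left.1 h

/-- The Green ring is additively generated by the classes of modules. -/
theorem green_induction {P : GreenRing k H → Prop} (cls : ∀ M : FinMod k H, P M.cls)
    (add : ∀ a b, P a → P b → P (a + b)) (neg : ∀ a, P a → P (-a)) (a : GreenRing k H) : P a := by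
  obtain ⟨a, rfl⟩ := RingQuot.mkRingHom_surjective (GreenRel k H) a
  change P (RingQuot.mkRingHom (GreenRel k H) a : GreenRing k H)
  have h0 : P (0 : GreenRing k H) := by
    have := add _ _ (cls (trivial k H)) (neg _ (cls (trivial k H)))
    rwa [add_neg_cancel] at this
  have hn : ∀ (b : GreenRing k H) (m : ℕ), P b → P (m • b) := by
    intro b m hb
    induction m with
    | zero => rwa [zero_smul]
    | succ m ih => rw [succ_nsmul]; exact add _ _ ih hb
  induction a using MonoidAlgebra.induction_on with
  | of c =>
    obtain ⟨M, rfl⟩ := Quotient.exists_rep c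
    exact cls M
  | add a b ha hb =>
    have h : RingQuot.mkRingHom (GreenRel k H) (a + b) =
      RingQuot.mkRingHom (GreenRel k H) a + RingQuot.mkRingHom (GreenRel k H) b := map_add _ _ _
    rw [h]
    exact add _ _ ha hb
  | smul r a ha =>
    have h : RingQuot.mkRingHom (GreenRel k H) (r • a) =
      r • RingQuot.mkRingHom (GreenRel k H) a := map_zsmul _ _ _
    rw [h]
    obtain ⟨m, rfl | rfl⟩ := r.eq_nat_or_neg
    · rw [natCast_zsmul]
      exact hn _ _ ha
    · rw [neg_smul, natCast_zsmul]
      exact neg _ (hn _ _ ha)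

/-- A ring homomorphism out of the Green ring, given by a multiplicative and additive invariant. -/
theorem exists_green_lift {R : Type*} [Ring R] (f : FinMod k H → R)
    (iso : ∀ M N, Iso M N → f M = f N) (one : f (trivial k H) = 1)
    (mul : ∀ M N, f (tensor M N) = f M * f N) (add : ∀ M N, f (directSum M N) = f M + f N) :
    ∃ F : GreenRing k H →+* R, ∀ M : FinMod k H, F M.cls = f M := by
  let f₀ : IsoClass k H →* R :=
    { toFun := Quotient.lift f fun M N h => iso M N h
      map_one' := one
      map_mul' := by
        rintro ⟨M⟩ ⟨N⟩
        exact mul M N }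
  let f₁ : MonoidAlgebra ℤ (IsoClass k H) →+* R :=
    MonoidAlgebra.liftNCRingHom (Int.castRingHom R) f₀ fun _ _ => Int.cast_commute _ _
  have h1 : ∀ M : FinMod k H, f₁ (MonoidAlgebra.of ℤ (IsoClass k H) M.isoClass) = f M := by
    intro M
    refine (MonoidAlgebra.liftNC_single _ _ _ _).trans ?_
    simp
    rfl
  refine ⟨RingQuot.lift ⟨f₁, ?_⟩, fun M => ?_⟩
  · rintro _ _ ⟨M, N⟩
    rw [map_add, h1, h1, h1, add]
  · exact (RingQuot.lift_mkRingHom_apply _ _ _).trans (h1 M)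

end Bialgebra

end FinMod

/-! ### Weight vectors, and homomorphisms out of the standard modules. -/

theorem quadSum_apply {k : Type*} {V : Type*} [Field k] [AddCommGroup V] [Module k V]
    {n : ℕ} {q : k} {X Y : Module.End k V} {α β : k} {v : V} (hX : X v = α • v)
    (hY : Y v = β • v) : quadSum n q X Y v = quadSum n q α β • v := by
  have hX' : ∀ i, (X ^ i) v = α ^ i • v := by
    intro i
    induction i with
    | zero => simp
    | succ i ih => rw [pow_succ', Module.End.mul_apply, ih, map_smul, hX, smul_smul, pow_succ]
  have hY' : ∀ i, (Y ^ i) v = β ^ i • v := by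
    intro i
    induction i with
    | zero => simp
    | succ i ih => rw [pow_succ', Module.End.mul_apply, ih, map_smul, hY, smul_smul, pow_succ]
  simp only [quadSum, LinearMap.smul_apply, LinearMap.sum_apply, Module.End.mul_apply, hX', hY',
    map_smul, smul_smul, smul_eq_mul, Finset.sum_smul, Finset.smul_sum, Finset.mul_sum]
  refine Finset.sum_congr rfl fun i _ => Finset.sum_congr rfl fun j _ => ?_
  congr 1
  ring

namespace KacPaljutkin

open FinMod

variable {k : Type u} [Field k] {n : ℕ} {q : k} {hq : IsPrimitiveRoot q n}

theorem isHom_of_gens {M N : FinMod k (H hq)} {f : M.V →ₗ[k] N.V}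
    (hx : ∀ v, f (M.ρ (x hq) v) = N.ρ (x hq) (f v)) (hy : ∀ v, f (M.ρ (y hq) v) = N.ρ (y hq) (f v))
    (hz : ∀ v, f (M.ρ (z hq) v) = N.ρ (z hq) (f v)) : IsHom M N f := by
  intro h
  induction h using induction with
  | alg r => intro v; simp
  | hx => exact hx
  | hy => exact hy
  | hz => exact hz
  | mul a b ha hb =>
    intro v
    rw [map_mul, map_mul, Module.End.mul_apply, Module.End.mul_apply, ha, hb]
  | add a b ha hb =>
    intro v
    rw [map_add, map_add, LinearMap.add_apply, LinearMap.add_apply, map_add, ha, hb]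

/-- `x` and `y` act on `v` by `q^i` and `q^j`. -/
structure IsWeight (M : FinMod k (H hq)) (i j : ℕ) (v : M.V) : Prop where
  x_apply : M.ρ (x hq) v = q ^ i • v
  y_apply : M.ρ (y hq) v = q ^ j • v

theorem isTriple_ρ (M : FinMod k (H hq)) :
    IsTriple n q (M.ρ (x hq)) (M.ρ (y hq)) (M.ρ (z hq)) := by
  have t := isTriple_gen hq
  constructor
  · rw [← map_pow, t.x_pow, map_one]
  · rw [← map_pow, t.y_pow, map_one]
  · rw [← map_mul, t.xy, map_mul]
  · rw [← map_mul, t.zx, map_mul]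
  · rw [← map_mul, t.zy, map_mul]
  · rw [← map_pow, t.z_sq, map_quadSum]

theorem x_z_apply (M : FinMod k (H hq)) (v : M.V) :
    M.ρ (x hq) (M.ρ (z hq) v) = M.ρ (z hq) (M.ρ (y hq) v) :=
  (LinearMap.congr_fun (isTriple_ρ M).zy v).symm

theorem y_z_apply (M : FinMod k (H hq)) (v : M.V) :
    M.ρ (y hq) (M.ρ (z hq) v) = M.ρ (z hq) (M.ρ (x hq) v) :=
  (LinearMap.congr_fun (isTriple_ρ M).zx v).symm

namespace IsWeight

variable {M N : FinMod k (H hq)} {i j : ℕ} {v : M.V}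

theorem z (h : IsWeight M i j v) : IsWeight M j i (M.ρ (z hq) v) :=
  ⟨by rw [x_z_apply, h.y_apply, map_smul], by rw [y_z_apply, h.x_apply, map_smul]⟩

theorem add {w : M.V} (h : IsWeight M i j v) (h' : IsWeight M i j w) : IsWeight M i j (v + w) :=
  ⟨by rw [map_add, h.x_apply, h'.x_apply, smul_add], by
    rw [map_add, h.y_apply, h'.y_apply, smul_add]⟩

theorem smul (c : k) (h : IsWeight M i j v) : IsWeight M i j (c • v) :=
  ⟨by rw [map_smul, h.x_apply, smul_comm], by rw [map_smul, h.y_apply, smul_comm]⟩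

/-- By the last defining relation `z²` is the quadratic sum in `x` and `y`, whose value at the
eigenvalues `q^i`, `q^j` is `q^{ij}`. -/
theorem z_z [NeZero n] (h : IsWeight M i j v) :
    M.ρ (KacPaljutkin.z hq) (M.ρ (KacPaljutkin.z hq) v) = q ^ (i * j) • v := by
  rw [← Module.End.mul_apply, ← pow_two, (isTriple_ρ M).z_sq, quadSum_apply h.x_apply h.y_apply,
    quadSum_pow hq]

end IsWeight

/-- The homomorphism from `S_{i,j}` which sends the first basis vector to `u`. -/
def twoHom (M : FinMod k (H hq)) (u : M.V) : (Fin 2 → k) →ₗ[k] M.V :=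
  (LinearMap.proj 0).smulRight u + (LinearMap.proj 1).smulRight (M.ρ (z hq) u)

theorem twoHom_apply (M : FinMod k (H hq)) (u : M.V) (v : Fin 2 → k) :
    twoHom M u v = v 0 • u + v 1 • M.ρ (z hq) u := rfl

theorem fst_mem_range_twoHom (M : FinMod k (H hq)) (u : M.V) :
    u ∈ LinearMap.range (twoHom M u) := ⟨Pi.single 0 1, by simp [twoHom_apply]⟩

theorem snd_mem_range_twoHom (M : FinMod k (H hq)) (u : M.V) :
    M.ρ (z hq) u ∈ LinearMap.range (twoHom M u) := ⟨Pi.single 1 1, by simp [twoHom_apply]⟩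

section

variable [NeZero n]

theorem tensor_x_apply {M N : FinMod k (H hq)} (v : M.V) (w : N.V) :
    (tensor M N).ρ (x hq) (v ⊗ₜ[k] w) = M.ρ (x hq) v ⊗ₜ[k] N.ρ (x hq) w := by
  have : (Coalgebra.comul (x hq) : H hq ⊗[k] H hq) = x hq ⊗ₜ x hq := comulHom_x hq
  rw [tensor_ρ, this]
  rfl

theorem tensor_y_apply {M N : FinMod k (H hq)} (v : M.V) (w : N.V) :
    (tensor M N).ρ (y hq) (v ⊗ₜ[k] w) = M.ρ (y hq) v ⊗ₜ[k] N.ρ (y hq) w := by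
  have : (Coalgebra.comul (y hq) : H hq ⊗[k] H hq) = y hq ⊗ₜ y hq := comulHom_y hq
  rw [tensor_ρ, this]
  rfl

theorem IsWeight.tensor {M N : FinMod k (H hq)} {i j a b : ℕ} {v : M.V} {w : N.V}
    (hv : IsWeight M i j v) (hw : IsWeight N a b w) :
    IsWeight (FinMod.tensor M N) (i + a) (j + b) (v ⊗ₜ[k] w) := by
  constructor
  · rw [tensor_x_apply, hv.x_apply, hw.x_apply, TensorProduct.smul_tmul_smul, pow_add]
    rfl
  · rw [tensor_y_apply, hv.y_apply, hw.y_apply, TensorProduct.smul_tmul_smul, pow_add]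
    rfl

/-- `Δ(z)` is the quadratic sum in `x ⊗ 1` and `1 ⊗ y`, times `z ⊗ z`. The vectors `z v` and `z w`
have the weights `(j, i)` and `(b, a)`, so `x ⊗ 1` and `1 ⊗ y` act by `q^j` and `q^a` and the sum is
`q^{ja}`. -/
theorem tensor_z_apply {M N : FinMod k (H hq)} {i j a b : ℕ} {v : M.V} {w : N.V}
    (hv : IsWeight M i j v) (hw : IsWeight N a b w) :
    (tensor M N).ρ (z hq) (v ⊗ₜ[k] w) =
      q ^ (j * a) • (M.ρ (z hq) v ⊗ₜ[k] N.ρ (z hq) w : M.V ⊗[k] N.V) := by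
  have : (Coalgebra.comul (z hq) : H hq ⊗[k] H hq) = deltaZ hq := comulHom_z hq
  rw [tensor_ρ, this, deltaZ_eq, map_mul, map_quadSum]
  have h1 : act₂ M N (x hq ⊗ₜ 1) (M.ρ (z hq) v ⊗ₜ N.ρ (z hq) w) =
      q ^ j • (M.ρ (z hq) v ⊗ₜ[k] N.ρ (z hq) w) := by
    rw [act₂_tmul, hv.z.x_apply, map_one, TensorProduct.smul_tmul']
    rfl
  have h2 : act₂ M N (1 ⊗ₜ y hq) (M.ρ (z hq) v ⊗ₜ N.ρ (z hq) w) =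
      q ^ a • (M.ρ (z hq) v ⊗ₜ[k] N.ρ (z hq) w) := by
    rw [act₂_tmul, hw.z.y_apply, map_one, TensorProduct.tmul_smul]
    rfl
  exact (quadSum_apply h1 h2).trans (by rw [quadSum_pow hq])

/-! ### Simple modules -/

variable {p : k} (hp : p ^ 2 = q)

variable (hq) in
/-- The one-dimensional module on which `x` and `y` act by `q^a` and `z` acts by `c p^{a²}`,
where `c² = 1`. -/
def oneWith (a : ℕ) {c : k} (hc : c ^ 2 = 1) : FinMod k (H hq) where
  V := k
  ρ := (Algebra.lmul k k).comp (lift hq (isTriple_one hp a hc hq))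

theorem neg_one_pow_sq (s : ℕ) : ((-1 : k) ^ s) ^ 2 = 1 := by
  rw [← pow_mul, mul_comm, pow_mul, neg_one_sq, one_pow]

variable (hq) in
/-- The one-dimensional module on which `x` and `y` act by `q^a` and `z` acts by
`(-1)^s p^{a²}`. -/
abbrev one (a s : ℕ) : FinMod k (H hq) := oneWith hq hp a (neg_one_pow_sq (k := k) s)

section

variable (a : ℕ) {c : k} (hc : c ^ 2 = 1)

theorem oneWith_isWeight (v : k) : IsWeight (oneWith hq hp a hc) a a v := by
  constructor
  · change lift hq (isTriple_one hp a hc hq) (x hq) * v = q ^ a * v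
    rw [lift_x]
  · change lift hq (isTriple_one hp a hc hq) (y hq) * v = q ^ a * v
    rw [lift_y]

theorem oneWith_z (v : k) : (oneWith hq hp a hc).ρ (z hq) v = (c * p ^ a ^ 2) • v := by
  change lift hq (isTriple_one hp a hc hq) (z hq) * v = (c * p ^ a ^ 2) * v
  rw [lift_z]

theorem finrank_oneWith : Module.finrank k (oneWith hq hp a hc).V = 1 := Module.finrank_self k

end

theorem two_x (i j : ℕ) (v : Fin 2 → k) :
    (twoDim hq i j).ρ (x hq) v = ![q ^ i * v 0, q ^ j * v 1] := by
  change (Matrix.toLinAlgEquiv' (lift hq (isTriple_two i j hq) (x hq))) v = _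
  rw [lift_x, Matrix.toLinAlgEquiv'_apply]
  ext t
  fin_cases t <;> simp [Matrix.mulVec, dotProduct]

theorem two_y (i j : ℕ) (v : Fin 2 → k) :
    (twoDim hq i j).ρ (y hq) v = ![q ^ j * v 0, q ^ i * v 1] := by
  change (Matrix.toLinAlgEquiv' (lift hq (isTriple_two i j hq) (y hq))) v = _
  rw [lift_y, Matrix.toLinAlgEquiv'_apply]
  ext t
  fin_cases t <;> simp [Matrix.mulVec, dotProduct]

theorem two_z (i j : ℕ) (v : Fin 2 → k) :
    (twoDim hq i j).ρ (z hq) v = ![q ^ (i * j) * v 1, v 0] := by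
  change (Matrix.toLinAlgEquiv' (lift hq (isTriple_two i j hq) (z hq))) v = _
  rw [lift_z, Matrix.toLinAlgEquiv'_apply]
  ext t
  fin_cases t <;> simp [Matrix.mulVec, dotProduct]

theorem finrank_twoDim (i j : ℕ) : Module.finrank k (twoDim hq i j).V = 2 := by
  change Module.finrank k (Fin 2 → k) = 2
  simp

theorem two_isWeight_fst (i j : ℕ) : IsWeight (twoDim hq i j) i j (Pi.single 0 1 : Fin 2 → k) := by
  constructor
  · rw [two_x]
    funext t
    change _ = q ^ i * _
    fin_cases t <;> simp
  · rw [two_y]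
    funext t
    change _ = q ^ j * _
    fin_cases t <;> simp

theorem two_z_fst (i j : ℕ) :
    (twoDim hq i j).ρ (z hq) (Pi.single 0 1 : Fin 2 → k) = (Pi.single 1 1 : Fin 2 → k) := by
  rw [two_z]
  funext t
  fin_cases t <;> simp

theorem two_z_snd (i j : ℕ) : (twoDim hq i j).ρ (z hq) (Pi.single 1 1 : Fin 2 → k) =
    (q ^ (i * j) • Pi.single 0 1 : Fin 2 → k) := by
  rw [two_z]
  funext t
  fin_cases t <;> simp

theorem two_isWeight_snd (i j : ℕ) : IsWeight (twoDim hq i j) j i (Pi.single 1 1 : Fin 2 → k) := by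
  rw [← two_z_fst (hq := hq) i j]
  exact (two_isWeight_fst i j).z

/-- Compatibility with `z` on the second basis vector is `z_z`. No independence of `u` and `z u` is
required, so `i` and `j` may coincide. -/
theorem isHom_twoHom {M : FinMod k (H hq)} {i j : ℕ} {u : M.V} (hu : IsWeight M i j u) :
    IsHom (twoDim hq i j) M (twoHom M u) := by
  have hx (v : Fin 2 → k) : twoHom M u ![q ^ i * v 0, q ^ j * v 1] =
      M.ρ (x hq) (twoHom M u v) := by
    simp [twoHom_apply, hu.x_apply, hu.z.x_apply, smul_smul, mul_comm]
  have hy (v : Fin 2 → k) : twoHom M u ![q ^ j * v 0, q ^ i * v 1] =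
      M.ρ (y hq) (twoHom M u v) := by
    simp [twoHom_apply, hu.y_apply, hu.z.y_apply, smul_smul, mul_comm]
  have hz (v : Fin 2 → k) : twoHom M u ![q ^ (i * j) * v 1, v 0] =
      M.ρ (z hq) (twoHom M u v) := by
    simp [twoHom_apply, hu.z_z, smul_smul, mul_comm, add_comm]
  exact isHom_of_gens (fun v => (congrArg _ (two_x i j v)).trans (hx v))
    (fun v => (congrArg _ (two_y i j v)).trans (hy v))
    (fun v => (congrArg _ (two_z i j v)).trans (hz v))

theorem isHom_oneHom {M : FinMod k (H hq)} {a : ℕ} {c : k} {hc : c ^ 2 = 1} {u : M.V}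
    (hu : IsWeight M a a u) (hz : M.ρ (z hq) u = (c * p ^ a ^ 2) • u) :
    IsHom (oneWith hq hp a hc) M (LinearMap.toSpanSingleton k M.V u) := by
  have key (b : H hq) (r : k) (hb : M.ρ b u = r • u) (v : k) :
      LinearMap.toSpanSingleton k M.V u (r • v) =
        M.ρ b (LinearMap.toSpanSingleton k M.V u v) := by
    simp [hb, smul_smul, mul_comm]
  exact isHom_of_gens
    (fun v => (congrArg _ (oneWith_isWeight hp a hc v).x_apply).trans (key _ _ hu.x_apply v))
    (fun v => (congrArg _ (oneWith_isWeight hp a hc v).y_apply).trans (key _ _ hu.y_apply v))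
    (fun v => (congrArg _ (oneWith_z hp a hc v)).trans (key _ _ hz v))

end

end KacPaljutkin

/-! ### Isomorphisms and tensor products among the standard modules. -/

theorem Module.Basis.eq_top_of_mem {k V ι : Type*} [Field k] [AddCommGroup V] [Module k V]
    (b : Module.Basis ι k V) {S : Submodule k V} (h : ∀ i, b i ∈ S) : S = ⊤ := by
  rw [eq_top_iff, ← b.span_eq, Submodule.span_le]
  rintro _ ⟨i, rfl⟩
  exact h i

theorem Module.Basis.eq_top_of_tmul_mem {k V W ι κ : Type*} [Field k] [AddCommGroup V] [Module k V]
    [AddCommGroup W] [Module k W] (b : Module.Basis ι k V) (c : Module.Basis κ k W)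
    {S : Submodule k (V ⊗[k] W)} (h : ∀ i j, b i ⊗ₜ[k] c j ∈ S) : S = ⊤ := by
  refine (b.tensorProduct c).eq_top_of_mem ?_
  rintro ⟨i, j⟩
  rw [Module.Basis.tensorProduct_apply]
  exact h i j

namespace KacPaljutkin

open FinMod

variable {k : Type u} [Field k] {n : ℕ} {q : k} {hq : IsPrimitiveRoot q n} [NeZero n]

include hq in
theorem q_pow_ne_zero (m : ℕ) : q ^ m ≠ 0 := pow_ne_zero _ (hq.ne_zero (NeZero.ne n))

omit [NeZero n] in
theorem mem_of_smul_mem {M : FinMod k (H hq)} {S : Submodule k M.V} {r : k} {v : M.V}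
    (hr : r ≠ 0) (h : r • v ∈ S) : v ∈ S := (S.smul_mem_iff hr).1 h

theorem eq_top_of_single_mem {S : Submodule k (Fin 2 → k)} (h0 : Pi.single 0 1 ∈ S)
    (h1 : Pi.single 1 1 ∈ S) : S = ⊤ := by
  refine (Pi.basisFun k (Fin 2)).eq_top_of_mem fun i => ?_
  rw [Pi.basisFun_apply]
  fin_cases i
  · exact h0
  · exact h1

theorem iso_twoDim_of_range {M : FinMod k (H hq)} {i j : ℕ} {u : M.V} (hu : IsWeight M i j u)
    (hs : LinearMap.range (twoHom M u) = ⊤) (hd : Module.finrank k M.V = 2) :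
    Iso M (twoDim hq i j) :=
  (iso_of_isHom (isHom_twoHom hu) hs ((finrank_twoDim i j).trans hd.symm)).symm

theorem twoDim_congr {i j a b : ℕ} (hi : q ^ i = q ^ a) (hj : q ^ j = q ^ b) :
    Iso (twoDim hq i j) (twoDim hq a b) := by
  refine iso_twoDim_of_range (u := (Pi.single 0 1 : Fin 2 → k))
    ⟨?_, ?_⟩ (eq_top_of_single_mem (fst_mem_range_twoHom _ _) ?_) (finrank_twoDim _ _)
  · rw [(two_isWeight_fst i j).x_apply, hi]
  · rw [(two_isWeight_fst i j).y_apply, hj]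
  · have := snd_mem_range_twoHom (twoDim hq i j) (Pi.single 0 1 : Fin 2 → k)
    rwa [two_z_fst] at this

/-- The second basis vector has weight `(j, i)`, and `z` sends it to a nonzero multiple of the
first. -/
theorem twoDim_symm (i j : ℕ) : Iso (twoDim hq i j) (twoDim hq j i) := by
  refine iso_twoDim_of_range (two_isWeight_snd i j)
    (eq_top_of_single_mem ?_ (fst_mem_range_twoHom _ _)) (finrank_twoDim _ _)
  have := snd_mem_range_twoHom (twoDim hq i j) (Pi.single 1 1 : Fin 2 → k)
  rw [two_z_snd] at this
  exact mem_of_smul_mem (M := twoDim hq i j) (q_pow_ne_zero (hq := hq) _) this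

/-- With the standard basis `e₀, e₁`, the vectors `e₀ ⊗ e₀` and `e₀ ⊗ e₁` have the two required
weights. Up to nonzero scalars `z` sends them to `e₁ ⊗ e₁` and `e₁ ⊗ e₀`, so the two resulting
homomorphisms together are onto, and dimensions agree. -/
theorem twoDim_tensor_twoDim (i j a b : ℕ) :
    Iso (tensor (twoDim hq i j) (twoDim hq a b))
      (directSum (twoDim hq (i + a) (j + b)) (twoDim hq (i + b) (j + a))) := by
  let T := tensor (twoDim hq i j) (twoDim hq a b)
  let u₀ : (Fin 2 → k) ⊗[k] (Fin 2 → k) := Pi.single 0 1 ⊗ₜ Pi.single 0 1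
  let u₁ : (Fin 2 → k) ⊗[k] (Fin 2 → k) := Pi.single 0 1 ⊗ₜ Pi.single 1 1
  have h0 : IsWeight T (i + a) (j + b) u₀ := (two_isWeight_fst i j).tensor (two_isWeight_fst a b)
  have h1 : IsWeight T (i + b) (j + a) u₁ := (two_isWeight_fst i j).tensor (two_isWeight_snd a b)
  have z0 : T.ρ (z hq) u₀ = (q ^ (j * a) • (Pi.single 1 1 ⊗ₜ Pi.single 1 1) :
      (Fin 2 → k) ⊗[k] (Fin 2 → k)) := by
    have := tensor_z_apply (two_isWeight_fst (hq := hq) i j) (two_isWeight_fst (hq := hq) a b)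
    rwa [two_z_fst, two_z_fst] at this
  have z1 : T.ρ (z hq) u₁ = (q ^ (j * b) • (Pi.single 1 1 ⊗ₜ (q ^ (a * b) • Pi.single 0 1)) :
      (Fin 2 → k) ⊗[k] (Fin 2 → k)) := by
    have := tensor_z_apply (two_isWeight_fst (hq := hq) i j) (two_isWeight_snd (hq := hq) a b)
    rwa [two_z_fst, two_z_snd] at this
  refine (iso_of_isHom (M := directSum _ _) ((isHom_twoHom h0).coprod (isHom_twoHom h1)) ?_ ?_).symm
  · refine (LinearMap.range_coprod _ _).trans ?_
    refine Module.Basis.eq_top_of_tmul_mem (Pi.basisFun k (Fin 2)) (Pi.basisFun k (Fin 2)) ?_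
    have m0 := (z0 ▸ snd_mem_range_twoHom T u₀ : _ ∈ LinearMap.range (twoHom T u₀))
    have m1 := (z1 ▸ snd_mem_range_twoHom T u₁ : _ ∈ LinearMap.range (twoHom T u₁))
    rw [TensorProduct.tmul_smul] at m1
    have l₀ : ∀ v ∈ LinearMap.range (twoHom T u₀), v ∈ (LinearMap.range (twoHom T u₀) ⊔
        LinearMap.range (twoHom T u₁) : Submodule k T.V) := fun _ => Submodule.mem_sup_left
    have l₁ : ∀ v ∈ LinearMap.range (twoHom T u₁), v ∈ (LinearMap.range (twoHom T u₀) ⊔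
        LinearMap.range (twoHom T u₁) : Submodule k T.V) := fun _ => Submodule.mem_sup_right
    intro c d
    rw [Pi.basisFun_apply, Pi.basisFun_apply]
    fin_cases c <;> fin_cases d
    · exact l₀ _ (fst_mem_range_twoHom T u₀)
    · exact l₁ _ (fst_mem_range_twoHom T u₁)
    · exact l₁ _ (mem_of_smul_mem (M := T) (q_pow_ne_zero (hq := hq) _)
        (mem_of_smul_mem (M := T) (q_pow_ne_zero (hq := hq) _) m1))
    · exact l₀ _ (mem_of_smul_mem (M := T) (q_pow_ne_zero (hq := hq) _) m0)
  · refine (Module.finrank_prod ..).trans (Eq.trans ?_ (Module.finrank_tensorProduct ..).symm)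
    simp only [finrank_twoDim]

variable {p : k} {hp : p ^ 2 = q} {a : ℕ} {c : k} {hc : c ^ 2 = 1}

include hp in
theorem p_pow_ne_zero (hq : IsPrimitiveRoot q n) (m : ℕ) : p ^ m ≠ 0 := by
  refine pow_ne_zero _ fun h => hq.ne_zero (NeZero.ne n) ?_
  rw [← hp, h]
  simp

theorem c_ne_zero (hc : c ^ 2 = 1) : c ≠ 0 := by
  rintro rfl
  simp at hc

theorem iso_oneWith_of_range {M : FinMod k (H hq)} {u : M.V} (hu : IsWeight M a a u)
    (hz : M.ρ (z hq) u = (c * p ^ a ^ 2) • u) (hs : ∀ v : M.V, ∃ r : k, r • u = v)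
    (hd : Module.finrank k M.V = 1) : Iso M (oneWith hq hp a hc) :=
  (iso_of_isHom (isHom_oneHom hp hu hz) (LinearMap.range_eq_top.2 hs)
    ((finrank_oneWith hp a hc).trans hd.symm)).symm

theorem oneWith_congr {b : ℕ} {d : k} {hd : d ^ 2 = 1} (hab : q ^ a = q ^ b)
    (hz : c * p ^ a ^ 2 = d * p ^ b ^ 2) : Iso (oneWith hq hp a hc) (oneWith hq hp b hd) := by
  refine iso_oneWith_of_range (u := (1 : k)) ⟨?_, ?_⟩ ?_ (fun v => ⟨v, ?_⟩) (finrank_oneWith ..)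
  · rw [(oneWith_isWeight hp a hc 1).x_apply, hab]
  · rw [(oneWith_isWeight hp a hc 1).y_apply, hab]
  · rw [oneWith_z, hz]
    rfl
  · exact mul_one (M := k) v

theorem oneWith_tensor_oneWith {b : ℕ} {d e : k} {hd : d ^ 2 = 1} {he : e ^ 2 = 1}
    (h : c * d = e) : Iso (tensor (oneWith hq hp a hc) (oneWith hq hp b hd))
      (oneWith hq hp (a + b) he) := by
  let T := tensor (oneWith hq hp a hc) (oneWith hq hp b hd)
  let u : k ⊗[k] k := 1 ⊗ₜ 1
  have h0 : IsWeight T (a + b) (a + b) u :=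
    (oneWith_isWeight hp a hc 1).tensor (oneWith_isWeight hp b hd 1)
  have z0 : T.ρ (z hq) u = ((e * p ^ (a + b) ^ 2) • u : k ⊗[k] k) := by
    have := tensor_z_apply (oneWith_isWeight (hq := hq) hp a hc 1)
      (oneWith_isWeight (hq := hq) hp b hd 1)
    rw [oneWith_z, oneWith_z] at this
    refine this.trans ?_
    refine (congrArg _ (TensorProduct.smul_tmul_smul _ _ _ _)).trans ?_
    -- The twist `q^{ab} = p^{2ab}` from `tensor_z_apply` completes the square in the exponent.
    have h1 : q ^ (a * b) * (c * p ^ a ^ 2 * (d * p ^ b ^ 2)) = e * p ^ (a + b) ^ 2 := by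
      rw [← h, ← hp]
      ring
    rw [smul_smul, h1]
    rfl
  refine iso_oneWith_of_range h0 z0 (fun v => ?_) ?_
  · change k ⊗[k] k at v
    refine ⟨TensorProduct.lid k k v, ?_⟩
    apply (TensorProduct.lid k k).injective
    refine (map_smul (TensorProduct.lid k k) _ u).trans ?_
    simp [u]
  · refine (Module.finrank_tensorProduct ..).trans ?_
    simp only [finrank_oneWith, mul_one]

/-- The vector `1 ⊗ e₀` and its image under `z` span the product. The sign `c` only rescales the
second of them, so the result does not depend on it; in the Green ring this makes `e` fix every `w i
j`. -/
theorem oneWith_tensor_twoDim (i j : ℕ) : Iso (tensor (oneWith hq hp a hc) (twoDim hq i j))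
    (twoDim hq (a + i) (a + j)) := by
  let T := tensor (oneWith hq hp a hc) (twoDim hq i j)
  let u : k ⊗[k] (Fin 2 → k) := 1 ⊗ₜ Pi.single 0 1
  have h0 : IsWeight T (a + i) (a + j) u :=
    (oneWith_isWeight hp a hc 1).tensor (two_isWeight_fst i j)
  have z0 : T.ρ (z hq) u = (q ^ (a * i) • (((c * p ^ a ^ 2) • (1 : k)) ⊗ₜ Pi.single 1 1) :
      k ⊗[k] (Fin 2 → k)) := by
    have := tensor_z_apply (oneWith_isWeight (hq := hq) hp a hc 1)
      (two_isWeight_fst (hq := hq) i j)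
    rwa [oneWith_z, two_z_fst] at this
  refine iso_twoDim_of_range h0 ?_ ?_
  · refine Module.Basis.eq_top_of_tmul_mem (Module.Basis.singleton Unit k)
      (Pi.basisFun k (Fin 2)) ?_
    have m0 := (z0 ▸ snd_mem_range_twoHom T u : _ ∈ LinearMap.range (twoHom T u))
    intro s t
    rw [Module.Basis.singleton_apply, Pi.basisFun_apply]
    fin_cases t
    · exact fst_mem_range_twoHom T u
    · exact mem_of_smul_mem (M := T) (mul_ne_zero (c_ne_zero hc) (p_pow_ne_zero (hp := hp) hq _))
        (mem_of_smul_mem (M := T) (q_pow_ne_zero (hq := hq) _) m0)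
  · refine (Module.finrank_tensorProduct ..).trans ?_
    simp only [finrank_oneWith, finrank_twoDim, one_mul]

theorem twoDim_tensor_oneWith (i j : ℕ) : Iso (tensor (twoDim hq i j) (oneWith hq hp a hc))
    (twoDim hq (a + i) (a + j)) := by
  rw [add_comm a, add_comm a]
  let T := tensor (twoDim hq i j) (oneWith hq hp a hc)
  let u : (Fin 2 → k) ⊗[k] k := Pi.single 0 1 ⊗ₜ 1
  have h0 : IsWeight T (i + a) (j + a) u :=
    (two_isWeight_fst i j).tensor (oneWith_isWeight hp a hc 1)
  have z0 : T.ρ (z hq) u = (q ^ (j * a) • (Pi.single 1 1 ⊗ₜ ((c * p ^ a ^ 2) • (1 : k))) :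
      (Fin 2 → k) ⊗[k] k) := by
    have := tensor_z_apply (two_isWeight_fst (hq := hq) i j)
      (oneWith_isWeight (hq := hq) hp a hc 1)
    rwa [oneWith_z, two_z_fst] at this
  refine iso_twoDim_of_range h0 ?_ ?_
  · refine Module.Basis.eq_top_of_tmul_mem (Pi.basisFun k (Fin 2))
      (Module.Basis.singleton Unit k) ?_
    have m0 := (z0 ▸ snd_mem_range_twoHom T u : _ ∈ LinearMap.range (twoHom T u))
    rw [TensorProduct.tmul_smul] at m0
    intro t s
    rw [Module.Basis.singleton_apply, Pi.basisFun_apply]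
    fin_cases t
    · exact fst_mem_range_twoHom T u
    · exact mem_of_smul_mem (M := T) (mul_ne_zero (c_ne_zero hc) (p_pow_ne_zero (hp := hp) hq _))
        (mem_of_smul_mem (M := T) (q_pow_ne_zero (hq := hq) _) m0)
  · refine (Module.finrank_tensorProduct ..).trans ?_
    simp only [finrank_oneWith, finrank_twoDim, mul_one]

variable (hp) in
-- Here `x` and `y` are scalars and `z²` is the square of `p^{i²}`. The eigenvectors of `z` are
-- `p^{i²} e₀ ± e₁`, which are independent because `2 ≠ 0`.
theorem twoDim_diag (h2 : (2 : k) ≠ 0) (i : ℕ) :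
    Iso (twoDim hq i i) (directSum (one hq hp i 0) (one hq hp i 1)) := by
  let e₀ : Fin 2 → k := Pi.single 0 1
  let e₁ : Fin 2 → k := Pi.single 1 1
  have hpq : p ^ i ^ 2 * p ^ i ^ 2 = q ^ (i * i) := by rw [← hp]; ring
  have w (r s : k) : IsWeight (twoDim hq i i) i i (r • e₀ + s • e₁ : Fin 2 → k) :=
    ((two_isWeight_fst i i).smul r).add ((two_isWeight_snd i i).smul s)
  have hz (r s : k) : (twoDim hq i i).ρ (z hq) (r • e₀ + s • e₁ : Fin 2 → k) =
      ((s * q ^ (i * i)) • e₀ + r • e₁ : Fin 2 → k) := by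
    rw [two_z]
    funext t
    fin_cases t <;> simp [e₀, e₁, mul_comm]
  have z0 : (twoDim hq i i).ρ (z hq) (p ^ i ^ 2 • e₀ + (1 : k) • e₁ : Fin 2 → k) =
      (((-1) ^ 0 * p ^ i ^ 2) • (p ^ i ^ 2 • e₀ + (1 : k) • e₁) : Fin 2 → k) := by
    rw [hz, smul_add, smul_smul, smul_smul, pow_zero, one_mul, one_mul, mul_one, hpq]
  have z1 : (twoDim hq i i).ρ (z hq) (p ^ i ^ 2 • e₀ + (-1 : k) • e₁ : Fin 2 → k) =
      (((-1) ^ 1 * p ^ i ^ 2) • (p ^ i ^ 2 • e₀ + (-1 : k) • e₁) : Fin 2 → k) := by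
    rw [hz, smul_add, smul_smul, smul_smul, pow_one, mul_assoc, hpq]
    simp
    rfl
  refine (iso_of_isHom (M := directSum (one hq hp i 0) (one hq hp i 1))
    ((isHom_oneHom hp (w _ 1) z0).coprod (isHom_oneHom hp (w _ (-1)) z1)) ?_ ?_).symm
  · rw [eq_top_iff]
    intro v _
    change Fin 2 → k at v
    have hp0 := p_pow_ne_zero (hp := hp) hq (i ^ 2)
    -- These are the coordinates of `v` in that eigenbasis.
    refine ⟨((2⁻¹ * (v 0 / p ^ i ^ 2 + v 1) : k), (2⁻¹ * (v 0 / p ^ i ^ 2 - v 1) : k)), ?_⟩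
    change ((2⁻¹ * (v 0 / p ^ i ^ 2 + v 1)) • (p ^ i ^ 2 • e₀ + (1 : k) • e₁) +
      (2⁻¹ * (v 0 / p ^ i ^ 2 - v 1)) • (p ^ i ^ 2 • e₀ + (-1 : k) • e₁) : Fin 2 → k) = v
    funext t
    fin_cases t
    · simp [e₀, e₁]
      field_simp
      ring
    · simp [e₀, e₁]
      field_simp
      ring
  · refine (Module.finrank_prod ..).trans ?_
    rw [finrank_twoDim, finrank_oneWith, finrank_oneWith]

end KacPaljutkin

/-! ### Weight projections and complete reducibility. -/

theorem commute_rootIdem {k : Type*} {A : Type*} [Field k] [Ring A] [Algebra k A] {n : ℕ} {q : k}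
    {a b : A} (h : Commute a b) (i : ℕ) : Commute a (rootIdem n q i b) :=
  (Commute.sum_right _ _ _ fun j _ => (h.pow_right j).smul_right _).smul_right _

theorem exists_dual_eq_one {k V : Type*} [Field k] [AddCommGroup V] [Module k V] {v : V}
    (hv : v ≠ 0) : ∃ φ : V →ₗ[k] k, φ v = 1 := by
  obtain ⟨φ, hφ⟩ : ∃ φ : V →ₗ[k] k, φ v ≠ 0 := by
    by_contra! h
    exact hv ((Module.forall_dual_apply_eq_zero_iff k v).1 h)
  exact ⟨(φ v)⁻¹ • φ, by simp [hφ]⟩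

namespace KacPaljutkin

open FinMod

variable {k : Type u} [Field k] {n : ℕ} {q : k} {hq : IsPrimitiveRoot q n}

/-- The projection onto the space of vectors on which `x` and `y` act by `q^a` and `q^b`. -/
def proj (M : FinMod k (H hq)) (a b : ℕ) : Module.End k M.V :=
  rootIdem n q a (M.ρ (x hq)) * rootIdem n q b (M.ρ (y hq))

section

variable (M : FinMod k (H hq)) (a b : ℕ) (v : M.V)

theorem commute_x_proj : Commute (M.ρ (x hq)) (proj M a b) :=
  (commute_rootIdem (Commute.refl _) a).mul_right (commute_rootIdem (isTriple_ρ M).xy b)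

theorem commute_y_proj : Commute (M.ρ (y hq)) (proj M a b) :=
  (commute_rootIdem (isTriple_ρ M).xy.symm a).mul_right (commute_rootIdem (Commute.refl _) b)

variable [NeZero n]

theorem isWeight_proj : IsWeight M a b (proj M a b v) := by
  have t := isTriple_ρ M
  constructor
  · rw [← Module.End.mul_apply, proj, ← mul_assoc, mul_rootIdem hq t.x_pow, smul_mul_assoc]
    rfl
  · have hc : Commute (M.ρ (y hq)) (rootIdem n q a (M.ρ (x hq))) :=
      commute_rootIdem t.xy.symm a
    rw [← Module.End.mul_apply, proj, ← mul_assoc, hc.eq, mul_assoc, mul_rootIdem hq t.y_pow,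
      mul_smul_comm]
    rfl

theorem proj_x_apply : proj M a b (M.ρ (x hq) v) = q ^ a • proj M a b v :=
  (LinearMap.congr_fun (commute_x_proj M a b).eq v).symm.trans (isWeight_proj M a b v).x_apply

theorem proj_y_apply : proj M a b (M.ρ (y hq) v) = q ^ b • proj M a b v :=
  (LinearMap.congr_fun (commute_y_proj M a b).eq v).symm.trans (isWeight_proj M a b v).y_apply

/-- Although `z` permutes the weight spaces, `z²` is a polynomial in `x` and `y` and so commutes
with the projections. -/
theorem proj_z_z_apply :
    proj M a b (M.ρ (z hq) (M.ρ (z hq) v)) = q ^ (a * b) • proj M a b v := by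
  have h := (isTriple_ρ M).z_sq
  have hc : Commute (proj M a b) (M.ρ (z hq) ^ 2) := by
    rw [h]
    exact commute_quadSum (commute_x_proj M a b).symm (commute_y_proj M a b).symm
  have h1 := LinearMap.congr_fun hc.eq v
  rw [pow_two] at h1
  exact h1.trans (isWeight_proj M a b v).z_z

theorem sum_rootIdem {A : Type*} [Ring A] [Algebra k A] (hq : IsPrimitiveRoot q n) (Y : A) :
    ∑ i ∈ Finset.range n, rootIdem n q i Y = 1 := by
  have := quadSum_one_left hq Y
  rw [quadSum_eq] at this
  simpa using this

theorem sum_proj : ∑ a ∈ Finset.range n, ∑ b ∈ Finset.range n, proj M a b v = v := by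
  have h : ∑ a ∈ Finset.range n, ∑ b ∈ Finset.range n, proj M a b = 1 := by
    simp only [proj]
    rw [← Finset.sum_mul_sum, sum_rootIdem hq, sum_rootIdem hq, one_mul]
  have h1 := LinearMap.congr_fun h v
  simpa only [LinearMap.sum_apply, Module.End.one_apply] using h1

variable {M a b v} {c d : ℕ}

theorem proj_eq_zero_left (hv : IsWeight M c d v) (h : q ^ a ≠ q ^ c) : proj M a b v = 0 := by
  have h1 := proj_x_apply M a b v
  rw [hv.x_apply, map_smul, ← sub_eq_zero, ← sub_smul] at h1
  exact (smul_eq_zero.1 h1).resolve_left (sub_ne_zero.2 h.symm)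

theorem proj_eq_zero_right (hv : IsWeight M c d v) (h : q ^ b ≠ q ^ d) : proj M a b v = 0 := by
  have h1 := proj_y_apply M a b v
  rw [hv.y_apply, map_smul, ← sub_eq_zero, ← sub_smul] at h1
  exact (smul_eq_zero.1 h1).resolve_left (sub_ne_zero.2 h.symm)

/-- The projections with indices below `n` add up to the identity, and all others kill `v`, since
powers of `q` below `n` are distinct. -/
theorem proj_of_isWeight (hv : IsWeight M a b v) (ha : a < n) (hb : b < n) :
    proj M a b v = v := by
  conv_rhs => rw [← sum_proj M v]
  rw [Finset.sum_eq_single_of_mem a (Finset.mem_range.2 ha),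
    Finset.sum_eq_single_of_mem b (Finset.mem_range.2 hb)]
  · intro c hc hne
    exact proj_eq_zero_right hv fun h => hne (hq.pow_inj (Finset.mem_range.1 hc) hb h)
  · intro c hc hne
    exact Finset.sum_eq_zero fun _ _ =>
      proj_eq_zero_left hv fun h => hne (hq.pow_inj (Finset.mem_range.1 hc) ha h)

end

variable [NeZero n] {p : k} (hp : p ^ 2 = q)

/-- A vector of weight `(a, b)`, `a ≠ b`, splits off a copy of `S_{a,b}`. -/
theorem exists_split_twoDim {M : FinMod k (H hq)} {a b : ℕ} (ha : a < n) (hb : b < n)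
    (hab : a ≠ b) {v : M.V} (hv : IsWeight M a b v) (hv0 : v ≠ 0) :
    ∃ N, Iso (directSum (twoDim hq a b) N) M := by
  obtain ⟨φ, hφ⟩ := exists_dual_eq_one (k := k) hv0
  have hc := q_pow_ne_zero (hq := hq) (a * b)
  -- A retraction of `twoHom M v`. The first coordinate of `z • w` in `S_{a,b}` is `q^{ab} * w 1`,
  -- so compatibility with `z` forces the second coordinate of `f`.
  let f : M.V →ₗ[k] (Fin 2 → k) := LinearMap.pi
    ![φ ∘ₗ proj M a b, (q ^ (a * b))⁻¹ • φ ∘ₗ proj M a b ∘ₗ M.ρ (z hq)]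
  have f_apply (m : M.V) : f m =
      ![φ (proj M a b m), (q ^ (a * b))⁻¹ * φ (proj M a b (M.ρ (z hq) m))] := by
    funext t
    fin_cases t <;> rfl
  have hf : IsHom M (twoDim hq a b) f := by
    refine isHom_of_gens (fun m => ?_) (fun m => ?_) (fun m => ?_)
    · refine (f_apply _).trans (Eq.trans ?_ (two_x a b (f m)).symm)
      rw [f_apply, proj_x_apply, ← y_z_apply, proj_y_apply]
      funext t
      fin_cases t
      · simp
      · simp [mul_left_comm]
    · refine (f_apply _).trans (Eq.trans ?_ (two_y a b (f m)).symm)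
      rw [f_apply, proj_y_apply, ← x_z_apply, proj_x_apply]
      funext t
      fin_cases t
      · simp
      · simp [mul_left_comm]
    · refine (f_apply _).trans (Eq.trans ?_ (two_z a b (f m)).symm)
      rw [f_apply, proj_z_z_apply]
      funext t
      fin_cases t
      · simp [hc]
      · simp [hc]
  -- The weight of `z v` is `(b, a)`; this is the place where `a ≠ b` enters.
  have hz : proj M a b (M.ρ (z hq) v) = 0 :=
    proj_eq_zero_left hv.z fun h => hab (hq.pow_inj ha hb h)
  have hfv : f v = Pi.single 0 1 := by
    rw [f_apply, proj_of_isWeight hv ha hb, hz, hφ]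
    funext t
    fin_cases t <;> simp
  have hfz : f (M.ρ (z hq) v) = Pi.single 1 1 := by
    rw [f_apply, hz, proj_z_z_apply, proj_of_isWeight hv ha hb, map_smul, hφ]
    funext t
    fin_cases t <;> simp [hc]
  refine ⟨ker hf, iso_directSum_ker hf (isHom_twoHom hv) fun (w : Fin 2 → k) => ?_⟩
  change f (twoHom M v w) = w
  rw [twoHom_apply, map_add, map_smul, map_smul, hfv, hfz]
  funext t
  fin_cases t <;> simp

/-- A vector of weight `(a, a)` which is an eigenvector of `z` splits off a one-dimensional
module. -/
theorem exists_split_oneWith {M : FinMod k (H hq)} (h2 : (2 : k) ≠ 0) {a : ℕ} (ha : a < n) {c : k}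
    (hc : c ^ 2 = 1) {v : M.V} (hv : IsWeight M a a v)
    (hz : M.ρ (z hq) v = (c * p ^ a ^ 2) • v) (hv0 : v ≠ 0) :
    ∃ N, Iso (directSum (oneWith hq hp a hc) N) M := by
  obtain ⟨φ, hφ⟩ := exists_dual_eq_one (k := k) hv0
  set d := c * p ^ a ^ 2 with hd
  have hd0 : d ≠ 0 := mul_ne_zero (c_ne_zero hc) (p_pow_ne_zero (hp := hp) hq _)
  have hdd : q ^ (a * a) = d * d := by
    rw [hd, ← hp]
    linear_combination -p ^ (2 * a ^ 2) * hc
  -- The functional `φ ∘ proj` is averaged over the action of `z / d`, whose square is the identity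
  -- on the weight space because `d² = q^{a²}`. The factor `1/2` makes `f v = 1`.
  let f : M.V →ₗ[k] k :=
    (2 : k)⁻¹ • (φ ∘ₗ proj M a a + d⁻¹ • φ ∘ₗ proj M a a ∘ₗ M.ρ (z hq))
  have f_apply (m : M.V) : f m =
      2⁻¹ * (φ (proj M a a m) + d⁻¹ * φ (proj M a a (M.ρ (z hq) m))) := rfl
  have hf : IsHom M (oneWith hq hp a hc) f := by
    refine isHom_of_gens (fun m => ?_) (fun m => ?_) (fun m => ?_)
    · refine Eq.trans ?_ (oneWith_isWeight hp a hc (f m)).x_apply.symm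
      change f _ = q ^ a * f m
      rw [f_apply, f_apply, proj_x_apply, ← y_z_apply, proj_y_apply]
      simp only [map_smul, smul_eq_mul]
      ring
    · refine Eq.trans ?_ (oneWith_isWeight hp a hc (f m)).y_apply.symm
      change f _ = q ^ a * f m
      rw [f_apply, f_apply, proj_y_apply, ← x_z_apply, proj_x_apply]
      simp only [map_smul, smul_eq_mul]
      ring
    · refine Eq.trans ?_ (oneWith_z hp a hc (f m)).symm
      change f _ = d * f m
      rw [f_apply, f_apply, proj_z_z_apply, map_smul, hdd, smul_eq_mul]
      field_simp
      ring
  have hg : IsHom (oneWith hq hp a hc) M (LinearMap.toSpanSingleton k M.V v) :=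
    isHom_oneHom hp hv hz
  refine ⟨ker hf, iso_directSum_ker hf hg fun (w : k) => ?_⟩
  change f (w • v) = w
  rw [map_smul, f_apply, hz, map_smul, proj_of_isWeight hv ha ha, map_smul, hφ]
  simp only [smul_eq_mul, mul_one]
  rw [inv_mul_cancel₀ hd0]
  field_simp
  ring

theorem exists_split (h2 : (2 : k) ≠ 0) (M : FinMod k (H hq)) [Nontrivial M.V] :
    ∃ S N : FinMod k (H hq), Iso (directSum S N) M ∧
      ((∃ a s, S = one hq hp a s) ∨ ∃ i j, S = twoDim hq i j) := by
  obtain ⟨m, hm⟩ := exists_ne (0 : M.V)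
  obtain ⟨a, ha, b, hb, hab⟩ : ∃ a < n, ∃ b < n, proj M a b m ≠ 0 := by
    by_contra! h
    apply hm
    rw [← sum_proj M m]
    exact Finset.sum_eq_zero fun a ha => Finset.sum_eq_zero fun b hb =>
      h a (Finset.mem_range.1 ha) b (Finset.mem_range.1 hb)
  set v := proj M a b m
  have hv : IsWeight M a b v := isWeight_proj M a b m
  by_cases hne : a = b
  · subst hne
    have hpq : p ^ a ^ 2 * p ^ a ^ 2 = q ^ (a * a) := by rw [← hp]; ring
    have hw (r : k) : IsWeight M a a (p ^ a ^ 2 • v + r • M.ρ (z hq) v) :=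
      (hv.smul _).add (hv.z.smul _)
    have hs (s : ℕ) : (-1 : k) ^ s * (-1) ^ s = 1 := by rw [← pow_two, neg_one_pow_sq]
    have hz (s : ℕ) : M.ρ (z hq) (p ^ a ^ 2 • v + (-1 : k) ^ s • M.ρ (z hq) v) =
        ((-1 : k) ^ s * p ^ a ^ 2) • (p ^ a ^ 2 • v + (-1 : k) ^ s • M.ρ (z hq) v) := by
      rw [map_add, map_smul, map_smul, hv.z_z, smul_add, smul_smul, smul_smul, smul_smul,
        mul_assoc, hpq, mul_right_comm, hs s, one_mul, add_comm]
    -- Both candidates satisfy the eigenvector equation for `z`, with eigenvalues `± p^{a²}`. They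
    -- add up to `2 p^{a²} v`, so at least one of them is nonzero.
    by_cases h0 : p ^ a ^ 2 • v + (-1 : k) ^ 0 • M.ρ (z hq) v = 0
    · have h1 : p ^ a ^ 2 • v + (-1 : k) ^ 1 • M.ρ (z hq) v ≠ 0 := by
        intro h1
        have h3 : (2 * p ^ a ^ 2) • v = 0 := by
          calc (2 * p ^ a ^ 2) • v = (p ^ a ^ 2 • v + (-1 : k) ^ 0 • M.ρ (z hq) v) +
                (p ^ a ^ 2 • v + (-1 : k) ^ 1 • M.ρ (z hq) v) := by module
            _ = 0 := by rw [h0, h1, add_zero]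
        exact hab ((smul_eq_zero.1 h3).resolve_left
          (mul_ne_zero h2 (p_pow_ne_zero (hp := hp) hq _)))
      obtain ⟨N, hN⟩ := exists_split_oneWith hp h2 ha (neg_one_pow_sq 1) (hw _) (hz 1) h1
      exact ⟨_, N, hN, Or.inl ⟨a, 1, rfl⟩⟩
    · obtain ⟨N, hN⟩ := exists_split_oneWith hp h2 ha (neg_one_pow_sq 0) (hw _) (hz 0) h0
      exact ⟨_, N, hN, Or.inl ⟨a, 0, rfl⟩⟩
  · obtain ⟨N, hN⟩ := exists_split_twoDim ha hb hne hv hab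
    exact ⟨_, N, hN, Or.inr ⟨a, b, rfl⟩⟩

/-- Every finite-dimensional module is a direct sum of modules `S_m` and `S_{i,j}`. -/
theorem finMod_induction (h2 : (2 : k) ≠ 0) {P : FinMod k (H hq) → Prop}
    (zero : ∀ M : FinMod k (H hq), Subsingleton M.V → P M)
    (iso : ∀ M N, Iso M N → P M → P N) (sum : ∀ M N, P M → P N → P (directSum M N))
    (hone : ∀ a s, P (one hq hp a s)) (htwo : ∀ i j, P (twoDim hq i j)) (M : FinMod k (H hq)) :
    P M := by
  induction hd : Module.finrank k M.V using Nat.strong_induction_on generalizing M with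
  | _ d ih =>
    rcases subsingleton_or_nontrivial M.V with hM | hM
    · exact zero M hM
    · obtain ⟨S, N, ⟨e, he⟩, hS⟩ := exists_split hp h2 M
      have hPS : P S := by
        obtain ⟨a, s, rfl⟩ | ⟨i, j, rfl⟩ := hS
        · exact hone a s
        · exact htwo i j
      have hpos : 0 < Module.finrank k S.V := by
        obtain ⟨a, s, rfl⟩ | ⟨i, j, rfl⟩ := hS
        · rw [finrank_oneWith]; exact Nat.one_pos
        · rw [finrank_twoDim]; exact Nat.two_pos
      have hfr : Module.finrank k S.V + Module.finrank k N.V = d :=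
        (Module.finrank_prod ..).symm.trans (e.finrank_eq.trans hd)
      exact iso _ _ ⟨e, he⟩ (sum _ _ hPS (ih _ (by omega) N rfl))

end KacPaljutkin

/-! ### From the polynomial relations to fusion families, and generation. -/

section Algebra

variable {R : Type*} [CommRing R]

/-- In terms of `e = x⁻¹ y`, the relation `x² = y²` becomes `e² = 1` and `zx = zy` becomes `z e =
z`. -/
theorem sq_eq_one_and_mul_eq_of_inv {x x' y z : R} (h : x * x' = 1) (hxy : x ^ 2 = y ^ 2)
    (hzx : z * x = z * y) : (x' * y) ^ 2 = 1 ∧ z * (x' * y) = z := by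
  constructor
  · linear_combination (x * x' + 1) * h - x' ^ 2 * hxy
  · linear_combination z * h - x' * hzx

/-- The relations are given with powers of `y = x e`. Since `e` fixes the sequence these may be
replaced by powers of the unit `x`, as `isFusionFamily_fusionInt` requires. The case `m = 1` is
included for the sake of `n = 2`. -/
theorem exists_isFusionFamily {m : ℕ} (hm : 1 ≤ m) {x y z e : R} (hx : x ^ (2 * m) = 1)
    (hxy : x ^ 2 = y ^ 2) (hzx : z * x = z * y) (he : e = x ^ (2 * m - 1) * y)
    (h0 : fusionSeq x e z m = y ^ m * fusionSeq x e z m)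
    (h1 : fusionSeq x e z (m + 1) = y ^ (m + 1) * fusionSeq x e z (m - 1)) :
    ∃ w, IsFusionFamily (2 * m) x e w ∧ x * e = y ∧ w 0 1 = z := by
  have hinv : x * x ^ (2 * m - 1) = 1 := by
    rw [← pow_succ', Nat.sub_add_cancel (by omega), hx]
  have hxe : x * e = y := by rw [he, ← mul_assoc, hinv, one_mul]
  obtain ⟨he2, hze⟩ := sq_eq_one_and_mul_eq_of_inv hinv hxy hzx
  rw [← he] at he2 hze
  let u : Rˣ := ⟨x, x ^ (2 * m - 1), hinv, by rw [mul_comm, hinv]⟩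
  have hu : (u : R) = x := rfl
  have hpow (s d : ℕ) : y ^ s * fusionSeq x e z d = x ^ s * fusionSeq x e z d := by
    have h2 : e ^ s * fusionSeq x e z d = fusionSeq x e z d := by
      induction s with
      | zero => simp
      | succ s ih => rw [pow_succ, mul_assoc, mul_fusionSeq he2 hze, ih]
    rw [← hxe, mul_pow, mul_assoc, h2]
  have key := isFusionFamily_fusionInt (u := u) (e := e) (z := z) (m := m)
    (Units.ext (by rw [Units.val_pow_eq_pow_val, hu, hx, Units.val_one])) he2 hze
    (by rw [fusionInt_natCast, hu, ← hpow, ← h0])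
    (by
      have := fusionInt_natCast u e z (m + 1)
      rw [Nat.cast_succ] at this
      rw [this, ← Nat.cast_pred hm, fusionInt_natCast, hu, ← hpow, ← h1])
  refine ⟨_, key, hxe, ?_⟩
  have := fusionInt_natCast u e z 1
  rw [Nat.cast_one] at this
  simp [this, fusionSeq]

theorem map_genFib {S : Type*} [CommRing S] (φ : R →+* S) (y z : R) (t : ℕ) :
    φ (genFib y z t) = genFib (φ y) (φ z) t := by
  induction t using Nat.twoStepInduction with
  | zero => simp [genFib]
  | one => simp [genFib]
  | more t h1 h2 => simp [genFib, h1, h2]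

theorem map_relFirst {S : Type*} [CommRing S] (φ : R →+* S) (m : ℕ) (x y z : R) :
    φ (relFirst m x y z) = relFirst m (φ x) (φ y) (φ z) := by
  simp [relFirst, map_genFib, map_sum]

theorem map_relSecond {S : Type*} [CommRing S] (φ : R →+* S) (m : ℕ) (x y z : R) :
    φ (relSecond m x y z) = relSecond m (φ x) (φ y) (φ z) := by
  simp [relSecond, map_genFib, map_sum]

/-- The relations for `n = 2m > 2` produce a fusion family. -/
theorem exists_isFusionFamily_of_rel {m : ℕ} (hm : 2 ≤ m) {x y z : R} (hx : x ^ (2 * m) = 1)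
    (hxy : x ^ 2 = y ^ 2) (hzx : z * x = z * y) (h1 : relFirst m x y z = 0)
    (h2 : relSecond m x y z = 0) :
    ∃ e w, IsFusionFamily (2 * m) x e w ∧ x * e = y ∧ w 0 1 = z := by
  obtain ⟨m, rfl⟩ := Nat.exists_eq_add_of_le' hm
  have hinv : x * x ^ (2 * (m + 2) - 1) = 1 := by
    rw [← pow_succ', Nat.sub_add_cancel (by omega), hx]
  set e := x ^ (2 * (m + 2) - 1) * y with he
  have hxe : x * e = y := by rw [he, ← mul_assoc, hinv, one_mul]
  obtain ⟨he2, hze⟩ := sq_eq_one_and_mul_eq_of_inv hinv hxy hzx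
  rw [← he] at he2 hze
  have hW (d : ℕ) : fusionSeq x e z (d + 1) = genFib y z (d + 2) - x * genFib y z d := by
    rw [fusionSeq_eq_genFib he2 hze, hxe]
  rw [relFirst_eq, ← hW, sub_eq_zero] at h1
  rw [relSecond_eq, ← hW, ← hW, sub_eq_zero] at h2
  exact ⟨e, exists_isFusionFamily (by omega) hx hxy hzx he h1 h2⟩

theorem IsFusionFamily.pow_mul_pow_mem {n : ℕ} [NeZero n] {g e : R} {w : ℕ → ℕ → R}
    (h : IsFusionFamily n g e w) {S : Subring R} (hg : g ∈ S) (hge : g * e ∈ S) (a s : ℕ) :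
    g ^ a * e ^ s ∈ S := by
  have he : e = g ^ (n - 1) * (g * e) := by
    rw [← mul_assoc, ← pow_succ, Nat.sub_add_cancel (NeZero.pos n), h.pow_eq_one, one_mul]
  have he' : e ∈ S := by
    rw [he]
    exact S.mul_mem (S.pow_mem hg _) hge
  exact S.mul_mem (S.pow_mem hg _) (S.pow_mem he' _)

/-- The recursion reaches every `w 0 d`, multiplication by `g ^ i` moves it to `w i (i + d)`, and
symmetry gives the rest. This is used for surjectivity onto the Green ring. -/
theorem IsFusionFamily.mem {n : ℕ} [NeZero n] {g e : R} {w : ℕ → ℕ → R}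
    (h : IsFusionFamily n g e w) {S : Subring R} (hg : g ∈ S) (hge : g * e ∈ S) (hw : w 0 1 ∈ S)
    (i j : ℕ) : w i j ∈ S := by
  have h0 (d : ℕ) : w 0 d ∈ S := by
    rw [← h.fusionSeq_eq]
    induction d using Nat.twoStepInduction with
    | zero =>
      have h1 := h.pow_mul_pow_mem hg hge 0 1
      rw [pow_zero, pow_one, one_mul] at h1
      exact S.add_mem S.one_mem h1
    | one => exact hw
    | more d h1 h2 => exact S.sub_mem (S.mul_mem hw h2) (S.mul_mem hg h1)
  have hle (i d : ℕ) : w i (i + d) ∈ S := by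
    have := h.shift i 0 0 d
    rw [pow_zero, mul_one, add_zero] at this
    rw [← this]
    exact S.mul_mem (S.pow_mem hg _) (h0 d)
  rcases le_total i j with hij | hij
  · obtain ⟨d, rfl⟩ := Nat.exists_eq_add_of_le hij
    exact hle i d
  · obtain ⟨d, rfl⟩ := Nat.exists_eq_add_of_le hij
    rw [h.symm]
    exact hle j d

/-- A ring homomorphism out of the quotient is determined by the variables, so `ψ` is a left inverse
of the induced map as soon as it is one on them. -/
theorem exists_quotient_equiv {σ G : Type*} [Ring G] {I : Ideal (MvPolynomial σ ℤ)}
    (φ : MvPolynomial σ ℤ →+* G) (hI : ∀ a ∈ I, φ a = 0) (hφ : Function.Surjective φ)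
    (ψ : G →+* MvPolynomial σ ℤ ⧸ I)
    (hψ : ∀ i, ψ (φ (MvPolynomial.X i)) = Ideal.Quotient.mk I (MvPolynomial.X i)) :
    ∃ e : (MvPolynomial σ ℤ ⧸ I) ≃+* G,
      ∀ i, e (Ideal.Quotient.mk I (MvPolynomial.X i)) = φ (MvPolynomial.X i) := by
  let Φ : (MvPolynomial σ ℤ ⧸ I) →+* G := Ideal.Quotient.lift I φ hI
  have hΦ (a) : Φ (Ideal.Quotient.mk I a) = φ a := Ideal.Quotient.lift_mk I φ hI
  have hid : ψ.comp Φ = RingHom.id _ := by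
    refine Ideal.Quotient.ringHom_ext (MvPolynomial.ringHom_ext (fun r => ?_) fun i => ?_)
    · simp
    · exact (congrArg ψ (hΦ _)).trans (hψ i)
  refine ⟨RingEquiv.ofBijective Φ ⟨?_, fun a => ?_⟩, fun i => hΦ _⟩
  · exact Function.LeftInverse.injective (g := ψ) (RingHom.congr_fun hid)
  · obtain ⟨b, rfl⟩ := hφ a
    exact ⟨_, hΦ b⟩

end Algebra

namespace KacPaljutkin

open FinMod

variable {k : Type u} [Field k] {n : ℕ} {q : k} {hq : IsPrimitiveRoot q n}

/-! ### Multiplicities -/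

variable (hq) in
/-- The eigenvalue conditions defining the vectors of weight `(i, j)`. -/
def wtSet (i j : ℕ) : Set (H hq × k) := {(x hq, q ^ i), (y hq, q ^ j)}

variable (hq) in
/-- The eigenvalue conditions defining the vectors which span copies of `one a s`. -/
def eigSet (p : k) (a s : ℕ) : Set (H hq × k) :=
  {(x hq, q ^ a), (y hq, q ^ a), (z hq, (-1) ^ s * p ^ a ^ 2)}

theorem mem_joint_wtSet {M : FinMod k (H hq)} {i j : ℕ} {v : M.V} :
    v ∈ joint M (wtSet hq i j) ↔ IsWeight M i j v := by
  rw [mem_joint]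
  simp only [wtSet, Set.mem_insert_iff, Set.mem_singleton_iff, forall_eq_or_imp, forall_eq]
  exact ⟨fun h => ⟨h.1, h.2⟩, fun h => ⟨h.1, h.2⟩⟩

theorem mem_joint_eigSet {M : FinMod k (H hq)} {p : k} {a s : ℕ} {v : M.V} :
    v ∈ joint M (eigSet hq p a s) ↔
      IsWeight M a a v ∧ M.ρ (z hq) v = ((-1) ^ s * p ^ a ^ 2) • v := by
  rw [mem_joint]
  simp only [eigSet, Set.mem_insert_iff, Set.mem_singleton_iff, forall_eq_or_imp, forall_eq]
  exact ⟨fun h => ⟨⟨h.1, h.2.1⟩, h.2.2⟩, fun h => ⟨h.1.1, h.1.2, h.2⟩⟩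

theorem mult_eq_zero {M : FinMod k (H hq)} {S : Set (H hq × k)} (h : ∀ v ∈ joint M S, v = 0) :
    mult M S = 0 := by
  rw [mult, (Submodule.eq_bot_iff _).2 h, finrank_bot]

theorem eq_of_smul_eq {V : Type*} [AddCommGroup V] [Module k V] {v : V} (hv : v ≠ 0) {a b : k}
    (h : a • v = b • v) : a = b := smul_left_injective k hv h

variable [NeZero n] {p : k} (hp : p ^ 2 = q)

theorem mult_one_wtSet (a s : ℕ) {i j : ℕ} (hi : i < n) (hj : j < n) (hij : i ≠ j) :
    mult (one hq hp a s) (wtSet hq i j) = 0 := by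
  refine mult_eq_zero fun v hv => ?_
  rw [mem_joint_wtSet] at hv
  by_contra h0
  have h := oneWith_isWeight (hq := hq) hp a (neg_one_pow_sq s) v
  have h1 := eq_of_smul_eq h0 (h.x_apply.symm.trans hv.x_apply)
  have h2 := eq_of_smul_eq h0 (h.y_apply.symm.trans hv.y_apply)
  exact hij (hq.pow_inj hi hj (h1.symm.trans h2))

theorem mult_one_eigSet (h2 : (2 : k) ≠ 0) {a b s t : ℕ} (ha : a < n) (hb : b < n) (hs : s < 2)
    (ht : t < 2) :
    mult (one hq hp a s) (eigSet hq p b t) = if b = a ∧ t = s then 1 else 0 := by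
  split_ifs with h
  · obtain ⟨rfl, rfl⟩ := h
    have : joint (one hq hp b t) (eigSet hq p b t) = ⊤ := by
      rw [eq_top_iff]
      intro v _
      exact mem_joint_eigSet.2 ⟨oneWith_isWeight hp b _ v, oneWith_z hp b _ v⟩
    rw [mult, this, finrank_top, finrank_oneWith]
  · refine mult_eq_zero fun v hv => ?_
    rw [mem_joint_eigSet] at hv
    by_contra h0
    have h' := oneWith_isWeight (hq := hq) hp a (neg_one_pow_sq s) v
    have h1 := hq.pow_inj ha hb (eq_of_smul_eq h0 (h'.x_apply.symm.trans hv.1.x_apply))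
    subst h1
    have h3 := eq_of_smul_eq h0 ((oneWith_z hp a (neg_one_pow_sq s) v).symm.trans hv.2)
    have h4 := mul_right_cancel₀ (p_pow_ne_zero (hp := hp) hq _) h3
    have h5 : (-1 : k) ≠ 1 := by
      intro h5
      apply h2
      linear_combination -h5
    apply h
    refine ⟨rfl, ?_⟩
    interval_cases s <;> interval_cases t <;> simp_all [eq_comm]

theorem twoDim_eq_zero_of_isWeight {i j a b : ℕ} {v : Fin 2 → k}
    (h : IsWeight (twoDim hq i j) a b v) (h0 : q ^ i ≠ q ^ a ∨ q ^ j ≠ q ^ b) : v 0 = 0 := by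
  have h1 := congrFun ((two_x i j v).symm.trans h.x_apply) 0
  have h2 := congrFun ((two_y i j v).symm.trans h.y_apply) 0
  change q ^ i * v 0 = q ^ a * v 0 at h1
  change q ^ j * v 0 = q ^ b * v 0 at h2
  rcases h0 with h0 | h0
  · exact (mul_eq_mul_right_iff.1 h1).resolve_left h0
  · exact (mul_eq_mul_right_iff.1 h2).resolve_left h0

theorem twoDim_eq_zero_of_isWeight' {i j a b : ℕ} {v : Fin 2 → k}
    (h : IsWeight (twoDim hq i j) a b v) (h0 : q ^ j ≠ q ^ a ∨ q ^ i ≠ q ^ b) : v 1 = 0 := by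
  have h1 := congrFun ((two_x i j v).symm.trans h.x_apply) 1
  have h2 := congrFun ((two_y i j v).symm.trans h.y_apply) 1
  change q ^ j * v 1 = q ^ a * v 1 at h1
  change q ^ i * v 1 = q ^ b * v 1 at h2
  rcases h0 with h0 | h0
  · exact (mul_eq_mul_right_iff.1 h1).resolve_left h0
  · exact (mul_eq_mul_right_iff.1 h2).resolve_left h0

/-- The weights of `S_{i,j}` are `(i, j)` and `(j, i)`, neither of the form `(a, a)`. -/
theorem mult_twoDim_eigSet {i j : ℕ} (hi : i < n) (hj : j < n) (hij : i ≠ j) (a s : ℕ) :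
    mult (twoDim hq i j) (eigSet hq p a s) = 0 := by
  refine mult_eq_zero fun (v : Fin 2 → k) hv => ?_
  replace hv := mem_joint_eigSet.1 hv
  have hne : q ^ i ≠ q ^ a ∨ q ^ j ≠ q ^ a := by
    by_contra! h
    exact hij (hq.pow_inj hi hj (h.1.trans h.2.symm))
  funext t
  fin_cases t
  · exact twoDim_eq_zero_of_isWeight hv.1 hne
  · exact twoDim_eq_zero_of_isWeight' hv.1 hne.symm

/-- As `a < b` and `i < j`, the weight `(j, i)` of the second basis vector never matches.
Restricting `character` to `a < b` thus counts each class `S_{a,b} ≅ S_{b,a}` once. -/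
theorem mult_twoDim_wtSet {i j a b : ℕ} (hij : i < j) (hj : j < n) (hab : a < b) (hb : b < n) :
    mult (twoDim hq i j) (wtSet hq a b) = if a = i ∧ b = j then 1 else 0 := by
  have hswap : q ^ j ≠ q ^ a ∨ q ^ i ≠ q ^ b := by
    by_contra! h
    have h1 := hq.pow_inj hj (hab.trans hb) h.1
    have h2 := hq.pow_inj (hij.trans hj) hb h.2
    omega
  split_ifs with h
  · obtain ⟨rfl, rfl⟩ := h
    let e₀ : (twoDim hq a b).V := (Pi.single 0 1 : Fin 2 → k)
    have he₀ : e₀ ≠ 0 := fun h => one_ne_zero (α := k) (congrFun h 0)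
    have : joint (twoDim hq a b) (wtSet hq a b) = Submodule.span k {e₀} := by
      ext v
      refine mem_joint_wtSet.trans ⟨fun hv => ?_, fun hv => ?_⟩
      · have h1 := twoDim_eq_zero_of_isWeight' hv hswap
        refine Submodule.mem_span_singleton.2 ⟨(v : Fin 2 → k) 0, ?_⟩
        funext t
        change (v : Fin 2 → k) 0 * (Pi.single 0 1 : Fin 2 → k) t = (v : Fin 2 → k) t
        fin_cases t
        · simp
        · simpa using h1.symm
      · obtain ⟨r, rfl⟩ := Submodule.mem_span_singleton.1 hv
        exact (two_isWeight_fst a b).smul r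
    rw [mult, this, finrank_span_singleton he₀]
  · refine mult_eq_zero fun (v : Fin 2 → k) hv => ?_
    replace hv := mem_joint_wtSet.1 hv
    funext t
    fin_cases t
    · refine twoDim_eq_zero_of_isWeight hv ?_
      by_contra! h'
      exact h ⟨(hq.pow_inj (hij.trans hj) (hab.trans hb) h'.1).symm,
        (hq.pow_inj hj hb h'.2).symm⟩
    · exact twoDim_eq_zero_of_isWeight' hv hswap

end KacPaljutkin

/-! ### Reduction of the indices modulo `n`. -/

namespace KacPaljutkin

open FinMod

variable {k : Type u} [Field k] {n : ℕ} {q : k} {hq : IsPrimitiveRoot q n} [NeZero n]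
  {p : k} (hp : p ^ 2 = q)

include hp in
-- For `n = 2m` one has `(a + n)² = a² + 2n(a + m)`, and `p^{2n} = q^n = 1`. Evenness thus makes
-- `S_a` depend only on `a` modulo `n`, which gives `g ^ n = 1`.
theorem p_pow_add (hn : Even n) (hq : IsPrimitiveRoot q n) (a : ℕ) :
    p ^ (a + n) ^ 2 = p ^ a ^ 2 := by
  obtain ⟨m, rfl⟩ := hn
  have h : p ^ (a + (m + m)) ^ 2 = p ^ a ^ 2 * ((p ^ 2) ^ (m + m)) ^ (a + m) := by ring
  rw [h, hp, hq.pow_eq_one, one_pow, mul_one]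

theorem one_add_iso (hn : Even n) (a s : ℕ) : Iso (one hq hp (a + n) s) (one hq hp a s) :=
  oneWith_congr (by rw [pow_add, hq.pow_eq_one, mul_one]) (by rw [p_pow_add hp hn hq])

theorem one_add_two_iso (a s : ℕ) : Iso (one hq hp a (s + 2)) (one hq hp a s) :=
  oneWith_congr rfl (by rw [pow_add, neg_one_sq, mul_one])

theorem one_mod_iso (hn : Even n) (a s : ℕ) : Iso (one hq hp (a % n) (s % 2)) (one hq hp a s) := by
  have h1 (a s t : ℕ) : Iso (one hq hp (a + n * t) s) (one hq hp a s) := by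
    induction t with
    | zero => exact (iso_equivalence k (H hq)).refl _
    | succ t ih =>
      rw [Nat.mul_succ, ← add_assoc]
      exact (one_add_iso hp hn _ _).trans ih
  have h2 (a s t : ℕ) : Iso (one hq hp a (s + 2 * t)) (one hq hp a s) := by
    induction t with
    | zero => exact (iso_equivalence k (H hq)).refl _
    | succ t ih =>
      rw [Nat.mul_succ, ← add_assoc]
      exact (one_add_two_iso hp _ _).trans ih
  have h3 := (h1 (a % n) (s % 2 + 2 * (s / 2)) (a / n)).trans (h2 (a % n) (s % 2) (s / 2))
  rw [Nat.mod_add_div, Nat.mod_add_div] at h3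
  exact h3.symm

theorem twoDim_mod_iso (i j : ℕ) : Iso (twoDim hq (i % n) (j % n)) (twoDim hq i j) := by
  have h (i : ℕ) : q ^ (i % n) = q ^ i := by
    conv_rhs => rw [← Nat.mod_add_div i n]
    rw [pow_add, pow_mul, hq.pow_eq_one, one_pow, mul_one]
  exact twoDim_congr (h i) (h j)

theorem trivial_iso_one : Iso (trivial k (H hq)) (one hq hp 0 0) := by
  refine iso_oneWith_of_range (u := (1 : k)) ⟨?_, ?_⟩ ?_ (fun v => ⟨v, mul_one (M := k) v⟩)
    (Module.finrank_self k)
  · change counitHom hq (x hq) * 1 = q ^ 0 * 1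
    rw [counitHom_x, pow_zero]
  · change counitHom hq (y hq) * 1 = q ^ 0 * 1
    rw [counitHom_y, pow_zero]
  · change counitHom hq (z hq) * 1 = ((-1) ^ 0 * p ^ 0 ^ 2) * 1
    rw [counitHom_z]
    simp

theorem one_tensor_one (a s b t : ℕ) :
    Iso (tensor (one hq hp a s) (one hq hp b t)) (one hq hp (a + b) (s + t)) :=
  oneWith_tensor_oneWith (pow_add _ _ _).symm

/-! ### The ring homomorphism attached to a fusion family -/

section

variable {R : Type*} [CommRing R] (g e : R) (w : ℕ → ℕ → R)

variable (p) in
/-- The combination of the elements of a fusion family with the multiplicities of the simple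
summands of `M` as coefficients. -/
noncomputable def character (M : FinMod k (H hq)) : R :=
  ∑ a ∈ Finset.range n, ∑ s ∈ Finset.range 2, (mult M (eigSet hq p a s) : R) * (g ^ a * e ^ s) +
    ∑ a ∈ Finset.range n, ∑ b ∈ Finset.range n,
      if a < b then (mult M (wtSet hq a b) : R) * w a b else 0

omit [NeZero n] in
theorem character_iso {M N : FinMod k (H hq)} (h : Iso M N) :
    character p g e w M = character p g e w N := by
  simp only [character, mult_iso h]

omit [NeZero n] in
theorem character_directSum (M N : FinMod k (H hq)) :
    character p g e w (directSum M N) = character p g e w M + character p g e w N := by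
  have h (a b : ℕ) : (if a < b then (mult (directSum M N) (wtSet hq a b) : R) * w a b else 0) =
      (if a < b then (mult M (wtSet hq a b) : R) * w a b else 0) +
      (if a < b then (mult N (wtSet hq a b) : R) * w a b else 0) := by
    split_ifs
    · rw [mult_directSum, Nat.cast_add, add_mul]
    · rw [add_zero]
  simp only [character, h]
  simp only [mult_directSum, Nat.cast_add, add_mul, Finset.sum_add_distrib]
  ring

omit [NeZero n] in
theorem character_of_subsingleton (M : FinMod k (H hq)) [Subsingleton M.V] :
    character p g e w M = 0 := by
  simp [character, mult_of_subsingleton]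

variable {g e w} (h2 : (2 : k) ≠ 0) (hn : Even n) (h : IsFusionFamily n g e w)
include h2 hn h

theorem character_one (a s : ℕ) : character p g e w (one hq hp a s) = g ^ a * e ^ s := by
  have ha : a % n < n := Nat.mod_lt _ (NeZero.pos n)
  have hs : s % 2 < 2 := Nat.mod_lt _ Nat.two_pos
  have hga : g ^ (a % n) = g ^ a := by
    conv_rhs => rw [← Nat.mod_add_div a n]
    rw [pow_add, pow_mul, h.pow_eq_one, one_pow, mul_one]
  have hes : e ^ (s % 2) = e ^ s := by
    conv_rhs => rw [← Nat.mod_add_div s 2]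
    rw [pow_add, pow_mul, h.sq_eq_one, one_pow, mul_one]
  rw [← character_iso g e w (one_mod_iso hp hn a s), character,
    Finset.sum_eq_single_of_mem (a % n) (Finset.mem_range.2 ha),
    Finset.sum_eq_single_of_mem (s % 2) (Finset.mem_range.2 hs), Finset.sum_eq_zero,
    mult_one_eigSet hp h2 ha ha hs hs, if_pos ⟨rfl, rfl⟩, hga, hes]
  · simp
  · intro i hi
    refine Finset.sum_eq_zero fun j hj => ?_
    split_ifs with hij
    · rw [mult_one_wtSet hp _ _ (Finset.mem_range.1 hi) (Finset.mem_range.1 hj) hij.ne]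
      simp
    · rfl
  · intro t ht hne
    rw [mult_one_eigSet hp h2 ha ha hs (Finset.mem_range.1 ht), if_neg fun h => hne h.2]
    simp
  · intro b hb hne
    refine Finset.sum_eq_zero fun t ht => ?_
    rw [mult_one_eigSet hp h2 ha (Finset.mem_range.1 hb) hs (Finset.mem_range.1 ht),
      if_neg fun h => hne h.1]
    simp

include hp in
-- After reduction modulo `n`, ordered residues are read off from the multiplicities and reversed
-- ones follow by symmetry. Equal residues are where `twoDim_diag` meets the axiom `diag`.
theorem character_twoDim (i j : ℕ) : character p g e w (twoDim hq i j) = w i j := by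
  have hlt {i j : ℕ} (hij : i < j) (hj : j < n) : character p g e w (twoDim hq i j) = w i j := by
    rw [character, Finset.sum_eq_zero,
      Finset.sum_eq_single_of_mem i (Finset.mem_range.2 (hij.trans hj)),
      Finset.sum_eq_single_of_mem j (Finset.mem_range.2 hj), if_pos hij,
      mult_twoDim_wtSet hij hj hij hj, if_pos ⟨rfl, rfl⟩]
    · simp
    · intro b hb hne
      split_ifs with hib
      · rw [mult_twoDim_wtSet hij hj hib (Finset.mem_range.1 hb), if_neg fun h => hne h.2]
        simp
      · rfl
    · intro a _ hne
      refine Finset.sum_eq_zero fun b hb => ?_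
      split_ifs with hab
      · rw [mult_twoDim_wtSet hij hj hab (Finset.mem_range.1 hb), if_neg fun h => hne h.1]
        simp
      · rfl
    · intro a _
      refine Finset.sum_eq_zero fun s _ => ?_
      rw [mult_twoDim_eigSet (hij.trans hj) hj hij.ne]
      simp
  have hi : i % n < n := Nat.mod_lt _ (NeZero.pos n)
  have hj : j % n < n := Nat.mod_lt _ (NeZero.pos n)
  rw [← character_iso g e w (twoDim_mod_iso i j), ← h.mod_left i j, ← h.mod_right _ j]
  rcases lt_trichotomy (i % n) (j % n) with hij | hij | hij
  · exact hlt hij hj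
  · rw [hij, character_iso g e w (twoDim_diag hp h2 _), character_directSum,
      character_one hp h2 hn h, character_one hp h2 hn h, h.diag, pow_zero, mul_one, pow_one]
  · rw [character_iso g e w (twoDim_symm _ _), h.symm]
    exact hlt hij hi

include hp in
-- Both sides are additive in each module, so induction on both leaves four kinds of products of
-- standard modules. Three of these are the axioms `shift` (twice) and `mul`; the fourth is
-- multiplication of powers of `g` and `e`.
theorem character_tensor (M N : FinMod k (H hq)) : character p g e w (tensor M N) =
    character p g e w M * character p g e w N := by
  have h1 := character_one (hq := hq) hp h2 hn h
  have hw := character_twoDim (hq := hq) hp h2 hn h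
  induction M using finMod_induction (hq := hq) hp h2 generalizing N with
  | zero M hM =>
    have := subsingleton_tensor_left M N
    rw [character_of_subsingleton g e w (tensor M N), character_of_subsingleton g e w M, zero_mul]
  | iso M M' hM ih =>
    rw [← character_iso g e w hM, ← ih]
    exact (character_iso g e w (tensor_iso hM ((iso_equivalence k (H hq)).refl N))).symm
  | sum M M' ih ih' =>
    rw [character_iso g e w (directSum_tensor M M' N), character_directSum, character_directSum,
      ih, ih', add_mul]
  | hone a s =>
    induction N using finMod_induction (hq := hq) hp h2 with
    | zero N hN =>
      have := subsingleton_tensor_right (one hq hp a s) N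
      rw [character_of_subsingleton g e w (tensor _ N), character_of_subsingleton g e w N, mul_zero]
    | iso N N' hN ih =>
      rw [← character_iso g e w hN, ← ih]
      exact (character_iso g e w (tensor_iso ((iso_equivalence k (H hq)).refl _) hN)).symm
    | sum N N' ih ih' =>
      rw [character_iso g e w (tensor_directSum _ N N'), character_directSum,
        character_directSum, ih, ih', mul_add]
    | hone b t =>
      rw [character_iso g e w (one_tensor_one hp a s b t), h1, h1, h1]
      ring
    | htwo i j =>
      rw [character_iso g e w (oneWith_tensor_twoDim i j), h1, hw, hw, h.shift]
  | htwo i j =>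
    induction N using finMod_induction (hq := hq) hp h2 with
    | zero N hN =>
      have := subsingleton_tensor_right (twoDim hq i j) N
      rw [character_of_subsingleton g e w (tensor _ N), character_of_subsingleton g e w N, mul_zero]
    | iso N N' hN ih =>
      rw [← character_iso g e w hN, ← ih]
      exact (character_iso g e w (tensor_iso ((iso_equivalence k (H hq)).refl _) hN)).symm
    | sum N N' ih ih' =>
      rw [character_iso g e w (tensor_directSum _ N N'), character_directSum,
        character_directSum, ih, ih', mul_add]
    | hone b t =>
      rw [character_iso g e w (twoDim_tensor_oneWith i j), h1, hw, hw, mul_comm, h.shift]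
    | htwo a b =>
      rw [character_iso g e w (twoDim_tensor_twoDim i j a b), character_directSum, hw, hw, hw, hw,
        h.mul]

/-- This is the universal property: every fusion family in a commutative ring is the image of the
one in the Green ring. -/
theorem exists_green_hom : ∃ F : GreenRing k (H hq) →+* R,
    (∀ a s, F (one hq hp a s).cls = g ^ a * e ^ s) ∧ ∀ i j, F (twoDim hq i j).cls = w i j := by
  obtain ⟨F, hF⟩ := exists_green_lift (H := H hq) (character p g e w)
    (fun _ _ => character_iso g e w)
    (by rw [character_iso g e w (trivial_iso_one hp), character_one hp h2 hn h, pow_zero, pow_zero,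
      mul_one])
    (character_tensor hp h2 hn h) (character_directSum g e w)
  exact ⟨F, fun a s => (hF _).trans (character_one hp h2 hn h a s),
    fun i j => (hF _).trans (character_twoDim hp h2 hn h i j)⟩

end

/-! ### The Green ring is a fusion family -/

theorem cls_one_mul (a s b t : ℕ) :
    (one hq hp a s).cls * (one hq hp b t).cls = (one hq hp (a + b) (s + t)).cls := by
  rw [← cls_tensor, cls_eq_of_iso (one_tensor_one hp a s b t)]

include hp in
-- By additivity it suffices to compare standard modules, for which the product rules are symmetric
-- in the two factors, up to `twoDim_symm`.
theorem cls_mul_comm (h2 : (2 : k) ≠ 0) (M N : FinMod k (H hq)) :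
    M.cls * N.cls = N.cls * M.cls := by
  have hzero (M : FinMod k (H hq)) (h : Subsingleton M.V) : M.cls = 0 := cls_of_subsingleton M
  have h (i j a s : ℕ) : (one hq hp a s).cls * (twoDim hq i j).cls =
      (twoDim hq i j).cls * (one hq hp a s).cls :=
    (cls_tensor _ _).symm.trans ((cls_eq_of_iso ((oneWith_tensor_twoDim i j).trans
      (twoDim_tensor_oneWith i j).symm)).trans (cls_tensor _ _))
  have h' (i j a b : ℕ) : (twoDim hq i j).cls * (twoDim hq a b).cls =
      (twoDim hq (i + a) (j + b)).cls + (twoDim hq (i + b) (j + a)).cls :=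
    (cls_tensor _ _).symm.trans ((cls_eq_of_iso (twoDim_tensor_twoDim i j a b)).trans
      (cls_directSum _ _))
  induction M using finMod_induction (hq := hq) hp h2 with
  | zero M hM => rw [hzero M hM, zero_mul, mul_zero]
  | iso M M' hM ih => rw [← cls_eq_of_iso hM, ih]
  | sum M M' ih ih' => rw [cls_directSum, add_mul, mul_add, ih, ih']
  | hone a s =>
    induction N using finMod_induction (hq := hq) hp h2 with
    | zero N hN => rw [hzero N hN, zero_mul, mul_zero]
    | iso N N' hN ih => rw [← cls_eq_of_iso hN, ih]
    | sum N N' ih ih' => rw [cls_directSum, add_mul, mul_add, ih, ih']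
    | hone b t =>
      refine (cls_one_mul hp a s b t).trans (Eq.trans ?_ (cls_one_mul hp b t a s).symm)
      rw [add_comm a b, add_comm s t]
    | htwo i j =>
      exact h i j _ _
  | htwo i j =>
    induction N using finMod_induction (hq := hq) hp h2 with
    | zero N hN => rw [hzero N hN, zero_mul, mul_zero]
    | iso N N' hN ih => rw [← cls_eq_of_iso hN, ih]
    | sum N N' ih ih' => rw [cls_directSum, add_mul, mul_add, ih, ih']
    | hone b t =>
      exact (h i j _ _).symm
    | htwo a b =>
      refine (h' i j a b).trans (Eq.trans ?_ (h' a b i j).symm)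
      rw [add_comm a i, add_comm b j, add_comm a j, add_comm b i]
      exact congrArg _ (cls_eq_of_iso (twoDim_symm (i + b) (j + a)))

/-- The Green ring of `H_{2n²}` is commutative. -/
noncomputable abbrev greenCommRing (hq : IsPrimitiveRoot q n) (h2 : (2 : k) ≠ 0) :
    CommRing (GreenRing k (H hq)) :=
  { GreenRing.instRing k (H hq) with
    mul_comm := fun a b => by
      induction a using green_induction with
      | cls M =>
        induction b using green_induction with
        | cls N => exact cls_mul_comm hp h2 M N
        | add b c hb hc => rw [mul_add, add_mul, hb, hc]
        | neg b hb => rw [mul_neg, neg_mul, hb]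
      | add a c ha hc => rw [add_mul, mul_add, ha, hc]
      | neg a ha => rw [neg_mul, mul_neg, ha] }

theorem cls_one_zero_zero : (one hq hp 0 0).cls = 1 := by
  rw [← cls_eq_of_iso (trivial_iso_one hp), cls_trivial]

theorem cls_one_eq (a s : ℕ) :
    (one hq hp a s).cls = (one hq hp 1 0).cls ^ a * (one hq hp 0 1).cls ^ s := by
  have h1 : (one hq hp 1 0).cls ^ a = (one hq hp a 0).cls := by
    induction a with
    | zero => rw [pow_zero, cls_one_zero_zero]
    | succ a ih => rw [pow_succ, ih, cls_one_mul]
  have h2 : (one hq hp 0 1).cls ^ s = (one hq hp 0 s).cls := by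
    induction s with
    | zero => rw [pow_zero, cls_one_zero_zero]
    | succ s ih => rw [pow_succ, ih, cls_one_mul]
  rw [h1, h2, cls_one_mul, add_zero, zero_add]

theorem isFusionFamily_green (h2 : (2 : k) ≠ 0) (hn : Even n) :
    @IsFusionFamily (GreenRing k (H hq)) (greenCommRing hp hq h2) n (one hq hp 1 0).cls
      (one hq hp 0 1).cls fun i j => (twoDim hq i j).cls :=
  letI := greenCommRing hp hq h2
  { pow_eq_one := by
      have h1 := cls_one_eq (hq := hq) hp n 0
      rw [pow_zero, mul_one] at h1
      have h3 := cls_eq_of_iso (one_add_iso (hq := hq) hp hn 0 0)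
      rw [zero_add, cls_one_zero_zero] at h3
      exact h1.symm.trans h3
    sq_eq_one := by
      have h1 := cls_one_eq (hq := hq) hp 0 2
      rw [pow_zero, one_mul] at h1
      have h3 := cls_eq_of_iso (one_add_two_iso (hq := hq) hp 0 0)
      rw [zero_add, cls_one_zero_zero] at h3
      exact h1.symm.trans h3
    symm := fun i j => cls_eq_of_iso (twoDim_symm i j)
    periodic := fun i j =>
      cls_eq_of_iso (twoDim_congr (by rw [pow_add, hq.pow_eq_one, mul_one]) rfl)
    diag := fun i => by
      have h1 := cls_one_eq (hq := hq) hp i 0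
      have h3 := cls_one_eq (hq := hq) hp i 1
      rw [pow_zero, mul_one] at h1
      rw [pow_one] at h3
      refine (cls_eq_of_iso (twoDim_diag hp h2 i)).trans ?_
      rw [cls_directSum, h1, h3]
    shift := fun a s i j => by
      have h1 := cls_one_eq (hq := hq) hp a s
      refine (congrArg (· * (twoDim hq i j).cls) h1.symm).trans ?_
      exact (cls_tensor _ _).symm.trans (cls_eq_of_iso (oneWith_tensor_twoDim i j))
    mul := fun i j a b =>
      (cls_tensor _ _).symm.trans ((cls_eq_of_iso (twoDim_tensor_twoDim i j a b)).trans
        (cls_directSum _ _)) }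

open MvPolynomial in
-- `hS` says that the generators of the ideal vanish in every fusion family, which yields the map to
-- the Green ring. `hI` says that the quotient carries such a family, which yields the inverse. The
-- ring in `hS` lies in `Type (u + 1)` because the Green ring does.
theorem exists_green_equiv (h2 : (2 : k) ≠ 0) (hn : Even n) {I : Ideal (MvPolynomial (Fin 3) ℤ)}
    {S : Set (MvPolynomial (Fin 3) ℤ)} (hIS : I = Ideal.span S)
    (hS : ∀ {R : Type (u + 1)} [CommRing R] {g e : R} {w : ℕ → ℕ → R}, IsFusionFamily n g e w →
      ∀ φ : MvPolynomial (Fin 3) ℤ →+* R, φ (X 0) = g → φ (X 1) = g * e → φ (X 2) = w 0 1 →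
        ∀ a ∈ S, φ a = 0)
    (hI : ∃ e w, IsFusionFamily n (Ideal.Quotient.mk I (X 0)) e w ∧
      Ideal.Quotient.mk I (X 0) * e = Ideal.Quotient.mk I (X 1) ∧
      w 0 1 = Ideal.Quotient.mk I (X 2)) :
    ∃ e : (MvPolynomial (Fin 3) ℤ ⧸ I) ≃+* GreenRing k (H hq),
      e (Ideal.Quotient.mk I (X 0)) = (one hq hp 1 0).cls ∧
      e (Ideal.Quotient.mk I (X 1)) = (one hq hp 1 1).cls ∧
      e (Ideal.Quotient.mk I (X 2)) = (twoDim hq 0 1).cls := by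
  let _ := greenCommRing hp hq h2
  have hG := isFusionFamily_green (hq := hq) hp h2 hn
  have h11 : (one hq hp 1 0).cls * (one hq hp 0 1).cls = (one hq hp 1 1).cls :=
    cls_one_mul hp 1 0 0 1
  let φ : MvPolynomial (Fin 3) ℤ →+* GreenRing k (H hq) :=
    eval₂Hom (Int.castRingHom _) ![(one hq hp 1 0).cls, (one hq hp 1 1).cls, (twoDim hq 0 1).cls]
  have φ0 : φ (X 0) = (one hq hp 1 0).cls := by simp [φ]
  have φ1 : φ (X 1) = (one hq hp 1 1).cls := by simp [φ]
  have φ2 : φ (X 2) = (twoDim hq 0 1).cls := by simp [φ]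
  have hφI : ∀ a ∈ I, φ a = 0 := by
    have : I ≤ RingHom.ker φ := by
      rw [hIS, Ideal.span_le]
      exact fun a ha => hS hG φ φ0 (φ1.trans h11.symm) φ2 a ha
    exact fun a ha => this ha
  have hsurj : Function.Surjective φ := by
    have m0 : (one hq hp 1 0).cls ∈ φ.range := ⟨_, φ0⟩
    have m1 : (one hq hp 1 0).cls * (one hq hp 0 1).cls ∈ φ.range := ⟨_, φ1.trans h11.symm⟩
    have m2 : (twoDim hq 0 1).cls ∈ φ.range := ⟨_, φ2⟩
    intro a
    change a ∈ φ.range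
    induction a using green_induction with
    | cls M =>
      induction M using finMod_induction (hq := hq) hp h2 with
      | zero M hM => rw [cls_of_subsingleton]; exact φ.range.zero_mem
      | iso M N hM ih => rwa [← cls_eq_of_iso hM]
      | sum M N ih ih' => rw [cls_directSum]; exact φ.range.add_mem ih ih'
      | hone a s => rw [cls_one_eq]; exact hG.pow_mul_pow_mem m0 m1 a s
      | htwo i j => exact hG.mem m0 m1 m2 i j
    | add a b ha hb => exact φ.range.add_mem ha hb
    | neg a ha => exact φ.range.neg_mem ha
  obtain ⟨e, w, hA, he, hw⟩ := hI
  obtain ⟨ψ, hψ, hψ'⟩ := exists_green_hom (hq := hq) hp h2 hn hA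
  obtain ⟨E, hE⟩ := exists_quotient_equiv φ hφI hsurj ψ fun i => by
    fin_cases i
    · exact (congrArg ψ φ0).trans ((hψ 1 0).trans (by simp))
    · exact (congrArg ψ φ1).trans ((hψ 1 1).trans (by simp [he]))
    · exact (congrArg ψ φ2).trans ((hψ' 0 1).trans hw)
  exact ⟨E, (hE 0).trans φ0, (hE 1).trans φ1, (hE 2).trans φ2⟩

theorem sign_sq (k : Type u) [Field k] (n m : ℕ) : sign k n m ^ 2 = 1 := by
  rw [sign]
  split_ifs
  · exact one_pow 2
  · exact neg_one_sq

theorem cls_oneDim_one (hn : 1 < n) : (oneDim hq hp 1).cls = (one hq hp 1 0).cls := by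
  refine cls_eq_of_iso (oneWith_congr (a := 1) (c := sign k n 1)
    (hc := sign_sq k n _) rfl ?_)
  rw [sign, if_pos hn, pow_zero]

/-- The index `n + 1` lies in the range of the sign `-1`, while `q^{n+1} = q` and, by evenness,
`p^{(n+1)²} = p`. -/
theorem cls_oneDim_add_one (hn : Even n) :
    (oneDim hq hp (n + 1)).cls = (one hq hp 1 1).cls := by
  refine cls_eq_of_iso (oneWith_congr (a := n + 1) (c := sign k n (n + 1))
    (hc := sign_sq k n _) ?_ ?_)
  · rw [pow_add, hq.pow_eq_one, one_mul]
  · rw [sign, if_neg (by omega), pow_one, add_comm n, p_pow_add hp hn hq]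

end KacPaljutkin

/-! ### The generators of the two ideals, and the conclusion. -/

open MvPolynomial in
theorem IsFusionFamily.idealTwo_gens {R : Type*} [CommRing R] {g e : R} {w : ℕ → ℕ → R}
    (h : IsFusionFamily 2 g e w) (φ : MvPolynomial (Fin 3) ℤ →+* R) (h0 : φ (X 0) = g)
    (h1 : φ (X 1) = g * e) (h2 : φ (X 2) = w 0 1) :
    ∀ a ∈ ({X 1 ^ 2 - 1, X 0 ^ 2 - X 1 ^ 2, X 2 * X 0 - X 2 * X 1, X 2 - X 2 * X 1,
      X 2 ^ 2 - X 0 - X 1 - X 0 * X 1 - 1} : Set (MvPolynomial (Fin 3) ℤ)), φ a = 0 := by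
  have hg := h.pow_eq_one
  have he := h.sq_eq_one
  have hwe := h.mul_e 0 1
  -- With period 2, `g * w 0 1 = w 1 2 = w 1 0`.
  have hwg : g * w 0 1 = w 0 1 := by
    have h3 := h.shift 1 0 0 1
    have h4 := h.periodic_right 1 0
    have h5 := h.symm 0 1
    rw [pow_one, pow_zero, mul_one] at h3
    exact h3.trans (h4.trans h5.symm)
  -- The square is `w 0 2 + w 1 1`, and with period 2 both terms are diagonal.
  have hsq : w 0 1 * w 0 1 = 1 + e + g + g * e := by
    have h3 := h.mul 0 1 0 1
    have h4 := h.periodic_right 0 0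
    have h5 := h.diag 0
    have h6 := h.diag 1
    simp only [zero_add, add_zero, pow_zero, one_mul, pow_one, Nat.reduceAdd] at h3 h4 h5 h6
    rw [h3, h4, h5, h6]
    ring
  intro a ha
  simp only [Set.mem_insert_iff, Set.mem_singleton_iff] at ha
  rcases ha with rfl | rfl | rfl | rfl | rfl
  all_goals simp only [map_sub, map_mul, map_pow, map_one, h0, h1, h2]
  · linear_combination e ^ 2 * hg + he
  · linear_combination -g ^ 2 * he
  · linear_combination -g * hwe
  · linear_combination -g * hwe - hwg
  · linear_combination hsq - e * hg

open MvPolynomial in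
theorem IsFusionFamily.idealEven_gens {m : ℕ} (hm : 2 ≤ m) {R : Type*} [CommRing R] {g e : R}
    {w : ℕ → ℕ → R} (h : IsFusionFamily (2 * m) g e w) (φ : MvPolynomial (Fin 3) ℤ →+* R)
    (h0 : φ (X 0) = g) (h1 : φ (X 1) = g * e) (h2 : φ (X 2) = w 0 1) :
    ∀ a ∈ ({X 0 ^ (2 * m) - 1, X 0 ^ 2 - X 1 ^ 2, X 2 * X 0 - X 2 * X 1,
      relFirst (2 * m / 2) (X 0) (X 1) (X 2), relSecond (2 * m / 2) (X 0) (X 1) (X 2)} :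
      Set (MvPolynomial (Fin 3) ℤ)), φ a = 0 := by
  have hwe := h.mul_e 0 1
  intro a ha
  simp only [Set.mem_insert_iff, Set.mem_singleton_iff, Nat.mul_div_cancel_left m Nat.two_pos] at ha
  rcases ha with rfl | rfl | rfl | rfl | rfl
  · rw [map_sub, map_pow, h0, h.pow_eq_one, map_one, sub_self]
  · rw [map_sub, map_pow, map_pow, h0, h1]
    linear_combination -g ^ 2 * h.sq_eq_one
  · rw [map_sub, map_mul, map_mul, h0, h1, h2]
    linear_combination -g * hwe
  · rw [map_relFirst, h0, h1, h2, h.relFirst_eq_zero (by omega)]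
  · rw [map_relSecond, h0, h1, h2, h.relSecond_eq_zero hm]

open MvPolynomial in
-- This is the case `m = 1`. The generator `z - zy` is `W(1) = y W(1)`. The last generator is `W(2)
-- = y² W(0)`, since `W(2) = z² - x - y`, `y² = 1` and `e = xy`.
theorem exists_isFusionFamily_idealTwo :
    ∃ e w, IsFusionFamily 2 (Ideal.Quotient.mk idealTwo (X 0)) e w ∧
      Ideal.Quotient.mk idealTwo (X 0) * e = Ideal.Quotient.mk idealTwo (X 1) ∧
      w 0 1 = Ideal.Quotient.mk idealTwo (X 2) := by
  have hmem {a : MvPolynomial (Fin 3) ℤ} (ha : a ∈ idealTwo) : Ideal.Quotient.mk idealTwo a = 0 :=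
    Ideal.Quotient.eq_zero_iff_mem.2 ha
  have h1 := hmem (Ideal.subset_span (by simp) : X 1 ^ 2 - 1 ∈ idealTwo)
  have h2 := hmem (Ideal.subset_span (by simp) : X 0 ^ 2 - X 1 ^ 2 ∈ idealTwo)
  have h3 := hmem (Ideal.subset_span (by simp) : X 2 * X 0 - X 2 * X 1 ∈ idealTwo)
  have h4 := hmem (Ideal.subset_span (by simp) : X 2 - X 2 * X 1 ∈ idealTwo)
  have h5 := hmem (Ideal.subset_span (by simp) :
    X 2 ^ 2 - X 0 - X 1 - X 0 * X 1 - 1 ∈ idealTwo)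
  simp only [map_sub, map_mul, map_pow, map_one] at h1 h2 h3 h4 h5
  generalize Ideal.Quotient.mk idealTwo (X 0) = x at *
  generalize Ideal.Quotient.mk idealTwo (X 1) = y at *
  generalize Ideal.Quotient.mk idealTwo (X 2) = z at *
  refine ⟨x ^ (2 * 1 - 1) * y, exists_isFusionFamily (m := 1) le_rfl ?_ ?_ ?_ rfl ?_ ?_⟩
  · linear_combination h1 + h2
  · linear_combination h2
  · linear_combination h3
  · simp only [fusionSeq]
    linear_combination h4
  · simp only [fusionSeq, Nat.sub_self, mul_one, Nat.reduceSub, pow_one]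
    linear_combination h5 - y * h2 - (1 + x * y + y) * h1

open MvPolynomial in
theorem exists_isFusionFamily_idealEven {m : ℕ} (hm : 2 ≤ m) :
    ∃ e w, IsFusionFamily (2 * m) (Ideal.Quotient.mk (idealEven (2 * m)) (X 0)) e w ∧
      Ideal.Quotient.mk (idealEven (2 * m)) (X 0) * e =
        Ideal.Quotient.mk (idealEven (2 * m)) (X 1) ∧
      w 0 1 = Ideal.Quotient.mk (idealEven (2 * m)) (X 2) := by
  have hmem {a : MvPolynomial (Fin 3) ℤ} (ha : a ∈ idealEven (2 * m)) :
      Ideal.Quotient.mk (idealEven (2 * m)) a = 0 := Ideal.Quotient.eq_zero_iff_mem.2 ha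
  have h1 := hmem (Ideal.subset_span (by simp) : X 0 ^ (2 * m) - 1 ∈ idealEven (2 * m))
  have h2 := hmem (Ideal.subset_span (by simp) : X 0 ^ 2 - X 1 ^ 2 ∈ idealEven (2 * m))
  have h3 := hmem (Ideal.subset_span (by simp) : X 2 * X 0 - X 2 * X 1 ∈ idealEven (2 * m))
  have h4 := hmem (Ideal.subset_span (by simp) :
    relFirst (2 * m / 2) (X 0) (X 1) (X 2) ∈ idealEven (2 * m))
  have h5 := hmem (Ideal.subset_span (by simp) :
    relSecond (2 * m / 2) (X 0) (X 1) (X 2) ∈ idealEven (2 * m))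
  rw [Nat.mul_div_cancel_left m Nat.two_pos] at h4 h5
  rw [map_relFirst] at h4
  rw [map_relSecond] at h5
  simp only [map_sub, map_mul, map_pow, map_one, sub_eq_zero] at h1 h2 h3
  exact exists_isFusionFamily_of_rel hm h1 h2 h3 h4 h5

open MvPolynomial KacPaljutkin in
theorem mainTheorem2 {k : Type u} [Field k] {n : ℕ} [NeZero n] (hn : Even n)
    (hchar : ¬ ringChar k ∣ 2 * n ^ 2) {q : k} (hq : IsPrimitiveRoot q n)
    {p : k} (hp : p ^ 2 = q) :
    (n = 2 → ∃ e : (MvPolynomial (Fin 3) ℤ ⧸ idealTwo) ≃+* GreenRing k (H hq),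
      e (Ideal.Quotient.mk idealTwo (X 0)) = (oneDim hq hp 1).cls ∧
      e (Ideal.Quotient.mk idealTwo (X 1)) = (oneDim hq hp (n + 1)).cls ∧
      e (Ideal.Quotient.mk idealTwo (X 2)) = (twoDim hq 0 1).cls) ∧
    (2 < n → ∃ e : (MvPolynomial (Fin 3) ℤ ⧸ idealEven n) ≃+* GreenRing k (H hq),
      e (Ideal.Quotient.mk (idealEven n) (X 0)) = (oneDim hq hp 1).cls ∧
      e (Ideal.Quotient.mk (idealEven n) (X 1)) = (oneDim hq hp (n + 1)).cls ∧
      e (Ideal.Quotient.mk (idealEven n) (X 2)) = (twoDim hq 0 1).cls) := by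
  have h2 : (2 : k) ≠ 0 := by
    intro h
    refine hchar (Dvd.dvd.mul_right ?_ _)
    exact (ringChar.spec k 2).1 (by exact_mod_cast h)
  constructor
  · intro h
    rw [cls_oneDim_one hp (by omega), cls_oneDim_add_one hp hn]
    subst h
    exact exists_green_equiv hp h2 hn rfl (fun h φ => h.idealTwo_gens φ)
      exists_isFusionFamily_idealTwo
  · intro h
    rw [cls_oneDim_one hp (by omega), cls_oneDim_add_one hp hn]
    obtain ⟨m, rfl⟩ := hn.two_dvd
    exact exists_green_equiv hp h2 hn rfl (fun h φ => h.idealEven_gens (by omega) φ)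
      (exists_isFusionFamily_idealEven (by omega))
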